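/- **Theorem 1.3 (ill-posedness in $H^{s_1,0}(\mathbb R^2)$, $s_1<-\tfrac12$).** For $s_1,s_2\in\mathbb R$ let $H^{s_1,s_2}(\mathbb R^2)$ be the space of complex-valued tempered distributions $f$ on $\mathbb R^2$ whose Fourier transform $\hat f(\xi,\eta)$ is a function with $$\|f\|_{H^{s_1,s_2}}=\big\|(1+|\xi|)^{s_1}(1+|\eta|)^{s_2}\hat f(\xi,\eta)\big\|_{L^2_{\xi\eta}}<\infty .$$ Let $\beta<0$, $\gamma>0$, and consider the Cauchy problem for the rotation-modified Kadomtsev–Petviashvili (RMKP) equation $$u_t-\beta\partial_x^3u+\partial_x(u^2)+\partial_x^{-1}\partial_y^2u-\gamma\partial_x^{-1}u=0,\qquad u(x,y,0)=u_0(x,y),$$ in its integral form $$u(t)=W(t)u_0-\int_0^tW(t-\tau)\,\partial_x\big(u(\tau)^2\big)\,d\tau ,\qquad \widehat{W(t)f}(\xi,\eta)=e^{it\phi(\xi,\eta)}\hat f(\xi,\eta),\quad \phi(\xi,\eta)=-\beta\xi^3-\frac{\eta^2+\gamma}{\xi}.$$ A smooth solution on $[0,T]$ is a solution $u$ of this integral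 equation for $t\in[0,T]$ with $u\in C([0,T];H^{m,m}(\mathbb R^2))$ for all $m\in\mathbb N$. Let $s_1<-\tfrac12$ and $T>0$. Let $(\Phi_t)_{t\in[0,T]}$ be any family of maps from $H^{s_1,0}(\mathbb R^2)$ to itself that is a solution map near zero, in the sense that for all $u_0$ in some neighbourhood of $0$ in $H^{s_1,0}(\mathbb R^2)$ one has $\Phi_t(u_0)=u(t)$ for all $t\in[0,T]$ whenever $u$ is a smooth solution on $[0,T]$ with $u(0)=u_0$. Then for every $t\in(0,T]$ the map $u_0\mapsto\Phi_t(u_0)$ is not $C^3$ (in the real Fréchet sense) at zero from $H^{s_1,0}(\mathbb R^2)$ to $H^{s_1,0}(\mathbb R^2)$. In particular, there is no $T>0$ for which the solution map $u_0\mapsto u(t)$, $t\in[0,T]$, is $C^3$ at zero from $H^{s_1,0}(\mathbb R^2)$ to itself. -/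

import Mathlib

open MeasureTheory Set Filter Topology
open scoped FourierTransform SchwartzMap ENNReal

noncomputable section

namespace RMKP

/-- The plane `ℝ²` with coordinates `x = z 0`, `y = z 1`. -/
abbrev Plane : Type := EuclideanSpace ℝ (Fin 2)

/-! Mathlib's Fourier transform is `𝓕 f k = ∫ exp (-2πi ⟨z, k⟩) f z dz`. The frequencies of the
normalization `(2π)⁻¹ ∫ exp (-i (x ξ + y η)) f` are `(ξ, η) = 2π k`; with this substitution both
transforms give the same `L²` norms and the same Fourier multipliers. -/

/-- The angular frequency `ξ` dual to `x`. -/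
def freqX (k : Plane) : ℝ := 2 * Real.pi * k 0

/-- The angular frequency `η` dual to `y`. -/
def freqY (k : Plane) : ℝ := 2 * Real.pi * k 1

/-! ### Anisotropic Sobolev spaces -/

/-- The weight `⟨ξ⟩^{s₁} ⟨η⟩^{s₂}` with `⟨a⟩ = 1 + |a|`. -/
def weight (s₁ s₂ : ℝ) (k : Plane) : ℝ :=
  (1 + |freqX k|) ^ s₁ * (1 + |freqY k|) ^ s₂

/-- `w = ⟨ξ⟩^{s₁} ⟨η⟩^{s₂} û`: the Fourier transform of the tempered distribution `u` is the
function `w / (⟨ξ⟩^{s₁} ⟨η⟩^{s₂})`. -/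
def IsWeightedTransform (s₁ s₂ : ℝ) (u : 𝓢'(Plane, ℂ)) (w : Lp ℂ 2 (volume : Measure Plane)) :
    Prop :=
  ∀ g : 𝓢(Plane, ℂ), (𝓕 u) g = ∫ k, g k * (((weight s₁ s₂ k)⁻¹ : ℝ) * w k)

theorem weight_pos (s₁ s₂ : ℝ) (k : Plane) : 0 < weight s₁ s₂ k := by
  unfold weight; positivity

theorem continuous_weight_inv (s₁ s₂ : ℝ) : Continuous fun k => (weight s₁ s₂ k)⁻¹ := by
  refine Continuous.inv₀ ?_ fun k => (weight_pos s₁ s₂ k).ne'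
  unfold weight freqX freqY
  refine Continuous.mul ?_ ?_ <;> refine Continuous.rpow_const (by fun_prop) fun k => Or.inl ?_ <;>
    positivity

theorem rpow_neg_le_aux (a b s : ℝ) (ha : |a| ≤ b) :
    ((1 + 2 * Real.pi * |a|) ^ s)⁻¹ ≤ (1 + 2 * Real.pi * b) ^ |s| := by
  have h1 : 1 ≤ 1 + 2 * Real.pi * |a| := by
    have : 0 ≤ 2 * Real.pi * |a| := by positivity
    linarith
  rw [← Real.rpow_neg (by linarith)]
  calc (1 + 2 * Real.pi * |a|) ^ (-s) ≤ (1 + 2 * Real.pi * |a|) ^ |s| :=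
        Real.rpow_le_rpow_of_exponent_le h1 (neg_le_abs s)
    _ ≤ _ := by
        apply Real.rpow_le_rpow (by linarith) _ (abs_nonneg s)
        gcongr

theorem weight_inv_le (s₁ s₂ : ℝ) : ∃ C r : ℝ, 0 ≤ C ∧
    ∀ k : Plane, (weight s₁ s₂ k)⁻¹ ≤ C * (1 + ‖k‖ ^ 2) ^ r := by
  have key : ∀ b : ℝ, 0 ≤ b → 1 + 2 * Real.pi * b ≤ (1 + 2 * Real.pi) * (1 + b ^ 2) := by
    intro b hb
    have := Real.pi_pos
    nlinarith [sq_nonneg (b - 1), mul_nonneg this.le (sq_nonneg (b - 1))]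
  refine ⟨(1 + 2 * Real.pi) ^ |s₁| * (1 + 2 * Real.pi) ^ |s₂|, |s₁| + |s₂|, by positivity,
    fun k => ?_⟩
  have hk : ∀ i, |k i| ≤ ‖k‖ := fun i => by simpa using PiLp.norm_apply_le k i
  have hf : ∀ i : Fin 2, |2 * Real.pi * k i| = 2 * Real.pi * |k i| := fun i => by
    rw [abs_mul, abs_of_pos (by positivity)]
  have hb : ∀ (i : Fin 2) (s : ℝ), ((1 + |2 * Real.pi * k i|) ^ s)⁻¹ ≤
      (1 + 2 * Real.pi) ^ |s| * (1 + ‖k‖ ^ 2) ^ |s| := fun i s => by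
    rw [hf, ← Real.mul_rpow (by positivity) (by positivity)]
    exact (rpow_neg_le_aux _ _ s (hk i)).trans
      (Real.rpow_le_rpow (by positivity) (key _ (norm_nonneg k)) (abs_nonneg s))
  unfold weight freqX freqY
  rw [mul_inv, Real.rpow_add (by positivity)]
  calc _ ≤ ((1 + 2 * Real.pi) ^ |s₁| * (1 + ‖k‖ ^ 2) ^ |s₁|) *
        ((1 + 2 * Real.pi) ^ |s₂| * (1 + ‖k‖ ^ 2) ^ |s₂|) := by
        gcongr
        · exact hb 0 s₁
        · exact hb 1 s₂
    _ = _ := by ring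

theorem integrable_weighted (s₁ s₂ : ℝ) (g : 𝓢(Plane, ℂ)) (w : Lp ℂ 2 (volume : Measure Plane)) :
    Integrable fun k => g k * (((weight s₁ s₂ k)⁻¹ : ℝ) * w k) := by
  obtain ⟨C, r, hC, h⟩ := weight_inv_le s₁ s₂
  have hg : Function.HasTemperateGrowth
      (fun x : Plane => (((1 + ‖x‖ ^ 2) ^ r : ℝ) : ℂ)) := by fun_prop
  have hL : MemLp (fun k => g k * ((weight s₁ s₂ k)⁻¹ : ℝ)) 2 (volume : Measure Plane) := by
    refine MemLp.of_le_mul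
      ((SchwartzMap.smulLeftCLM ℂ (fun x : Plane => (((1 + ‖x‖ ^ 2) ^ r : ℝ) : ℂ)) g).memLp 2)
      (c := C) ?_ (ae_of_all _ fun k => ?_)
    · exact (g.continuous.mul
        (Complex.continuous_ofReal.comp (continuous_weight_inv s₁ s₂))).aestronglyMeasurable
    · rw [SchwartzMap.smulLeftCLM_apply_apply hg, norm_smul, norm_mul, Complex.norm_real,
        Complex.norm_real, Real.norm_of_nonneg (inv_nonneg.2 (weight_pos s₁ s₂ k).le),
        Real.norm_of_nonneg (by positivity)]
      calc _ ≤ ‖g k‖ * (C * (1 + ‖k‖ ^ 2) ^ r) := by gcongr; exact h k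
        _ = _ := by ring
  refine (hL.integrable_mul (Lp.memLp w)).congr (ae_of_all _ fun k => ?_)
  simp only [Pi.mul_apply, mul_assoc]

theorem IsWeightedTransform.add {s₁ s₂ : ℝ} {u u' : 𝓢'(Plane, ℂ)}
    {w w' : Lp ℂ 2 (volume : Measure Plane)} (h : IsWeightedTransform s₁ s₂ u w)
    (h' : IsWeightedTransform s₁ s₂ u' w') : IsWeightedTransform s₁ s₂ (u + u') (w + w') := by
  intro g
  have e : (𝓕 (u + u')) g = (𝓕 u) g + (𝓕 u') g := rfl
  rw [e, h g, h' g,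
    ← integral_add (integrable_weighted s₁ s₂ g w) (integrable_weighted s₁ s₂ g w')]
  refine integral_congr_ae ?_
  filter_upwards [Lp.coeFn_add w w'] with k hk
  rw [hk, Pi.add_apply]
  ring

theorem IsWeightedTransform.smul {s₁ s₂ : ℝ} {u : 𝓢'(Plane, ℂ)}
    {w : Lp ℂ 2 (volume : Measure Plane)} (c : ℂ) (h : IsWeightedTransform s₁ s₂ u w) :
    IsWeightedTransform s₁ s₂ (c • u) (c • w) := by
  intro g
  have e : (𝓕 (c • u)) g = c * (𝓕 u) g := rfl
  rw [e, h g, ← integral_const_mul]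
  refine integral_congr_ae ?_
  filter_upwards [Lp.coeFn_smul c w] with k hk
  rw [hk, Pi.smul_apply, smul_eq_mul]
  ring

theorem IsWeightedTransform.zero (s₁ s₂ : ℝ) : IsWeightedTransform s₁ s₂ 0 0 := by
  intro g
  have e : (𝓕 (0 : 𝓢'(Plane, ℂ))) g = 0 := rfl
  rw [e]
  symm
  refine integral_eq_zero_of_ae ?_
  filter_upwards [Lp.coeFn_zero ℂ 2 (volume : Measure Plane)] with k hk
  rw [hk]
  simp

theorem IsWeightedTransform.eq_zero {s₁ s₂ : ℝ} {w : Lp ℂ 2 (volume : Measure Plane)}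
    (h : IsWeightedTransform s₁ s₂ 0 w) : w = 0 := by
  rw [Lp.eq_zero_iff_ae_eq_zero]
  have hz : ∀ᵐ k ∂(volume : Measure Plane), (((weight s₁ s₂ k)⁻¹ : ℝ) : ℂ) * w k = 0 := by
    apply ae_eq_zero_of_integral_contDiff_smul_eq_zero
    · simpa using! ((Lp.memLp w).locallyIntegrable (by norm_num)).continuous_smul
        (Complex.continuous_ofReal.comp (continuous_weight_inv s₁ s₂))
    · intro g g_smooth g_cpt
      have hg₁ : HasCompactSupport (Complex.ofRealCLM ∘ g) := g_cpt.comp_left rfl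
      have hg₂ : ContDiff ℝ (⊤ : ℕ∞) (Complex.ofRealCLM ∘ g) := by fun_prop
      have := h (hg₁.toSchwartzMap hg₂)
      have e : (𝓕 (0 : 𝓢'(Plane, ℂ))) (hg₁.toSchwartzMap hg₂) = 0 := rfl
      rw [e] at this
      simpa using this.symm
  filter_upwards [hz] with k hk
  have : (((weight s₁ s₂ k)⁻¹ : ℝ) : ℂ) ≠ 0 := by
    exact_mod_cast (inv_pos.2 (weight_pos s₁ s₂ k)).ne'
  simpa [(weight_pos s₁ s₂ k).ne'] using hk

theorem IsWeightedTransform.unique {s₁ s₂ : ℝ} {u : 𝓢'(Plane, ℂ)}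
    {w w' : Lp ℂ 2 (volume : Measure Plane)} (h : IsWeightedTransform s₁ s₂ u w)
    (h' : IsWeightedTransform s₁ s₂ u w') : w = w' := by
  have h2 := h.add (h'.smul (-1))
  have e : u + (-1 : ℂ) • u = 0 := by
    ext g
    change u g + (-1 : ℂ) * u g = 0
    ring
  rw [e] at h2
  have h3 := h2.eq_zero
  rwa [neg_one_smul, add_neg_eq_zero] at h3

/-- The complex-valued tempered distributions on `ℝ²` with `⟨ξ⟩^{s₁} ⟨η⟩^{s₂} û ∈ L²`. -/
def sobolevSubmodule (s₁ s₂ : ℝ) : Submodule ℂ 𝓢'(Plane, ℂ) where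
  carrier := {u | ∃ w, IsWeightedTransform s₁ s₂ u w}
  add_mem' := fun ⟨w, h⟩ ⟨w', h'⟩ => ⟨w + w', h.add h'⟩
  zero_mem' := ⟨0, IsWeightedTransform.zero s₁ s₂⟩
  smul_mem' := fun c _ ⟨w, h⟩ => ⟨c • w, h.smul c⟩

/-- The anisotropic Sobolev space `H^{s₁,s₂}(ℝ²)`. It is a separate type, and not a coerced
submodule, because it carries the Sobolev norm and not the topology of `𝓢'`. -/
def Sobolev (s₁ s₂ : ℝ) : Type := sobolevSubmodule s₁ s₂

instance (s₁ s₂ : ℝ) : AddCommGroup (Sobolev s₁ s₂) :=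
  inferInstanceAs (AddCommGroup (sobolevSubmodule s₁ s₂))

instance (s₁ s₂ : ℝ) : Module ℂ (Sobolev s₁ s₂) :=
  inferInstanceAs (Module ℂ (sobolevSubmodule s₁ s₂))

/-- The tempered distribution underlying an element of `H^{s₁,s₂}(ℝ²)`. -/
def Sobolev.toDistribution {s₁ s₂ : ℝ} (u : Sobolev s₁ s₂) : 𝓢'(Plane, ℂ) := u.1

/-- The function `⟨ξ⟩^{s₁} ⟨η⟩^{s₂} û ∈ L²` of `u ∈ H^{s₁,s₂}(ℝ²)`, linearly in `u`. -/
def Sobolev.weightedTransform (s₁ s₂ : ℝ) :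
    Sobolev s₁ s₂ →ₗ[ℂ] Lp ℂ 2 (volume : Measure Plane) where
  toFun u := u.2.choose
  map_add' u v :=
    (u + v : Sobolev s₁ s₂).2.choose_spec.unique (u.2.choose_spec.add v.2.choose_spec)
  map_smul' c u := (c • u : Sobolev s₁ s₂).2.choose_spec.unique (u.2.choose_spec.smul c)

theorem Sobolev.isWeightedTransform {s₁ s₂ : ℝ} (u : Sobolev s₁ s₂) :
    IsWeightedTransform s₁ s₂ u.toDistribution (Sobolev.weightedTransform s₁ s₂ u) :=
  u.2.choose_spec

theorem Sobolev.weightedTransform_injective (s₁ s₂ : ℝ) :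
    Function.Injective (Sobolev.weightedTransform s₁ s₂) := by
  rw [injective_iff_map_eq_zero]
  intro u hu
  have h := u.isWeightedTransform
  rw [hu] at h
  have h0 : 𝓕 u.toDistribution = 𝓕 (0 : 𝓢'(Plane, ℂ)) := by
    ext g
    rw [h g, IsWeightedTransform.zero s₁ s₂ g]
  have h1 : u.toDistribution = 0 := by
    simpa using congrArg (fun v : 𝓢'(Plane, ℂ) => 𝓕⁻ v) h0
  exact Subtype.ext h1

/-- `‖u‖_{H^{s₁,s₂}} = ‖⟨ξ⟩^{s₁} ⟨η⟩^{s₂} û‖_{L²}`. -/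
instance (s₁ s₂ : ℝ) : NormedAddCommGroup (Sobolev s₁ s₂) :=
  NormedAddCommGroup.induced (Sobolev s₁ s₂) (Lp ℂ 2 (volume : Measure Plane))
    (Sobolev.weightedTransform s₁ s₂) (Sobolev.weightedTransform_injective s₁ s₂)

instance (s₁ s₂ : ℝ) : NormedSpace ℂ (Sobolev s₁ s₂) :=
  NormedSpace.induced ℂ (Sobolev s₁ s₂) (Lp ℂ 2 (volume : Measure Plane))
    (Sobolev.weightedTransform s₁ s₂)

theorem Sobolev.norm_def {s₁ s₂ : ℝ} (u : Sobolev s₁ s₂) :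
    ‖u‖ = ‖Sobolev.weightedTransform s₁ s₂ u‖ := rfl

/-! ### The equation
`u_t - β ∂ₓ³ u + ∂ₓ (u²) + ∂ₓ⁻¹ ∂_y² u - γ ∂ₓ⁻¹ u = 0`, where `∂ₓ⁻¹` is the multiplier `1 / (iξ)`.
-/

/-- The phase `φ(ξ, η) = -β ξ³ - (η² + γ) / ξ`: on the Fourier side the linear part of the equation
reads `∂_t û = i φ û`. (The line `ξ = 0` is a null set.) -/
def phase (β γ : ℝ) (k : Plane) : ℝ :=
  -β * freqX k ^ 3 - (freqY k ^ 2 + γ) / freqX k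

/-- `u : [0,T] → L²(ℝ²)` is a smooth solution of the Cauchy problem on `[0, T]` with initial
value `u 0`: it is continuous from `[0, T]` to every `H^{m,m}(ℝ²)`, and it satisfies the integral
equation `u(t) = W(t) u(0) - ∫₀ᵗ W(t - τ) ∂ₓ(u(τ)²) dτ`, where `W(t)` is the Fourier multiplier
`exp (i t φ(ξ, η))`, written on the Fourier side. -/
structure IsSmoothSolution (β γ T : ℝ) (u : ℝ → Lp ℂ 2 (volume : Measure Plane)) : Prop where
  smooth : ∀ m : ℕ, ∃ v : ℝ → Sobolev m m, ContinuousOn v (Icc 0 T) ∧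
    ∀ t ∈ Icc 0 T, (v t).toDistribution = (u t : 𝓢'(Plane, ℂ))
  duhamel : ∀ t ∈ Icc 0 T, ∀ᵐ k : Plane,
    𝓕 (u t) k = Complex.exp (Complex.I * t * phase β γ k) * 𝓕 (u 0) k
      - ∫ τ in (0 : ℝ)..t, Complex.exp (Complex.I * (t - τ) * phase β γ k) *
          (Complex.I * freqX k * 𝓕 (fun z : Plane => (u τ z) ^ 2) k)

/-- `Φ` is a solution map on `[0, T]` near the origin of `H^{s₁,0}(ℝ²)`: for all `u₀` in a
neighbourhood of `0`, if the Cauchy problem with initial value `u₀` has a smooth solution `u` on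
`[0, T]`, then `Φ t u₀ = u(t)` for `t ∈ [0, T]`. The square of an element of `H^{s₁,0}` is not
defined for negative `s₁`; nothing is required of `Φ` at initial values without a smooth
solution. -/
def IsSolutionMap (β γ s₁ T : ℝ) (Φ : ℝ → Sobolev s₁ 0 → Sobolev s₁ 0) : Prop :=
  ∀ᶠ u₀ in 𝓝 (0 : Sobolev s₁ 0), ∀ u : ℝ → Lp ℂ 2 (volume : Measure Plane),
    IsSmoothSolution β γ T u → u₀.toDistribution = (u 0 : 𝓢'(Plane, ℂ)) →
      ∀ t ∈ Icc 0 T, (Φ t u₀).toDistribution = (u t : 𝓢'(Plane, ℂ))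

end RMKP

end

noncomputable section

namespace RMKP

/-! ### The third-order coefficient of a `C³` map -/

/-! Differentiability of order three at zero would force the third Taylor coefficient of the flow to
be a bounded cubic map from `H^{s₁,0}` to itself. This coefficient can be computed on analytic data,
and it is too large on suitable data concentrated near frequencies `ξ ≈ ±N`.

Computing the coefficient. Write `B` for the bilinear Duhamel operator and `L` for the free
evolution of `f`, both on the Fourier side. The derivative in the nonlinearity is controlled by a
Cauchy–Kovalevskaya argument: the weights `decay T t` lose exponential rate linearly in time, and
integrating that loss recovers exactly one factor `|k|` (`Adm.duhamelOp`). Hence small multiples `ε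
f` of data with exponentially decaying transform have smooth solutions on all of `[0, T]`
(`exists_solution`), with `U = ε L + ε² B(L,L) + 2 ε³ B(L,B(L,L)) + O(ε⁴)` (`solution_expansion`).
The solution map must agree with them, so `C³` regularity gives `‖2 B(L,B(L,L))‖ ≤ C ‖f‖³`
(`IsSolutionMap.exists_cubic_bound`).

Size of the coefficient. Let the transform of `f` be the indicator of two boxes of width `δ` in `ξ`
and half-height `h` in `η`, near `N` and near `-N`. For `β < 0` and `γ > 0` the quadratic resonance
`φ(p+q) - φ(p) - φ(q)` has no cancellation: it is `ξ(p+q) ξ(p) ξ(q)` times a factor at least `-3β`.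
The gap between the box near `N` and the reflection of the other keeps even the low-frequency output
away from `ξ = 0`, so quadratic interactions oscillate fast. The interaction of two positive
frequencies with a negative one is almost resonant, and its time integral is about `t`. Integrating
the inner Duhamel operator in time produces the multiplier `1/(-3β ξ(p) ξ(q))` approximately. It is
positive when the two positive frequencies interact first and negative for the two orderings in
which opposite signs interact first. The three orderings carry equal weight, so the total is `1 - 1
- 1` and does not cancel (`Regime.norm_cubicTerm_ge`).

Counting. Up to constants the cubic term is `(δh)²/N` on a set of volume `δh`, whence the `C³` bound
gives `(δh)² N^(-4s₁-2) ≤ B`. The near-resonance conditions permit `δh = N^(-3σ)` with `σ > 0`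
arbitrarily small (`eventually_regime`), and `-4s₁ - 2 > 0` exactly when `s₁ < -1/2`. -/

theorem eq_zero_of_cubic_isLittleO {F : Type*} [NormedAddCommGroup F] [NormedSpace ℝ F]
    {c₀ c₁ c₂ c₃ : F}
    (h : (fun ε : ℝ => c₀ + ε • c₁ + ε ^ 2 • c₂ + ε ^ 3 • c₃) =o[𝓝[>] 0] fun ε : ℝ => ε ^ 3) :
    c₃ = 0 := by
  have hk : ∀ m : ℝ, 0 < m →
      (fun ε : ℝ => c₀ + (m * ε) • c₁ + (m * ε) ^ 2 • c₂ + (m * ε) ^ 3 • c₃)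
        =o[𝓝[>] 0] fun ε : ℝ => ε ^ 3 := by
    intro m hm
    have ht : Tendsto (fun ε : ℝ => m * ε) (𝓝[>] 0) (𝓝[>] 0) := by
      refine tendsto_nhdsWithin_iff.2 ⟨?_, ?_⟩
      · have : Tendsto (fun ε : ℝ => m * ε) (𝓝 0) (𝓝 (m * 0)) := by
          exact (continuous_const.mul continuous_id).tendsto 0
        rw [mul_zero] at this
        exact this.mono_left nhdsWithin_le_nhds
      · filter_upwards [self_mem_nhdsWithin] with ε hε
        exact mul_pos hm hε
    refine (h.comp_tendsto ht).trans_isBigO ?_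
    refine Asymptotics.isBigO_of_le' (c := m ^ 3) _ fun ε => ?_
    simp only [Function.comp, mul_pow, norm_mul, norm_pow, Real.norm_of_nonneg hm.le]
    exact le_rfl
  -- The third difference with weights `1, -3, 3, -1` at `4ε, 3ε, 2ε, ε` annihilates quadratic
  -- polynomials and leaves `6 ε³ c₃`.
  have h6 := ((hk 4 (by norm_num)).sub ((hk 3 (by norm_num)).const_smul_left (3 : ℝ))).add
    (((hk 2 (by norm_num)).const_smul_left (3 : ℝ)).sub (hk 1 one_pos))
  have h7 : (fun ε : ℝ => ε ^ 3 • ((6 : ℝ) • c₃)) =o[𝓝[>] 0] fun ε : ℝ => ε ^ 3 := by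
    refine h6.congr_left fun ε => ?_
    simp only [Pi.smul_apply]
    module
  have h8 : (fun ε : ℝ => (6 : ℝ) • c₃) =o[𝓝[>] 0] fun _ : ℝ => (1 : ℝ) := by
    rw [Asymptotics.isLittleO_iff] at h7 ⊢
    intro c hc
    filter_upwards [h7 hc, self_mem_nhdsWithin] with ε hε hpos
    have hp : 0 < ‖ε ^ 3‖ := by
      rw [norm_pos_iff]; exact pow_ne_zero 3 (ne_of_gt hpos)
    rw [norm_smul] at hε
    have : ‖ε ^ 3‖ * ‖(6 : ℝ) • c₃‖ ≤ ‖ε ^ 3‖ * c := by linarith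
    simpa using le_of_mul_le_mul_left this hp
  rw [Asymptotics.isLittleO_one_iff, tendsto_const_nhds_iff] at h8
  simpa using h8

/-- If `Φ` is `C³` at `0`, then the third-order coefficients of its expansions along lines are
bounded by a multiple of the cube of the norm of the direction. -/
theorem exists_bound_cubic_coeff {E F : Type*} [NormedAddCommGroup E] [NormedSpace ℝ E]
    [NormedAddCommGroup F] [NormedSpace ℝ F] {Φ : E → F} (hΦ : ContDiffAt ℝ 3 Φ 0) :
    ∃ C : ℝ, ∀ (f : E) (A₁ A₂ A₃ : F),
      (fun ε : ℝ => Φ (ε • f) - (ε • A₁ + ε ^ 2 • A₂ + ε ^ 3 • A₃)) =o[𝓝[>] 0]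
        (fun ε : ℝ => ε ^ 3) → ‖A₃‖ ≤ C * ‖f‖ ^ 3 := by
  obtain ⟨u, hu, hc⟩ := hΦ.contDiffOn (m := 3) le_rfl (by simp)
  obtain ⟨r, hr, hru⟩ := Metric.mem_nhds_iff.1 hu
  set s : Set E := Metric.ball 0 r with hs
  have hcs : ContDiffOn ℝ 3 Φ s := hc.mono hru
  have h0s : (0 : E) ∈ s := Metric.mem_ball_self hr
  refine ⟨6⁻¹ * ‖iteratedFDerivWithin ℝ 3 Φ s 0‖, fun f A₁ A₂ A₃ hA => ?_⟩
  set L : ℝ →L[ℝ] E := ContinuousLinearMap.toSpanSingleton ℝ f with hL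
  have hLa : ∀ ε, L ε = ε • f := fun ε => by simp [hL]
  set s' : Set ℝ := L ⁻¹' s with hs'
  have hopen : IsOpen s' := Metric.isOpen_ball.preimage L.continuous
  have h0 : (0 : ℝ) ∈ s' := by simp [hs', h0s]
  have hconv : Convex ℝ s' := (convex_ball (0 : E) r).linear_preimage L.toLinearMap
  have hg : ContDiffOn ℝ (3 : ℕ) (Φ ∘ L) s' := by
    exact_mod_cast hcs.comp_continuousLinearMap L
  have ht := taylor_isLittleO hconv h0 hg
  rw [hopen.nhdsWithin_eq h0] at ht
  have hd : iteratedDerivWithin 3 (Φ ∘ L) s' 0 = iteratedFDerivWithin ℝ 3 Φ s 0 fun _ => f := by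
    rw [iteratedDerivWithin_eq_iteratedFDerivWithin,
      ContinuousLinearMap.iteratedFDerivWithin_comp_right L hcs Metric.isOpen_ball.uniqueDiffOn
        hopen.uniqueDiffOn (by simpa using h0s) (by norm_num)]
    simp [hLa]
  -- The given expansion and the Taylor polynomial on the line differ by a cubic polynomial that is
  -- `o(ε³)`. Its cubic coefficient therefore vanishes.
  have hz : A₃ - (6 : ℝ)⁻¹ • iteratedDerivWithin 3 (Φ ∘ L) s' 0 = 0 := by
    have h2 := (ht.mono nhdsWithin_le_nhds (l := 𝓝[>] 0)).sub
      (hA.congr_right fun ε => by rw [sub_zero])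
    refine eq_zero_of_cubic_isLittleO (c₀ := -(Φ ∘ L) 0)
      (c₁ := A₁ - iteratedDerivWithin 1 (Φ ∘ L) s' 0)
      (c₂ := A₂ - (2 : ℝ)⁻¹ • iteratedDerivWithin 2 (Φ ∘ L) s' 0) ?_
    refine (h2.congr_left fun ε => ?_).congr_right fun ε => by rw [sub_zero]
    simp only [taylorWithinEval_succ, taylor_within_zero_eval, Function.comp, hLa, sub_zero]
    norm_num
    module
  rw [sub_eq_zero.1 hz, norm_smul, hd, mul_assoc]
  have h6 : ‖(6 : ℝ)⁻¹‖ = 6⁻¹ := by norm_num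
  rw [h6]
  gcongr
  simpa using (iteratedFDerivWithin ℝ 3 Φ s 0).le_opNorm fun _ => f

/-! ### The Duhamel operator on the Fourier side -/

theorem continuous_freqX : Continuous freqX := by unfold freqX; fun_prop

theorem continuous_freqY : Continuous freqY := by unfold freqY; fun_prop

theorem measurable_phase (β γ : ℝ) : Measurable (phase β γ) := by
  unfold phase
  exact ((continuous_freqX.measurable.pow_const 3).const_mul _).sub
    (((continuous_freqY.measurable.pow_const 2).add_const _).div continuous_freqX.measurable)

theorem abs_freqX_le (k : Plane) : |freqX k| ≤ 2 * Real.pi * ‖k‖ := by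
  have h : |k 0| ≤ ‖k‖ := by simpa using PiLp.norm_apply_le k 0
  unfold freqX
  rw [abs_mul, abs_of_pos (by positivity)]
  gcongr

theorem norm_cexp_I_mul_mul (t φ : ℝ) : ‖Complex.exp (Complex.I * t * φ)‖ = 1 := by
  have : Complex.I * t * φ = ((t * φ : ℝ) : ℂ) * Complex.I := by push_cast; ring
  rw [this, Complex.norm_exp_ofReal_mul_I]

/-- The weight `(1 + |k|²)⁻²`, whose self-convolution it dominates. -/
def polyDecay (k : Plane) : ℝ := ((1 + ‖k‖ ^ 2) ^ 2)⁻¹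

theorem polyDecay_pos (k : Plane) : 0 < polyDecay k := by unfold polyDecay; positivity

theorem polyDecay_le_one (k : Plane) : polyDecay k ≤ 1 := by
  unfold polyDecay
  refine inv_le_one_of_one_le₀ ?_
  nlinarith [sq_nonneg ‖k‖]

theorem continuous_polyDecay : Continuous polyDecay := by
  unfold polyDecay
  exact Continuous.inv₀ (by fun_prop) fun k => by positivity

theorem integrable_polyDecay : Integrable polyDecay := by
  have h := integrable_rpow_neg_one_add_norm_sq (E := Plane) (μ := volume) (r := 4)
    (by simp; norm_num)
  refine h.congr (ae_of_all _ fun k => ?_)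
  simp only [polyDecay]
  rw [show (-4 / 2 : ℝ) = -((2 : ℕ) : ℝ) by norm_num, Real.rpow_neg (by positivity),
    Real.rpow_natCast]

/-- The triangle inequality gives `z ≤ 2 (x + y)`, hence `z² ≤ 8 (x² + y²)`, for the three brackets;
dividing by `x² y² z²` yields the claim. Each summand on the right is integrable in `l`, so
convolution preserves the weight. -/
theorem polyDecay_mul_le (k l : Plane) :
    polyDecay l * polyDecay (k - l) ≤ 8 * polyDecay k * (polyDecay l + polyDecay (k - l)) := by
  have hn : ‖k‖ ≤ ‖l‖ + ‖k - l‖ := by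
    simpa using norm_add_le l (k - l)
  unfold polyDecay
  set x := 1 + ‖l‖ ^ 2 with hx
  set y := 1 + ‖k - l‖ ^ 2 with hy
  set z := 1 + ‖k‖ ^ 2 with hz
  have hx0 : 0 < x := by positivity
  have hy0 : 0 < y := by positivity
  have hz0 : 0 < z := by positivity
  have h1 : z ≤ 2 * (x + y) := by
    have := norm_nonneg k
    have : ‖k‖ ^ 2 ≤ (‖l‖ + ‖k - l‖) ^ 2 := by gcongr
    nlinarith [sq_nonneg (‖l‖ - ‖k - l‖)]
  have h2 : z ^ 2 ≤ 8 * (x ^ 2 + y ^ 2) := by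
    have : z ^ 2 ≤ (2 * (x + y)) ^ 2 := by gcongr
    nlinarith [sq_nonneg (x - y)]
  have e : 8 * (z ^ 2)⁻¹ * ((x ^ 2)⁻¹ + (y ^ 2)⁻¹)
      = (8 * (x ^ 2 + y ^ 2)) / z ^ 2 * ((x ^ 2)⁻¹ * (y ^ 2)⁻¹) := by
    field_simp
    ring
  rw [e]
  refine le_mul_of_one_le_left (by positivity) ?_
  rw [le_div_iff₀ (by positivity)]
  linarith

/-- The weight controlling the Fourier transform of an analytic solution at time `t ∈ [0, T]`. -/
def decay (T t : ℝ) (k : Plane) : ℝ := Real.exp (-(2 - t / T) * ‖k‖) * polyDecay k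

theorem decay_pos (T t : ℝ) (k : Plane) : 0 < decay T t k :=
  mul_pos (Real.exp_pos _) (polyDecay_pos k)

theorem decay_mono {T t t' : ℝ} (hT : 0 < T) (h : t ≤ t') (k : Plane) :
    decay T t k ≤ decay T t' k := by
  unfold decay
  refine mul_le_mul_of_nonneg_right (Real.exp_le_exp.2 ?_) (polyDecay_pos k).le
  refine mul_le_mul_of_nonneg_right ?_ (norm_nonneg k)
  have : t / T ≤ t' / T := by gcongr
  linarith

theorem decay_le_exp_mul {T t : ℝ} (hT : 0 < T) (h : t ≤ T) (k : Plane) :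
    decay T t k ≤ Real.exp (-‖k‖) * polyDecay k := by
  refine (decay_mono hT h k).trans (le_of_eq ?_)
  unfold decay
  rw [div_self hT.ne']
  norm_num

theorem decay_le_polyDecay {T t : ℝ} (hT : 0 < T) (h : t ≤ T) (k : Plane) :
    decay T t k ≤ polyDecay k := by
  refine (decay_le_exp_mul hT h k).trans ?_
  refine mul_le_of_le_one_left (polyDecay_pos k).le ?_
  rw [Real.exp_le_one_iff]
  linarith [norm_nonneg k]

/-- The exponential factor is submultiplicative because its rate `2 - t/T` is nonnegative. The
integrability in `l` comes from the polynomial factor alone. -/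
theorem decay_mul_le {T t : ℝ} (hT : 0 < T) (h : t ≤ T) (k l : Plane) :
    decay T t l * decay T t (k - l) ≤ 8 * decay T t k * (polyDecay l + polyDecay (k - l)) := by
  have hn : ‖k‖ ≤ ‖l‖ + ‖k - l‖ := by
    simpa using norm_add_le l (k - l)
  have hc : 0 ≤ 2 - t / T := by
    have : t / T ≤ 1 := by rw [div_le_one hT]; exact h
    linarith
  have he : Real.exp (-(2 - t / T) * ‖l‖) * Real.exp (-(2 - t / T) * ‖k - l‖)
      ≤ Real.exp (-(2 - t / T) * ‖k‖) := by
    rw [← Real.exp_add]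
    refine Real.exp_le_exp.2 ?_
    nlinarith
  unfold decay
  calc _ = (Real.exp (-(2 - t / T) * ‖l‖) * Real.exp (-(2 - t / T) * ‖k - l‖)) *
        (polyDecay l * polyDecay (k - l)) := by ring
    _ ≤ Real.exp (-(2 - t / T) * ‖k‖) *
        (8 * polyDecay k * (polyDecay l + polyDecay (k - l))) :=
        mul_le_mul he (polyDecay_mul_le k l)
          (mul_nonneg (polyDecay_pos _).le (polyDecay_pos _).le) (Real.exp_pos _).le
    _ = _ := by ring

/-- A constant for which `decay * decay ≤ convConst • decay` (convolution on the left). -/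
def convConst : ℝ := 16 * ∫ k, polyDecay k

theorem convConst_nonneg : 0 ≤ convConst :=
  mul_nonneg (by norm_num) (integral_nonneg fun k => (polyDecay_pos k).le)

/-- Jointly measurable functions with `|a(t, k)| ≤ M decay(t, k)` for `t ∈ [0, T]`. -/
structure Adm (T M : ℝ) (a : ℝ → Plane → ℂ) : Prop where
  measurable : Measurable (Function.uncurry a)
  bound : ∀ t ∈ Icc 0 T, ∀ k, ‖a t k‖ ≤ M * decay T t k

/-- The convolution on the Fourier side at time `t`. -/
def convAt (a b : ℝ → Plane → ℂ) (t : ℝ) (k : Plane) : ℂ := ∫ l, a t l * b t (k - l)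

/-- The bilinear Duhamel operator on the Fourier side. -/
def duhamelOp (β γ : ℝ) (a b : ℝ → Plane → ℂ) (t : ℝ) (k : Plane) : ℂ :=
  -∫ τ in (0 : ℝ)..t, Complex.exp (Complex.I * (t - τ) * phase β γ k) *
    (Complex.I * freqX k * convAt a b τ k)

namespace Adm

variable {T M M' : ℝ} {a b c : ℝ → Plane → ℂ}

theorem measurable_at (ha : Adm T M a) (t : ℝ) : Measurable (a t) :=
  ha.measurable.comp measurable_prodMk_left

theorem add (ha : Adm T M a) (hb : Adm T M' b) : Adm T (M + M') fun t k => a t k + b t k where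
  measurable := ha.measurable.add hb.measurable
  bound t ht k := by
    refine (norm_add_le _ _).trans ?_
    rw [add_mul]
    exact add_le_add (ha.bound t ht k) (hb.bound t ht k)

theorem neg (ha : Adm T M a) : Adm T M fun t k => -a t k where
  measurable := ha.measurable.neg
  bound t ht k := by rw [norm_neg]; exact ha.bound t ht k

theorem sub (ha : Adm T M a) (hb : Adm T M' b) : Adm T (M + M') fun t k => a t k - b t k := by
  simpa only [sub_eq_add_neg] using ha.add hb.neg

theorem const_mul (ha : Adm T M a) (z : ℂ) : Adm T (‖z‖ * M) fun t k => z * a t k where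
  measurable := ha.measurable.const_mul z
  bound t ht k := by
    rw [norm_mul, mul_assoc]
    exact mul_le_mul_of_nonneg_left (ha.bound t ht k) (norm_nonneg z)

theorem mono (ha : Adm T M a) (h : M ≤ M') : Adm T M' a where
  measurable := ha.measurable
  bound t ht k := (ha.bound t ht k).trans (mul_le_mul_of_nonneg_right h (decay_pos _ _ _).le)

theorem congr_measurable (ha : Adm T M a) (hb : Measurable (Function.uncurry b))
    (h : ∀ t ∈ Icc 0 T, ∀ k, b t k = a t k) : Adm T M b where
  measurable := hb
  bound t ht k := by rw [h t ht k]; exact ha.bound t ht k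

theorem const_nonneg (hT : 0 < T) (ha : Adm T M a) : 0 ≤ M := by
  have h := (norm_nonneg _).trans (ha.bound 0 ⟨le_rfl, hT.le⟩ 0)
  exact nonneg_of_mul_nonneg_left h (decay_pos T 0 0)

theorem norm_mul_le (hT : 0 < T) (ha : Adm T M a) (hb : Adm T M' b) {t : ℝ} (ht : t ∈ Icc 0 T)
    (k l : Plane) : ‖a t l * b t (k - l)‖ ≤
      M * M' * 8 * decay T t k * (polyDecay l + polyDecay (k - l)) := by
  have hM := ha.const_nonneg hT
  have hM' := hb.const_nonneg hT
  rw [norm_mul]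
  calc _ ≤ (M * decay T t l) * (M' * decay T t (k - l)) :=
        mul_le_mul (ha.bound t ht l) (hb.bound t ht _) (norm_nonneg _)
          (mul_nonneg hM (decay_pos _ _ _).le)
    _ = M * M' * (decay T t l * decay T t (k - l)) := by ring
    _ ≤ M * M' * (8 * decay T t k * (polyDecay l + polyDecay (k - l))) :=
        mul_le_mul_of_nonneg_left (decay_mul_le hT ht.2 k l) (mul_nonneg hM hM')
    _ = _ := by ring

theorem integrable_mul (hT : 0 < T) (ha : Adm T M a) (hb : Adm T M' b) {t : ℝ}
    (ht : t ∈ Icc 0 T) (k : Plane) : Integrable fun l => a t l * b t (k - l) := by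
  refine Integrable.mono'
    ((integrable_polyDecay.add (integrable_polyDecay.comp_sub_left k)).const_mul
      (M * M' * 8 * decay T t k)) ?_ (ae_of_all _ fun l => ha.norm_mul_le hT hb ht k l)
  exact ((ha.measurable_at t).mul
    ((hb.measurable_at t).comp (measurable_const.sub measurable_id))).aestronglyMeasurable

theorem measurable_convAt (ha : Adm T M a) (hb : Adm T M' b) :
    Measurable (Function.uncurry (convAt a b)) := by
  have hm : StronglyMeasurable fun p : (ℝ × Plane) × Plane => a p.1.1 p.2 * b p.1.1 (p.1.2 - p.2) :=
    ((ha.measurable.comp (measurable_fst.fst.prodMk measurable_snd)).mul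
      (hb.measurable.comp (measurable_fst.fst.prodMk
        (measurable_fst.snd.sub measurable_snd)))).stronglyMeasurable
  exact (hm.integral_prod_right (ν := (volume : Measure Plane))).measurable

theorem norm_convAt_le (hT : 0 < T) (ha : Adm T M a) (hb : Adm T M' b) {t : ℝ}
    (ht : t ∈ Icc 0 T) (k : Plane) :
    ‖convAt a b t k‖ ≤ convConst * M * M' * decay T t k := by
  refine (norm_integral_le_of_norm_le
    ((integrable_polyDecay.add (integrable_polyDecay.comp_sub_left k)).const_mul
      (M * M' * 8 * decay T t k)) (ae_of_all _ fun l => ha.norm_mul_le hT hb ht k l)).trans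
    (le_of_eq ?_)
  have h1 : ∫ l, polyDecay (k - l) = ∫ l, polyDecay l := integral_sub_left_eq_self _ _ k
  rw [integral_const_mul]
  simp only [Pi.add_apply]
  rw [integral_add integrable_polyDecay (integrable_polyDecay.comp_sub_left k), h1]
  unfold convConst
  ring

end Adm

theorem measurable_duhamelOp {T M M' : ℝ} {a b : ℝ → Plane → ℂ} (β γ : ℝ) (ha : Adm T M a)
    (hb : Adm T M' b) : Measurable (Function.uncurry (duhamelOp β γ a b)) := by
  set G : (ℝ × Plane) × ℝ → ℂ := fun p =>
    Complex.exp (Complex.I * (p.1.1 - p.2) * phase β γ p.1.2) *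
      (Complex.I * freqX p.1.2 * convAt a b p.2 p.1.2) with hG
  have hφ : Measurable fun p : (ℝ × Plane) × ℝ => ((phase β γ p.1.2 : ℝ) : ℂ) :=
    Complex.measurable_ofReal.comp ((measurable_phase β γ).comp measurable_fst.snd)
  have hξ : Measurable fun p : (ℝ × Plane) × ℝ => ((freqX p.1.2 : ℝ) : ℂ) :=
    Complex.measurable_ofReal.comp (continuous_freqX.measurable.comp measurable_fst.snd)
  have h1 : Measurable fun p : (ℝ × Plane) × ℝ => (p.1.1 : ℂ) :=
    Complex.measurable_ofReal.comp measurable_fst.fst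
  have h2 : Measurable fun p : (ℝ × Plane) × ℝ => (p.2 : ℂ) :=
    Complex.measurable_ofReal.comp measurable_snd
  have hc : Measurable fun p : (ℝ × Plane) × ℝ => convAt a b p.2 p.1.2 :=
    (ha.measurable_convAt hb).comp (measurable_snd.prodMk measurable_fst.snd)
  have hGm : Measurable G :=
    (Complex.measurable_exp.comp (((h1.sub h2).const_mul _).mul hφ)).mul
      ((hξ.const_mul _).mul hc)
  -- The two one-sided pieces of the interval integral become integrals over the whole line of
  -- indicators of fixed measurable sets, so joint measurability passes through the integral. The
  -- second set is the one for negative `t`.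
  have hset : ∀ s : Set ((ℝ × Plane) × ℝ), MeasurableSet s →
      Measurable fun p : ℝ × Plane => ∫ τ, s.indicator G (p, τ) := fun s hs =>
    ((hGm.indicator hs).stronglyMeasurable.integral_prod_right' (ν := volume)).measurable
  have hs1 : MeasurableSet {p : (ℝ × Plane) × ℝ | 0 < p.2 ∧ p.2 ≤ p.1.1} :=
    (measurableSet_lt measurable_const measurable_snd).inter
      (measurableSet_le measurable_snd measurable_fst.fst)
  have hs2 : MeasurableSet {p : (ℝ × Plane) × ℝ | p.1.1 < p.2 ∧ p.2 ≤ 0} :=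
    (measurableSet_lt measurable_fst.fst measurable_snd).inter
      (measurableSet_le measurable_snd measurable_const)
  convert ((hset _ hs1).sub (hset _ hs2)).neg using 1
  ext ⟨t, k⟩
  simp only [Function.uncurry, duhamelOp, intervalIntegral, Pi.neg_apply, Pi.sub_apply]
  rw [← integral_indicator measurableSet_Ioc, ← integral_indicator measurableSet_Ioc]
  rfl

theorem norm_duhamel_integrand_le {T M M' : ℝ} {a b : ℝ → Plane → ℂ} (β γ : ℝ) (hT : 0 < T)
    (ha : Adm T M a) (hb : Adm T M' b) {τ : ℝ} (hτ : τ ∈ Icc 0 T) (t : ℝ) (k : Plane) :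
    ‖Complex.exp (Complex.I * (t - τ) * phase β γ k) *
      (Complex.I * freqX k * convAt a b τ k)‖ ≤
      2 * Real.pi * convConst * M * M' * (‖k‖ * decay T τ k) := by
  have hM := ha.const_nonneg hT
  have hM' := hb.const_nonneg hT
  have h := norm_cexp_I_mul_mul (t - τ) (phase β γ k)
  push_cast at h
  rw [norm_mul, h, one_mul, norm_mul, norm_mul, Complex.norm_I, one_mul, Complex.norm_real,
    Real.norm_eq_abs]
  calc _ ≤ (2 * Real.pi * ‖k‖) * (convConst * M * M' * decay T τ k) :=
        mul_le_mul (abs_freqX_le k) (ha.norm_convAt_le hT hb hτ k) (norm_nonneg _) (by positivity)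
    _ = _ := by ring

theorem intervalIntegrable_duhamel {T M M' : ℝ} {a b : ℝ → Plane → ℂ} (β γ : ℝ) (hT : 0 < T)
    (ha : Adm T M a) (hb : Adm T M' b) (r : ℝ) {t : ℝ} (ht : t ∈ Icc 0 T) (k : Plane) :
    IntervalIntegrable (fun τ : ℝ => Complex.exp (Complex.I * (r - τ) * phase β γ k) *
      (Complex.I * freqX k * convAt a b τ k)) volume 0 t := by
  have hM := ha.const_nonneg hT
  have hM' := hb.const_nonneg hT
  have hC := convConst_nonneg
  rw [intervalIntegrable_iff_integrableOn_Ioc_of_le ht.1]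
  refine Measure.integrableOn_of_bounded
    (M := 2 * Real.pi * convConst * M * M' * (‖k‖ * polyDecay k)) (by simp) ?_ ?_
  · have h1 : Measurable fun τ : ℝ => convAt a b τ k :=
      (ha.measurable_convAt hb).comp (measurable_id.prodMk measurable_const)
    have h2 : Measurable fun τ : ℝ => Complex.exp (Complex.I * (r - τ) * phase β γ k) := by
      fun_prop
    exact (h2.mul (h1.const_mul _)).aestronglyMeasurable
  · rw [ae_restrict_iff' measurableSet_Ioc]
    refine ae_of_all _ fun τ hτ => ?_
    have hτ' : τ ∈ Icc 0 T := ⟨hτ.1.le, hτ.2.trans ht.2⟩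
    refine (norm_duhamel_integrand_le β γ hT ha hb hτ' r k).trans ?_
    have := decay_le_polyDecay hT hτ'.2 k
    gcongr

/-- The norm of the Duhamel operator with respect to the weight `decay`. -/
def duhamelConst (T : ℝ) : ℝ := 2 * Real.pi * convConst * T

/-- The factor `ξ` costs `|k|`, but `∂_τ decay T τ k = (|k| / T) decay T τ k`, so `|k| decay` has
the primitive `T decay` and the derivative is regained by the time integration. No dispersion is
used: the propagator enters only through its modulus one. -/
theorem Adm.duhamelOp {T M M' : ℝ} {a b : ℝ → Plane → ℂ} (β γ : ℝ) (hT : 0 < T)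
    (ha : Adm T M a) (hb : Adm T M' b) :
    Adm T (duhamelConst T * M * M') (duhamelOp β γ a b) where
  measurable := measurable_duhamelOp β γ ha hb
  bound t ht k := by
    have hM := ha.const_nonneg hT
    have hM' := hb.const_nonneg hT
    have hC := convConst_nonneg
    set c := 2 * Real.pi * convConst * M * M' with hc
    have hc0 : 0 ≤ c := by positivity
    have hcont : Continuous fun τ => c * (‖k‖ * decay T τ k) := by
      unfold decay; fun_prop
    have hder : ∀ τ ∈ uIcc 0 t, HasDerivAt (fun τ => c * T * decay T τ k)
        (c * (‖k‖ * decay T τ k)) τ := by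
      intro τ _
      have h1 : HasDerivAt (fun τ : ℝ => -(2 - τ / T) * ‖k‖) (1 / T * ‖k‖) τ := by
        have := (((hasDerivAt_id τ).div_const T).const_sub 2).neg.mul_const ‖k‖
        simpa using this
      have h2 := ((h1.exp.mul_const (polyDecay k)).const_mul (c * T))
      refine h2.congr_deriv ?_
      unfold decay
      field_simp
    unfold RMKP.duhamelOp
    rw [norm_neg]
    refine (intervalIntegral.norm_integral_le_of_norm_le ht.1 (ae_of_all _ fun τ hτ =>
      norm_duhamel_integrand_le β γ hT ha hb ⟨hτ.1.le, hτ.2.trans ht.2⟩ t k)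
      (hcont.intervalIntegrable 0 t)).trans ?_
    rw [intervalIntegral.integral_eq_sub_of_hasDerivAt hder (hcont.intervalIntegrable 0 t)]
    have h0 : 0 ≤ c * T * decay T 0 k := mul_nonneg (mul_nonneg hc0 hT.le) (decay_pos _ _ _).le
    have e : duhamelConst T * M * M' = c * T := by rw [hc, duhamelConst]; ring
    rw [e]
    linarith

/-! ### Symmetry and bilinearity of the Duhamel operator -/

section bilinear

variable {T M M' M'' : ℝ} {a b c : ℝ → Plane → ℂ}

theorem duhamelOp_add_left (β γ : ℝ) (hT : 0 < T) (ha : Adm T M a) (hb : Adm T M' b)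
    (hc : Adm T M'' c) {t : ℝ} (ht : t ∈ Icc 0 T) (k : Plane) :
    duhamelOp β γ (fun t k => a t k + b t k) c t k =
      duhamelOp β γ a c t k + duhamelOp β γ b c t k := by
  unfold duhamelOp
  rw [← neg_add, ← intervalIntegral.integral_add (intervalIntegrable_duhamel β γ hT ha hc t ht k)
    (intervalIntegrable_duhamel β γ hT hb hc t ht k)]
  congr 1
  refine intervalIntegral.integral_congr fun τ hτ => ?_
  rw [uIcc_of_le ht.1] at hτ
  have hτ' : τ ∈ Icc 0 T := ⟨hτ.1, hτ.2.trans ht.2⟩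
  have : convAt (fun t k => a t k + b t k) c τ k = convAt a c τ k + convAt b c τ k := by
    unfold convAt
    rw [← integral_add (ha.integrable_mul hT hc hτ' k) (hb.integrable_mul hT hc hτ' k)]
    simp only [add_mul]
  simp only [this]
  ring

theorem convAt_comm (a b : ℝ → Plane → ℂ) (t : ℝ) (k : Plane) :
    convAt a b t k = convAt b a t k := by
  unfold convAt
  rw [← integral_sub_left_eq_self _ _ k]
  simp only [sub_sub_cancel, mul_comm]

theorem duhamelOp_comm (β γ : ℝ) (a b : ℝ → Plane → ℂ) (t : ℝ) (k : Plane) :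
    duhamelOp β γ a b t k = duhamelOp β γ b a t k := by
  unfold duhamelOp
  simp only [convAt_comm a b]

theorem duhamelOp_const_mul_left (β γ : ℝ) (z : ℂ) (a b : ℝ → Plane → ℂ) (t : ℝ) (k : Plane) :
    duhamelOp β γ (fun t k => z * a t k) b t k = z * duhamelOp β γ a b t k := by
  have : ∀ τ, convAt (fun t k => z * a t k) b τ k = z * convAt a b τ k := fun τ => by
    unfold convAt
    rw [← integral_const_mul]
    simp only [mul_assoc]
  unfold duhamelOp
  simp only [this]
  rw [mul_neg, ← intervalIntegral.integral_const_mul]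
  congr 2
  ext τ
  ring

theorem duhamelOp_congr (β γ : ℝ) {a' b' : ℝ → Plane → ℂ} (ha : ∀ t ∈ Icc 0 T, ∀ k, a t k = a' t k)
    (hb : ∀ t ∈ Icc 0 T, ∀ k, b t k = b' t k) {t : ℝ} (ht : t ∈ Icc 0 T) (k : Plane) :
    duhamelOp β γ a b t k = duhamelOp β γ a' b' t k := by
  unfold duhamelOp
  congr 1
  refine intervalIntegral.integral_congr fun τ hτ => ?_
  rw [uIcc_of_le ht.1] at hτ
  have hτ' : τ ∈ Icc 0 T := ⟨hτ.1, hτ.2.trans ht.2⟩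
  simp only [convAt, ha τ hτ', hb τ hτ']

/-- Difference of squares for a symmetric bilinear form. The contraction estimate, the passage to
the limit and the expansion in `ε` rest on it. -/
theorem duhamelOp_self_sub (β γ : ℝ) (hT : 0 < T) (ha : Adm T M a) (hb : Adm T M' b) {t : ℝ}
    (ht : t ∈ Icc 0 T) (k : Plane) :
    duhamelOp β γ a a t k - duhamelOp β γ b b t k =
      duhamelOp β γ (fun t k => a t k - b t k) (fun t k => a t k + b t k) t k := by
  have hd := ha.sub hb
  have e : duhamelOp β γ a (fun t k => a t k + b t k) t k =
      duhamelOp β γ (fun t k => a t k - b t k) (fun t k => a t k + b t k) t k +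
      duhamelOp β γ b (fun t k => a t k + b t k) t k := by
    rw [← duhamelOp_add_left β γ hT hd hb (ha.add hb) ht k]
    simp only [sub_add_cancel]
  rw [eq_sub_of_add_eq e.symm, duhamelOp_comm β γ a fun t k => a t k + b t k,
    duhamelOp_comm β γ b fun t k => a t k + b t k,
    duhamelOp_add_left β γ hT ha hb ha ht k, duhamelOp_add_left β γ hT ha hb hb ht k,
    duhamelOp_comm β γ a b]
  ring

end bilinear

/-! ### Small analytic solutions and their expansion -/

theorem duhamelConst_nonneg {T : ℝ} (hT : 0 < T) : 0 ≤ duhamelConst T := by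
  have := convConst_nonneg
  unfold duhamelConst
  positivity

/-- The Picard iterates of `U = ε L + duhamelOp U U`. -/
def picard (β γ ε : ℝ) (L : ℝ → Plane → ℂ) : ℕ → ℝ → Plane → ℂ
  | 0 => fun _ _ => 0
  | n + 1 => fun t k => ε * L t k + duhamelOp β γ (picard β γ ε L n) (picard β γ ε L n) t k

/-- The ball of radius `2Kε` is preserved: with `D = duhamelConst T`, the quadratic term is at most
`D (2Kε)² = (4DKε) Kε ≤ Kε / 2`. -/
theorem adm_picard {T K ε : ℝ} (β γ : ℝ) {L : ℝ → Plane → ℂ} (hT : 0 < T) (hL : Adm T K L)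
    (hε : 0 ≤ ε) (hs : 8 * duhamelConst T * K * ε ≤ 1) (n : ℕ) :
    Adm T (2 * K * ε) (picard β γ ε L n) := by
  have hK := hL.const_nonneg hT
  induction n with
  | zero =>
    exact ⟨measurable_const, fun t _ k => by
      simpa [picard] using mul_nonneg (by positivity) (decay_pos T t k).le⟩
  | succ n ih =>
    refine ((hL.const_mul (ε : ℂ)).add (ih.duhamelOp β γ hT ih)).mono ?_
    rw [Complex.norm_real, Real.norm_of_nonneg hε]
    have : 0 ≤ K * ε * (1 - 8 * duhamelConst T * K * ε) :=
      mul_nonneg (by positivity) (by linarith)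
    nlinarith [mul_nonneg hK hε]

/-- The sum of two iterates has size `4Kε`, so the contraction factor is `4DKε ≤ 1/2`. -/
theorem adm_picard_succ_sub {T K ε : ℝ} (β γ : ℝ) {L : ℝ → Plane → ℂ} (hT : 0 < T)
    (hL : Adm T K L) (hε : 0 ≤ ε) (hs : 8 * duhamelConst T * K * ε ≤ 1) (n : ℕ) :
    Adm T (K * ε * (1 / 2) ^ n) fun t k => picard β γ ε L (n + 1) t k - picard β γ ε L n t k := by
  have hK := hL.const_nonneg hT
  have hp := adm_picard β γ hT hL hε hs
  induction n with
  | zero =>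
    have h1 := hL.const_mul (ε : ℂ)
    rw [Complex.norm_real, Real.norm_of_nonneg hε] at h1
    refine (h1.mono (by simp [mul_comm])).congr_measurable ((hp 1).sub (hp 0)).measurable ?_
    intro t _ k
    simp [picard, duhamelOp, convAt]
  | succ n ih =>
    have h1 := ih.duhamelOp β γ hT ((hp (n + 1)).add (hp n))
    refine (h1.mono ?_).congr_measurable ((hp (n + 2)).sub (hp (n + 1))).measurable ?_
    · have h2 : 0 ≤ K * ε * (1 / 2) ^ n := by positivity
      rw [pow_succ]
      nlinarith [mul_le_mul_of_nonneg_left hs h2]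
    · intro t ht k
      rw [← duhamelOp_self_sub β γ hT (hp (n + 1)) (hp n) ht k]
      simp only [picard]
      ring

theorem exists_solution {T K ε : ℝ} (β γ : ℝ) {L : ℝ → Plane → ℂ} (hT : 0 < T)
    (hL : Adm T K L) (hε : 0 ≤ ε) (hs : 8 * duhamelConst T * K * ε ≤ 1) :
    ∃ U, Adm T (2 * K * ε) U ∧
      ∀ t ∈ Icc 0 T, ∀ k, U t k = ε * L t k + duhamelOp β γ U U t k := by
  have hK := hL.const_nonneg hT
  have hp := adm_picard β γ hT hL hε hs
  have hd := adm_picard_succ_sub β γ hT hL hε hs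
  have hd' : ∀ t ∈ Icc 0 T, ∀ k n, dist (picard β γ ε L n t k) (picard β γ ε L (n + 1) t k) ≤
      K * ε * decay T t k * (1 / 2) ^ n := by
    intro t ht k n
    rw [dist_comm, dist_eq_norm]
    refine ((hd n).bound t ht k).trans (le_of_eq ?_)
    ring
  -- The iterates are controlled only for `t ∈ [0, T]`. Cutting them off outside gives convergence
  -- at every `(t, k)`, hence a jointly measurable limit.
  have hlim : ∀ t k, ∃ z, Tendsto (fun n => (Icc 0 T).indicator
      (fun t => picard β γ ε L n t k) t) atTop (𝓝 z) := by
    intro t k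
    by_cases ht : t ∈ Icc 0 T
    · simp only [indicator_of_mem ht]
      exact cauchySeq_tendsto_of_complete
        (cauchySeq_of_le_geometric _ _ (by norm_num) (hd' t ht k))
    · simp only [indicator_of_notMem ht]
      exact ⟨0, tendsto_const_nhds⟩
  choose U hU using hlim
  have hU' : ∀ t ∈ Icc 0 T, ∀ k, Tendsto (fun n => picard β γ ε L n t k) atTop (𝓝 (U t k)) := by
    intro t ht k
    simpa only [indicator_of_mem ht] using hU t k
  have hmeas : Measurable (Function.uncurry U) := by
    refine measurable_of_tendsto_metrizable
      (f := fun n => (Prod.fst ⁻¹' Icc 0 T).indicator (Function.uncurry (picard β γ ε L n)))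
      (fun n => (hp n).measurable.indicator (measurable_fst measurableSet_Icc)) ?_
    rw [tendsto_pi_nhds]
    rintro ⟨t, k⟩
    exact hU t k
  have hAU : Adm T (2 * K * ε) U := ⟨hmeas, fun t ht k =>
    le_of_tendsto (hU' t ht k).norm (Eventually.of_forall fun n => (hp n).bound t ht k)⟩
  have hsub : ∀ n, Adm T (2 * K * ε * (1 / 2) ^ n) fun t k => picard β γ ε L n t k - U t k := by
    intro n
    refine ⟨(hp n).measurable.sub hmeas, fun t ht k => ?_⟩
    have := dist_le_of_le_geometric_of_tendsto _ _ (by norm_num) (hd' t ht k) (hU' t ht k) n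
    rw [dist_eq_norm] at this
    refine this.trans (le_of_eq ?_)
    ring
  refine ⟨U, hAU, fun t ht k => ?_⟩
  have hdu : Tendsto (fun n => duhamelOp β γ (picard β γ ε L n) (picard β γ ε L n) t k) atTop
      (𝓝 (duhamelOp β γ U U t k)) := by
    rw [tendsto_iff_norm_sub_tendsto_zero]
    refine squeeze_zero (g := fun n : ℕ => (duhamelConst T * (2 * K * ε) *
      (2 * K * ε + 2 * K * ε) * decay T t k) * (1 / 2) ^ n) (fun n => norm_nonneg _) (fun n => ?_) ?_
    · rw [duhamelOp_self_sub β γ hT (hp n) hAU ht k]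
      refine (((hsub n).duhamelOp β γ hT ((hp n).add hAU)).bound t ht k).trans (le_of_eq ?_)
      ring
    · simpa using (tendsto_pow_atTop_nhds_zero_of_lt_one (r := (1 / 2 : ℝ)) (by norm_num)
        (by norm_num)).const_mul _
  have h1 := (hU' t ht k).comp (tendsto_add_atTop_nat 1)
  exact tendsto_nhds_unique h1 (hdu.const_add _)

/-- The third-order term of the expansion of the solution `U = ε L + duhamelOp U U` in `ε`. -/
def cubicTerm (β γ : ℝ) (L : ℝ → Plane → ℂ) (t : ℝ) (k : Plane) : ℂ :=
  2 * duhamelOp β γ L (duhamelOp β γ L L) t k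

/-- Put `V = B(U,U)`, `A = B(L,L)` and `E = V - ε² A = B(V, U + ε L)`. Then `V = O(ε²)` and `E =
O(ε³)`, and the remainder is exactly `2ε B(L,E) + B(V,V)`. With `D = duhamelConst T` these two terms
account for `24 D³ K⁴` and `16 D³ K⁴`. -/
theorem solution_expansion {T K : ℝ} (β γ : ℝ) {L : ℝ → Plane → ℂ} (hT : 0 < T)
    (hL : Adm T K L) : ∃ C : ℝ, 0 ≤ C ∧ ∀ ε : ℝ, 0 ≤ ε → ∀ U, Adm T (2 * K * ε) U →
      (∀ t ∈ Icc 0 T, ∀ k, U t k = ε * L t k + duhamelOp β γ U U t k) →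
      ∀ t ∈ Icc 0 T, ∀ k, ‖U t k - (ε * L t k + ε ^ 2 * duhamelOp β γ L L t k +
        ε ^ 3 * cubicTerm β γ L t k)‖ ≤ C * ε ^ 4 * decay T t k := by
  have hK := hL.const_nonneg hT
  set D := duhamelConst T with hD
  have hD0 : 0 ≤ D := duhamelConst_nonneg hT
  refine ⟨24 * D ^ 3 * K ^ 4 + 16 * D ^ 3 * K ^ 4, by positivity,
    fun ε hε U hU hsol t ht k => ?_⟩
  have hnε : ‖(ε : ℂ)‖ = ε := by rw [Complex.norm_real, Real.norm_of_nonneg hε]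
  set V := duhamelOp β γ U U with hVdef
  set A := duhamelOp β γ L L with hAdef
  have hV : Adm T (D * (2 * K * ε) * (2 * K * ε)) V := hU.duhamelOp β γ hT hU
  have hεL : Adm T (ε * K) fun t k => ε * L t k := by simpa only [hnε] using hL.const_mul (ε : ℂ)
  have hAA : Adm T (D * K * K) A := hL.duhamelOp β γ hT hL
  have hsq : ∀ t k, duhamelOp β γ (fun t k => ε * L t k) (fun t k => ε * L t k) t k =
      ε ^ 2 * A t k := by
    intro t k
    rw [duhamelOp_const_mul_left, duhamelOp_comm, duhamelOp_const_mul_left]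
    ring
  have hE : Adm T (D * (D * (2 * K * ε) * (2 * K * ε)) * (2 * K * ε + ε * K))
      fun t k => V t k - ε ^ 2 * A t k := by
    refine (hV.duhamelOp β γ hT (hU.add hεL)).congr_measurable
      (hV.measurable.sub (hAA.measurable.const_mul _)) fun t ht k => ?_
    rw [← hsq, hVdef, duhamelOp_self_sub β γ hT hU hεL ht k]
    refine duhamelOp_congr β γ (fun t ht k => ?_) (fun t ht k => rfl) ht k
    rw [hsol t ht k]
    ring
  have hA2 : Adm T _ fun t k => (ε : ℂ) ^ 2 * A t k := hAA.const_mul _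
  -- Since `U = ε L + V`, the difference of squares is `B(U,U) - B(εL,εL) = B(V, 2εL + V)`.
  have e1 : V t k = ε ^ 2 * A t k + 2 * ε * duhamelOp β γ L V t k + duhamelOp β γ V V t k := by
    have h1 : V t k - duhamelOp β γ (fun t k => ε * L t k) (fun t k => ε * L t k) t k =
        duhamelOp β γ V (fun t k => (2 * ε) * L t k + V t k) t k := by
      rw [hVdef, duhamelOp_self_sub β γ hT hU hεL ht k]
      refine duhamelOp_congr β γ (fun t ht k => ?_) (fun t ht k => ?_) ht k <;>
      · rw [hsol t ht k]
        ring
    rw [hsq, duhamelOp_comm β γ V, duhamelOp_add_left β γ hT (hL.const_mul (2 * ε : ℂ)) hV hV ht k,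
      duhamelOp_const_mul_left, sub_eq_iff_eq_add] at h1
    rw [h1]
    ring
  have e2 : duhamelOp β γ L V t k = ε ^ 2 * duhamelOp β γ L A t k +
      duhamelOp β γ L (fun t k => V t k - ε ^ 2 * A t k) t k := by
    rw [duhamelOp_comm β γ L A, ← duhamelOp_const_mul_left, duhamelOp_comm β γ L,
      duhamelOp_comm β γ L, ← duhamelOp_add_left β γ hT hA2 hE hL ht k]
    simp only [add_sub_cancel]
  have e3 : U t k - (ε * L t k + ε ^ 2 * A t k + ε ^ 3 * cubicTerm β γ L t k) =
      2 * ε * duhamelOp β γ L (fun t k => V t k - ε ^ 2 * A t k) t k + duhamelOp β γ V V t k := by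
    rw [hsol t ht k, e1, e2, cubicTerm]
    ring
  rw [e3]
  have b1 := (hL.duhamelOp β γ hT hE).bound t ht k
  have b2 := (hV.duhamelOp β γ hT hV).bound t ht k
  refine (norm_add_le _ _).trans ?_
  rw [norm_mul, norm_mul, hnε, Complex.norm_ofNat]
  calc _ ≤ 2 * ε * _ + _ := add_le_add (mul_le_mul_of_nonneg_left b1 (by positivity)) b2
    _ = _ := by rw [← hD]; ring

/-- The Fourier transform of the free evolution `W(t) f`. -/
def freeEvol (β γ : ℝ) (f : Plane → ℂ) (t : ℝ) (k : Plane) : ℂ :=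
  Complex.exp (Complex.I * t * phase β γ k) * f k

theorem norm_freeEvol (β γ : ℝ) (f : Plane → ℂ) (t : ℝ) (k : Plane) :
    ‖freeEvol β γ f t k‖ = ‖f k‖ := by
  rw [freeEvol, norm_mul, norm_cexp_I_mul_mul, one_mul]

theorem measurable_freeEvol (β γ : ℝ) {f : Plane → ℂ} (hf : Measurable f) :
    Measurable (Function.uncurry (freeEvol β γ f)) := by
  have hφ : Measurable fun p : ℝ × Plane => ((phase β γ p.2 : ℝ) : ℂ) :=
    Complex.measurable_ofReal.comp ((measurable_phase β γ).comp measurable_snd)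
  have h1 : Measurable fun p : ℝ × Plane => (p.1 : ℂ) :=
    Complex.measurable_ofReal.comp measurable_fst
  exact (Complex.measurable_exp.comp ((h1.const_mul _).mul hφ)).mul (hf.comp measurable_snd)

theorem adm_freeEvol {T K : ℝ} (β γ : ℝ) {f : Plane → ℂ} (hT : 0 < T) (hf : Measurable f)
    (hK : ∀ k, ‖f k‖ ≤ K * decay T 0 k) : Adm T K (freeEvol β γ f) where
  measurable := measurable_freeEvol β γ hf
  bound t ht k := by
    rw [norm_freeEvol]
    have h0 : 0 ≤ K := nonneg_of_mul_nonneg_left ((norm_nonneg _).trans (hK 0)) (decay_pos T 0 0)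
    exact (hK k).trans (mul_le_mul_of_nonneg_left (decay_mono hT ht.1 k) h0)

/-! ### The Fourier transform of the square of an `L²` function -/

section pairing

variable {m : Plane → ℂ} {τ : Plane → Plane}

theorem memLp_comp (hτ : MeasurePreserving τ (volume : Measure Plane) volume)
    (v : Lp ℂ 2 (volume : Measure Plane)) : MemLp (fun z => v (τ z)) 2 volume :=
  (Lp.memLp v).comp_measurePreserving hτ

theorem memLp_bounded_mul (hm : Measurable m) (hm1 : ∀ z, ‖m z‖ ≤ 1)
    (u : Lp ℂ 2 (volume : Measure Plane)) : MemLp (fun z => m z * u z) 2 volume := by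
  refine (Lp.memLp u).of_le (hm.aestronglyMeasurable.mul (Lp.aestronglyMeasurable u))
    (ae_of_all _ fun z => ?_)
  rw [norm_mul]
  exact mul_le_of_le_one_left (norm_nonneg _) (hm1 z)

theorem integrable_pairing (hm : Measurable m) (hm1 : ∀ z, ‖m z‖ ≤ 1)
    (hτ : MeasurePreserving τ (volume : Measure Plane) volume)
    (u v : Lp ℂ 2 (volume : Measure Plane)) : Integrable fun z => (m z * u z) * v (τ z) :=
  (memLp_bounded_mul hm hm1 u).integrable_mul (memLp_comp hτ v)

theorem norm_integral_pairing_le (hm : Measurable m) (hm1 : ∀ z, ‖m z‖ ≤ 1)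
    (hτ : MeasurePreserving τ (volume : Measure Plane) volume)
    (u v : Lp ℂ 2 (volume : Measure Plane)) :
    ‖∫ z, (m z * u z) * v (τ z)‖ ≤ ‖u‖ * ‖v‖ := by
  have h1 := memLp_bounded_mul hm hm1 u
  have h2 := memLp_comp hτ v
  have h3 : eLpNorm (fun z => (m z * u z) * v (τ z)) 1 volume ≤
      eLpNorm u 2 volume * eLpNorm v 2 volume := by
    refine (eLpNorm_smul_le_mul_eLpNorm (p := 2) (q := 2) (r := 1) h2.1 h1.1).trans ?_
    refine mul_le_mul' ?_ (le_of_eq ?_)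
    · refine eLpNorm_mono fun z => ?_
      rw [norm_mul]
      exact mul_le_of_le_one_left (norm_nonneg _) (hm1 z)
    · exact eLpNorm_comp_measurePreserving (Lp.aestronglyMeasurable v) hτ
  have hi := integrable_pairing hm hm1 hτ u v
  calc ‖∫ z, (m z * u z) * v (τ z)‖ ≤ ∫ z, ‖(m z * u z) * v (τ z)‖ :=
        norm_integral_le_integral_norm _
    _ = (eLpNorm (fun z => (m z * u z) * v (τ z)) 1 volume).toReal := by
        rw [eLpNorm_one_eq_lintegral_enorm, integral_norm_eq_lintegral_enorm hi.1]
    _ ≤ (eLpNorm u 2 volume * eLpNorm v 2 volume).toReal :=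
        ENNReal.toReal_mono (ENNReal.mul_ne_top (Lp.eLpNorm_ne_top u) (Lp.eLpNorm_ne_top v)) h3
    _ = _ := by rw [ENNReal.toReal_mul, Lp.norm_def, Lp.norm_def]

/-- A bilinear form bounded by Cauchy–Schwarz, restricted to the diagonal. It serves both sides of
`fourier_sq_eq`: a character `m` with `τ = id`, and `m = 1` with `τ` the reflection `l ↦ k - l`. -/
theorem continuous_pairing (hm : Measurable m) (hm1 : ∀ z, ‖m z‖ ≤ 1)
    (hτ : MeasurePreserving τ (volume : Measure Plane) volume) :
    Continuous fun u : Lp ℂ 2 (volume : Measure Plane) => ∫ z, (m z * u z) * u (τ z) := by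
  have hq := hτ.quasiMeasurePreserving
  have hi := integrable_pairing hm hm1 hτ
  set B : Lp ℂ 2 (volume : Measure Plane) →ₗ[ℂ] Lp ℂ 2 (volume : Measure Plane) →ₗ[ℂ] ℂ :=
    LinearMap.mk₂ ℂ (fun u v => ∫ z, (m z * u z) * v (τ z))
      (by
        intro u u' v
        rw [← integral_add (hi u v) (hi u' v)]
        refine integral_congr_ae ?_
        filter_upwards [Lp.coeFn_add u u'] with z hz
        rw [hz, Pi.add_apply]
        ring)
      (by
        intro c u v
        rw [smul_eq_mul, ← integral_const_mul]
        refine integral_congr_ae ?_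
        filter_upwards [Lp.coeFn_smul c u] with z hz
        rw [hz, Pi.smul_apply, smul_eq_mul]
        ring)
      (by
        intro u v v'
        rw [← integral_add (hi u v) (hi u v')]
        refine integral_congr_ae ?_
        filter_upwards [hq.ae (Lp.coeFn_add v v')] with z hz
        rw [hz, Pi.add_apply]
        ring)
      (by
        intro c u v
        rw [smul_eq_mul, ← integral_const_mul]
        refine integral_congr_ae ?_
        filter_upwards [hq.ae (Lp.coeFn_smul c v)] with z hz
        rw [hz, Pi.smul_apply, smul_eq_mul]
        ring) with hB
  have e : ∀ u, (B.mkContinuous₂ 1 fun u v => by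
    rw [one_mul]
    exact norm_integral_pairing_le hm hm1 hτ u v) u u = ∫ z, (m z * u z) * u (τ z) := fun u => rfl
  simp only [← e]
  fun_prop

end pairing

theorem schwartz_fourier_fourier (f : 𝓢(Plane, ℂ)) (z : Plane) : 𝓕 (𝓕 f) z = f (-z) := by
  have h : (𝓕⁻ (𝓕 f)) (-z) = f (-z) := by rw [FourierTransform.fourierInv_fourier_eq]
  rw [← h, SchwartzMap.fourierInv_coe, SchwartzMap.fourier_coe (𝓕 f),
    Real.fourierInv_eq_fourier_neg, neg_neg]

/-- The convolution theorem applied to `𝓕 f`, whose transform is `f (-z)`, followed by Fourier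
inversion. -/
theorem schwartz_fourier_sq (f : 𝓢(Plane, ℂ)) (k : Plane) :
    𝓕 (fun z => f z ^ 2) k = ∫ l, 𝓕 f l * 𝓕 f (k - l) := by
  have h := SchwartzMap.convolution_apply (ContinuousLinearMap.mul ℂ ℂ) (𝓕 f) (𝓕 f) k
  have h2 : (MeasureTheory.convolution (⇑(𝓕 f : 𝓢(Plane, ℂ))) (⇑(𝓕 f : 𝓢(Plane, ℂ)))
      (ContinuousLinearMap.mul ℂ ℂ) volume) k =
    ∫ l, 𝓕 f l * 𝓕 f (k - l) := rfl
  rw [← h2]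
  refine Eq.trans ?_ h
  have h3 : SchwartzMap.convolution (ContinuousLinearMap.mul ℂ ℂ) (𝓕 f) (𝓕 f) =
      𝓕⁻ (SchwartzMap.pairing (ContinuousLinearMap.mul ℂ ℂ) (𝓕 (𝓕 f)) (𝓕 (𝓕 f))) := by
    rw [← SchwartzMap.fourier_convolution, FourierTransform.fourierInv_fourier_eq]
  rw [h3, SchwartzMap.fourierInv_coe, Real.fourierInv_eq_fourier_comp_neg]
  refine congrArg (fun g : Plane → ℂ => 𝓕 g k) (funext fun z => ?_)
  simp [schwartz_fourier_fourier, sq]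

theorem measurePreserving_const_sub (k : Plane) :
    MeasurePreserving (fun l : Plane => k - l) volume volume :=
  Measure.measurePreserving_sub_left volume k

/-- For fixed `k` both sides are continuous quadratic functions of `u ∈ L²`, the right one by
Plancherel, and they agree on the dense Schwartz class. The square is integrable, so the identity
holds at every `k` and not only almost everywhere. -/
theorem fourier_sq_eq (u : Lp ℂ 2 (volume : Measure Plane)) (k : Plane) :
    𝓕 (fun z : Plane => (u z) ^ 2) k = ∫ l, 𝓕 u l * 𝓕 u (k - l) := by
  have hm : Measurable fun z : Plane => ((Real.fourierChar (-(inner ℝ z k)) : Circle) : ℂ) := by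
    have : Continuous fun z : Plane => ((Real.fourierChar (-(inner ℝ z k)) : Circle) : ℂ) := by
      fun_prop
    exact this.measurable
  have c1 := continuous_pairing hm (fun z => (Circle.norm_coe _).le) (MeasurePreserving.id volume)
  have c2 := (continuous_pairing (m := fun _ => 1) measurable_const (fun z => by simp)
    (measurePreserving_const_sub k)).comp
    (FourierTransform.fourierCLM ℂ (Lp ℂ 2 (volume : Measure Plane))).continuous
  have e1 : ∀ u : Lp ℂ 2 (volume : Measure Plane), 𝓕 (fun z : Plane => (u z) ^ 2) k =
      ∫ z, (((Real.fourierChar (-(inner ℝ z k)) : Circle) : ℂ) * u z) * u (id z) := by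
    intro u
    rw [Real.fourier_eq]
    refine integral_congr_ae (ae_of_all _ fun z => ?_)
    simp only [Circle.smul_def, smul_eq_mul, id]
    ring
  have hd := SchwartzMap.denseRange_toLpCLM (E := Plane) (F := ℂ) (p := 2)
    (μ := (volume : Measure Plane)) ENNReal.ofNat_ne_top
  rw [e1]
  refine DenseRange.induction_on (p := fun u : Lp ℂ 2 (volume : Measure Plane) =>
    ∫ z, (((Real.fourierChar (-(inner ℝ z k)) : Circle) : ℂ) * u z) * u (id z) =
      ∫ l, 𝓕 u l * 𝓕 u (k - l)) hd u ?_ ?_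
  · refine isClosed_eq c1 ?_
    refine c2.congr fun u => ?_
    simp only [Function.comp, one_mul]
    rfl
  · intro f
    change ∫ z, (((Real.fourierChar (-(inner ℝ z k)) : Circle) : ℂ) * f.toLp 2 volume z) *
      f.toLp 2 volume (id z) = ∫ l, 𝓕 (f.toLp 2 volume) l * 𝓕 (f.toLp 2 volume) (k - l)
    rw [← e1]
    have h1 : 𝓕 (fun z : Plane => (f.toLp 2 volume z) ^ 2) k = 𝓕 (fun z : Plane => (f z) ^ 2) k := by
      rw [Real.fourier_eq, Real.fourier_eq]
      refine integral_congr_ae ?_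
      filter_upwards [f.coeFn_toLp 2 volume] with z hz
      rw [hz]
    rw [h1, schwartz_fourier_sq, SchwartzMap.toLp_fourier_eq]
    refine integral_congr_ae ?_
    filter_upwards [(𝓕 f).coeFn_toLp 2 volume,
      (measurePreserving_const_sub k).quasiMeasurePreserving.ae ((𝓕 f).coeFn_toLp 2 volume)]
      with l hl hl'
    rw [hl, hl']

/-! ### Functions and distributions with a given Fourier transform -/

open Classical in
/-- The `L²` function whose Fourier transform is the square integrable function `g`. -/
def ofFourier (g : Plane → ℂ) : Lp ℂ 2 (volume : Measure Plane) :=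
  if h : MemLp g 2 volume then 𝓕⁻ (h.toLp g) else 0

theorem fourier_ofFourier {g : Plane → ℂ} (h : MemLp g 2 volume) :
    𝓕 (ofFourier g) = h.toLp g := by
  rw [ofFourier, dif_pos h, FourierTransform.fourier_fourierInv_eq]

theorem fourier_ofFourier_ae {g : Plane → ℂ} (h : MemLp g 2 volume) :
    (𝓕 (ofFourier g) : Lp ℂ 2 (volume : Measure Plane)) =ᵐ[volume] g := by
  rw [fourier_ofFourier h]
  exact h.coeFn_toLp

theorem isWeightedTransform_ofFourier {s₁ s₂ : ℝ} {g : Plane → ℂ} (h : MemLp g 2 volume)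
    (hw : MemLp (fun k => (weight s₁ s₂ k : ℂ) * g k) 2 volume) :
    IsWeightedTransform s₁ s₂ (ofFourier g : 𝓢'(Plane, ℂ)) (hw.toLp _) := by
  intro φ
  rw [Lp.fourier_toTemperedDistribution_eq, fourier_ofFourier h, Lp.toTemperedDistribution_apply]
  refine integral_congr_ae ?_
  filter_upwards [h.coeFn_toLp, hw.coeFn_toLp] with k hk hk'
  rw [hk, hk', smul_eq_mul, ← mul_assoc, ← mul_assoc]
  have : ((weight s₁ s₂ k : ℝ) : ℂ) ≠ 0 := by exact_mod_cast (weight_pos s₁ s₂ k).ne'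
  push_cast
  rw [mul_assoc (φ k), inv_mul_cancel₀ this, mul_one]

open Classical in
/-- The element of `H^{s₁,s₂}` whose Fourier transform is `g`. -/
def sobolevOf (s₁ s₂ : ℝ) (g : Plane → ℂ) : Sobolev s₁ s₂ :=
  if h : MemLp g 2 volume ∧ MemLp (fun k => (weight s₁ s₂ k : ℂ) * g k) 2 volume then
    ⟨(ofFourier g : 𝓢'(Plane, ℂ)), _, isWeightedTransform_ofFourier h.1 h.2⟩
  else 0

theorem toDistribution_sobolevOf {s₁ s₂ : ℝ} {g : Plane → ℂ} (h : MemLp g 2 volume)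
    (hw : MemLp (fun k => (weight s₁ s₂ k : ℂ) * g k) 2 volume) :
    (sobolevOf s₁ s₂ g).toDistribution = (ofFourier g : 𝓢'(Plane, ℂ)) := by
  have e : sobolevOf s₁ s₂ g = ⟨(ofFourier g : 𝓢'(Plane, ℂ)), _,
      isWeightedTransform_ofFourier h hw⟩ := dif_pos ⟨h, hw⟩
  rw [e]
  rfl

theorem weightedTransform_sobolevOf {s₁ s₂ : ℝ} {g : Plane → ℂ} (h : MemLp g 2 volume)
    (hw : MemLp (fun k => (weight s₁ s₂ k : ℂ) * g k) 2 volume) :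
    Sobolev.weightedTransform s₁ s₂ (sobolevOf s₁ s₂ g) = hw.toLp _ := by
  have h1 := (sobolevOf s₁ s₂ g).isWeightedTransform
  rw [toDistribution_sobolevOf h hw] at h1
  exact h1.unique (isWeightedTransform_ofFourier h hw)

theorem norm_sq_toLp {g : Plane → ℂ} (h : MemLp g 2 volume) :
    ‖h.toLp g‖ ^ 2 = ∫ k, ‖g k‖ ^ 2 := by
  have h1 := L2.inner_def (𝕜 := ℂ) (h.toLp g) (h.toLp g)
  rw [inner_self_eq_norm_sq_to_K] at h1
  have h2 : ∫ k, inner ℂ (h.toLp g k) (h.toLp g k) = ((∫ k, ‖g k‖ ^ 2 : ℝ) : ℂ) := by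
    rw [← integral_complex_ofReal]
    refine integral_congr_ae ?_
    filter_upwards [h.coeFn_toLp] with k hk
    rw [hk, inner_self_eq_norm_sq_to_K]
    push_cast
    rfl
  rw [h2] at h1
  exact Complex.ofReal_injective (by push_cast; exact h1)

/-! ### Sobolev regularity and continuity in time of functions below the analytic weight -/

theorem memLp_polyDecay : MemLp polyDecay 2 volume := by
  rw [memLp_two_iff_integrable_sq continuous_polyDecay.aestronglyMeasurable]
  refine integrable_polyDecay.mono' (continuous_polyDecay.pow 2).aestronglyMeasurable
    (ae_of_all _ fun k => ?_)
  rw [Real.norm_of_nonneg (sq_nonneg _), sq]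
  exact mul_le_of_le_one_left (polyDecay_pos k).le (polyDecay_le_one k)

theorem memLp_of_le_polyDecay {g : Plane → ℂ} {C : ℝ} (hg : Measurable g)
    (h : ∀ k, ‖g k‖ ≤ C * polyDecay k) : MemLp g 2 volume :=
  memLp_polyDecay.of_le_mul hg.aestronglyMeasurable (c := C) (ae_of_all _ fun k => by
    rw [Real.norm_of_nonneg (polyDecay_pos k).le]
    exact h k)

theorem continuous_weight (s₁ s₂ : ℝ) : Continuous (weight s₁ s₂) := by
  have := (continuous_weight_inv s₁ s₂).inv₀ fun k => inv_ne_zero (weight_pos s₁ s₂ k).ne'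
  exact this.congr fun k => inv_inv _

theorem exists_weight_mul_exp_le (m : ℕ) :
    ∃ C, 0 ≤ C ∧ ∀ k, weight m m k * Real.exp (-‖k‖) ≤ C := by
  refine ⟨(2 * Real.pi) ^ (2 * m) * ((2 * m).factorial * Real.exp 1), by positivity, fun k => ?_⟩
  have hY : |freqY k| ≤ 2 * Real.pi * ‖k‖ := by
    have h : |k 1| ≤ ‖k‖ := by simpa using PiLp.norm_apply_le k 1
    unfold freqY
    rw [abs_mul, abs_of_pos (by positivity)]
    gcongr
  have hX := abs_freqX_le k
  have hpi : 1 ≤ 2 * Real.pi := by linarith [Real.pi_gt_three]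
  have h1 : ∀ x : ℝ, |x| ≤ 2 * Real.pi * ‖k‖ → 1 + |x| ≤ 2 * Real.pi * (1 + ‖k‖) := by
    intro x hx; linarith
  have h2 : weight m m k ≤ (2 * Real.pi * (1 + ‖k‖)) ^ (2 * m) := by
    unfold weight
    rw [Real.rpow_natCast, Real.rpow_natCast, two_mul m, pow_add]
    gcongr
    · exact h1 _ hX
    · exact h1 _ hY
  have h3 := Real.pow_div_factorial_le_exp (1 + ‖k‖) (by positivity) (2 * m)
  rw [div_le_iff₀ (by positivity)] at h3
  have h4 : Real.exp (1 + ‖k‖) * Real.exp (-‖k‖) = Real.exp 1 := by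
    rw [← Real.exp_add]; ring_nf
  calc weight m m k * Real.exp (-‖k‖)
      ≤ (2 * Real.pi * (1 + ‖k‖)) ^ (2 * m) * Real.exp (-‖k‖) := by gcongr
    _ = (2 * Real.pi) ^ (2 * m) * ((1 + ‖k‖) ^ (2 * m) * Real.exp (-‖k‖)) := by
        rw [mul_pow]; ring
    _ ≤ (2 * Real.pi) ^ (2 * m) *
        ((Real.exp (1 + ‖k‖) * (2 * m).factorial) * Real.exp (-‖k‖)) := by gcongr
    _ = _ := by rw [mul_right_comm, h4]; ring

theorem weight_le_one {s : ℝ} (hs : s ≤ 0) (k : Plane) : weight s 0 k ≤ 1 := by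
  unfold weight
  rw [Real.rpow_zero, mul_one]
  exact Real.rpow_le_one_of_one_le_of_nonpos (by linarith [abs_nonneg (freqX k)]) hs

namespace Adm

variable {T M : ℝ} {a : ℝ → Plane → ℂ}

theorem memLp (hT : 0 < T) (ha : Adm T M a) {t : ℝ} (ht : t ∈ Icc 0 T) :
    MemLp (a t) 2 volume := by
  have hM := ha.const_nonneg hT
  exact memLp_of_le_polyDecay (ha.measurable_at t) fun k => (ha.bound t ht k).trans
    (mul_le_mul_of_nonneg_left (decay_le_polyDecay hT ht.2 k) hM)

theorem measurable_weight_mul (ha : Adm T M a) (s₁ s₂ : ℝ) (t : ℝ) :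
    Measurable fun k => (weight s₁ s₂ k : ℂ) * a t k :=
  (Complex.measurable_ofReal.comp (continuous_weight s₁ s₂).measurable).mul (ha.measurable_at t)

/-- The exponential rate `2 - t/T` stays at least `1` on `[0, T]`, so `exp (-‖k‖)` absorbs the
Sobolev weight uniformly in time, and `polyDecay` remains for square integrability. -/
theorem exists_weight_bound (hT : 0 < T) (ha : Adm T M a) (m : ℕ) :
    ∃ C, ∀ t ∈ Icc 0 T, ∀ k, ‖(weight m m k : ℂ) * a t k‖ ≤ C * polyDecay k := by
  have hM := ha.const_nonneg hT
  obtain ⟨C, hC, h⟩ := exists_weight_mul_exp_le m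
  refine ⟨C * M, fun t ht k => ?_⟩
  have hw := (weight_pos m m k).le
  have hp := (polyDecay_pos k).le
  rw [norm_mul, Complex.norm_real, Real.norm_of_nonneg hw]
  calc weight m m k * ‖a t k‖ ≤ weight m m k * (M * (Real.exp (-‖k‖) * polyDecay k)) := by
        gcongr
        exact (ha.bound t ht k).trans
          (mul_le_mul_of_nonneg_left (decay_le_exp_mul hT ht.2 k) hM)
    _ = (weight m m k * Real.exp (-‖k‖)) * (M * polyDecay k) := by ring
    _ ≤ C * (M * polyDecay k) := by gcongr; exact h k
    _ = _ := by ring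

theorem memLp_weight_mul (hT : 0 < T) (ha : Adm T M a) (m : ℕ) {t : ℝ} (ht : t ∈ Icc 0 T) :
    MemLp (fun k => (weight m m k : ℂ) * a t k) 2 volume := by
  obtain ⟨C, hC⟩ := ha.exists_weight_bound hT m
  exact memLp_of_le_polyDecay (ha.measurable_weight_mul m m t) (hC t ht)

theorem norm_weight_mul_le {s : ℝ} (hs : s ≤ 0) (k : Plane) (z : ℂ) :
    ‖(weight s 0 k : ℂ) * z‖ ≤ ‖z‖ := by
  rw [norm_mul, Complex.norm_real, Real.norm_of_nonneg (weight_pos s 0 k).le]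
  exact mul_le_of_le_one_left (norm_nonneg _) (weight_le_one hs k)

theorem memLp_weight_mul_of_nonpos (hT : 0 < T) (ha : Adm T M a) {s : ℝ} (hs : s ≤ 0) {t : ℝ}
    (ht : t ∈ Icc 0 T) : MemLp (fun k => (weight s 0 k : ℂ) * a t k) 2 volume :=
  (ha.memLp hT ht).of_le (ha.measurable_weight_mul s 0 t).aestronglyMeasurable
    (ae_of_all _ fun k => norm_weight_mul_le hs k _)

/-- Dominated convergence: pointwise continuity in `t` suffices, because `exists_weight_bound` gives
a square integrable majorant independent of `t`. -/
theorem continuousOn_sobolevOf (hT : 0 < T) (ha : Adm T M a)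
    (hc : ∀ k, ContinuousOn (fun t => a t k) (Icc 0 T)) (m : ℕ) :
    ContinuousOn (fun t => sobolevOf m m (a t)) (Icc 0 T) := by
  intro t₀ ht₀
  rw [ContinuousWithinAt, tendsto_iff_norm_sub_tendsto_zero]
  obtain ⟨C, hC⟩ := ha.exists_weight_bound hT m
  set w : ℝ → Plane → ℂ := fun t k => (weight m m k : ℂ) * a t k with hw
  have hsq : ∀ t ∈ Icc 0 T, ‖sobolevOf m m (a t) - sobolevOf m m (a t₀)‖ =
      √(∫ k, ‖w t k - w t₀ k‖ ^ 2) := by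
    intro t ht
    have e : ∫ k, ‖w t k - w t₀ k‖ ^ 2 = _ :=
      (norm_sq_toLp ((ha.memLp_weight_mul hT m ht).sub (ha.memLp_weight_mul hT m ht₀))).symm
    rw [e, Real.sqrt_sq (norm_nonneg _), Sobolev.norm_def, map_sub,
      weightedTransform_sobolevOf (ha.memLp hT ht) (ha.memLp_weight_mul hT m ht),
      weightedTransform_sobolevOf (ha.memLp hT ht₀) (ha.memLp_weight_mul hT m ht₀)]
    rfl
  have hlim : Tendsto (fun t => ∫ k, ‖w t k - w t₀ k‖ ^ 2) (𝓝[Icc 0 T] t₀) (𝓝 0) := by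
    suffices h : Tendsto (fun t => ∫ k, ‖w t k - w t₀ k‖ ^ 2) (𝓝[Icc 0 T] t₀)
        (𝓝 (∫ k : Plane, (0 : ℝ))) by simpa using h
    refine tendsto_integral_filter_of_dominated_convergence
      (fun k => (2 * C) ^ 2 * polyDecay k ^ 2) ?_ ?_ ?_ ?_
    · exact Eventually.of_forall fun t =>
        (((ha.measurable_weight_mul m m t).sub
          (ha.measurable_weight_mul m m t₀)).norm.pow_const 2).aestronglyMeasurable
    · filter_upwards [self_mem_nhdsWithin] with t ht
      refine ae_of_all _ fun k => ?_
      rw [Real.norm_of_nonneg (sq_nonneg _), ← mul_pow]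
      gcongr
      refine (norm_sub_le _ _).trans ?_
      linarith [hC t ht k, hC t₀ ht₀ k]
    · exact ((memLp_two_iff_integrable_sq
        continuous_polyDecay.aestronglyMeasurable).1 memLp_polyDecay).const_mul _
    · refine ae_of_all _ fun k => ?_
      have h1 : Tendsto (fun t => w t k) (𝓝[Icc 0 T] t₀) (𝓝 (w t₀ k)) :=
        (hc k t₀ ht₀).const_mul _
      simpa using ((h1.sub_const (w t₀ k)).norm.pow 2)
  have h2 := hlim.sqrt
  rw [Real.sqrt_zero] at h2
  refine h2.congr' ?_
  filter_upwards [self_mem_nhdsWithin] with t ht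
  exact (hsq t ht).symm

end Adm

/-- Factoring `exp (i t φ)` out of the propagator leaves the primitive of an integrable function of
`τ`. -/
theorem continuousOn_duhamelOp {T M M' : ℝ} {a b : ℝ → Plane → ℂ} (β γ : ℝ) (hT : 0 < T)
    (ha : Adm T M a) (hb : Adm T M' b) (k : Plane) :
    ContinuousOn (fun t => duhamelOp β γ a b t k) (Icc 0 T) := by
  have hi := intervalIntegrable_duhamel β γ hT ha hb 0 ⟨hT.le, le_rfl⟩ k
  have hc := intervalIntegral.continuousOn_primitive_interval'
    (hi : IntervalIntegrable _ volume 0 T) left_mem_uIcc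
  rw [uIcc_of_le hT.le] at hc
  have he : ContinuousOn (fun t : ℝ => Complex.exp (Complex.I * t * phase β γ k)) (Icc 0 T) := by
    fun_prop
  refine (he.mul hc).neg.congr fun t _ => ?_
  simp only [duhamelOp, Pi.neg_apply, Pi.mul_apply]
  rw [← intervalIntegral.integral_const_mul]
  congr 2
  ext τ
  rw [← mul_assoc (Complex.exp (Complex.I * t * phase β γ k)), ← Complex.exp_add]
  congr 2
  push_cast
  ring

theorem isSmoothSolution_ofFourier {T M : ℝ} (β γ : ℝ) {U : ℝ → Plane → ℂ} {f : Plane → ℂ}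
    (hT : 0 < T) (hU : Adm T M U)
    (hsol : ∀ t ∈ Icc 0 T, ∀ k, U t k = freeEvol β γ f t k + duhamelOp β γ U U t k) :
    IsSmoothSolution β γ T fun t => ofFourier (U t) where
  smooth m := by
    refine ⟨fun t => sobolevOf m m (U t), hU.continuousOn_sobolevOf hT (fun k => ?_) m,
      fun t ht => toDistribution_sobolevOf (hU.memLp hT ht) (hU.memLp_weight_mul hT m ht)⟩
    refine ContinuousOn.congr (f := fun t => freeEvol β γ f t k + duhamelOp β γ U U t k) ?_
      fun t ht => hsol t ht k
    refine ContinuousOn.add ?_ (continuousOn_duhamelOp β γ hT hU hU k)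
    unfold freeEvol
    fun_prop
  duhamel t ht := by
    have h0 : (0 : ℝ) ∈ Icc 0 T := ⟨le_rfl, hT.le⟩
    filter_upwards [fourier_ofFourier_ae (hU.memLp hT ht), fourier_ofFourier_ae (hU.memLp hT h0)]
      with k hk hk0
    have hU0 : U 0 k = f k := by
      rw [hsol 0 h0 k]
      simp [freeEvol, duhamelOp]
    rw [hk, hk0, hU0, hsol t ht k, sub_eq_add_neg]
    unfold freeEvol duhamelOp
    congr 2
    refine intervalIntegral.integral_congr fun τ hτ => ?_
    rw [uIcc_of_le ht.1] at hτ
    have hτ' : τ ∈ Icc 0 T := ⟨hτ.1, hτ.2.trans ht.2⟩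
    have he : 𝓕 (fun z : Plane => (ofFourier (U τ) z) ^ 2) k = convAt U U τ k := by
      rw [fourier_sq_eq]
      have hae := fourier_ofFourier_ae (hU.memLp hT hτ')
      refine integral_congr_ae ?_
      filter_upwards [hae, (measurePreserving_const_sub k).quasiMeasurePreserving.ae hae]
        with l hl hl'
      rw [hl, hl']
    simp only [he]

/-! ### A `C³` solution map bounds the cubic term -/

section sobolevOf

variable {s₁ s₂ : ℝ} {g g' : Plane → ℂ}

theorem sobolevOf_add (h : MemLp g 2 volume)
    (hw : MemLp (fun k => (weight s₁ s₂ k : ℂ) * g k) 2 volume) (h' : MemLp g' 2 volume)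
    (hw' : MemLp (fun k => (weight s₁ s₂ k : ℂ) * g' k) 2 volume) :
    sobolevOf s₁ s₂ (fun k => g k + g' k) = sobolevOf s₁ s₂ g + sobolevOf s₁ s₂ g' := by
  have e : (fun k => (weight s₁ s₂ k : ℂ) * (g k + g' k)) =
      (fun k => (weight s₁ s₂ k : ℂ) * g k) + fun k => (weight s₁ s₂ k : ℂ) * g' k := by
    ext k; simp [mul_add]
  refine Sobolev.weightedTransform_injective s₁ s₂ ?_
  rw [map_add, weightedTransform_sobolevOf h hw, weightedTransform_sobolevOf h' hw',
    weightedTransform_sobolevOf (g := fun k => g k + g' k) (h.add h') (e ▸ hw.add hw'), ← MemLp.toLp_add hw hw']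
  congr 1

theorem sobolevOf_const_mul (c : ℂ) (h : MemLp g 2 volume)
    (hw : MemLp (fun k => (weight s₁ s₂ k : ℂ) * g k) 2 volume) :
    sobolevOf s₁ s₂ (fun k => c * g k) = c • sobolevOf s₁ s₂ g := by
  have e : (fun k => (weight s₁ s₂ k : ℂ) * (c * g k)) =
      c • fun k => (weight s₁ s₂ k : ℂ) * g k := by
    ext k; simp only [Pi.smul_apply, smul_eq_mul]; ring
  refine Sobolev.weightedTransform_injective s₁ s₂ ?_
  rw [map_smul, weightedTransform_sobolevOf h hw,
    weightedTransform_sobolevOf (h.const_mul c) (e ▸ hw.const_smul c), ← MemLp.toLp_const_smul c hw]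
  congr 1

theorem norm_sq_sobolevOf (h : MemLp g 2 volume)
    (hw : MemLp (fun k => (weight s₁ s₂ k : ℂ) * g k) 2 volume) :
    ‖sobolevOf s₁ s₂ g‖ ^ 2 = ∫ k, (weight s₁ s₂ k * ‖g k‖) ^ 2 := by
  rw [Sobolev.norm_def, weightedTransform_sobolevOf h hw, norm_sq_toLp]
  simp only [norm_mul, Complex.norm_real, Real.norm_of_nonneg (weight_pos s₁ s₂ _).le]

end sobolevOf

theorem norm_sobolevOf_le {s C : ℝ} {g : Plane → ℂ} (hs : s ≤ 0) (hC : 0 ≤ C)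
    (hg : MemLp g 2 volume) (hw : MemLp (fun k => (weight s 0 k : ℂ) * g k) 2 volume)
    (h : ∀ k, ‖g k‖ ≤ C * polyDecay k) :
    ‖sobolevOf s 0 g‖ ≤ C * √(∫ k, polyDecay k ^ 2) := by
  refine (sq_le_sq₀ (norm_nonneg _) (by positivity)).1 ?_
  have hi : 0 ≤ ∫ k, polyDecay k ^ 2 := integral_nonneg fun k => sq_nonneg _
  rw [norm_sq_sobolevOf hg hw, mul_pow, Real.sq_sqrt hi, ← integral_const_mul]
  refine integral_mono_of_nonneg (ae_of_all _ fun k => sq_nonneg _)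
    (((memLp_two_iff_integrable_sq
        continuous_polyDecay.aestronglyMeasurable).1 memLp_polyDecay).const_mul _)
    (ae_of_all _ fun k => ?_)
  have hw0 := (weight_pos s 0 k).le
  simp only
  rw [← mul_pow]
  refine pow_le_pow_left₀ (by positivity) ?_ 2
  exact (mul_le_of_le_one_left (norm_nonneg _) (weight_le_one hs k)).trans (h k)

/-- For small `ε > 0` the data `ε f` lie in the neighbourhood where `Φ` is prescribed, and the
analytic solution identifies `Φ t (ε f)`. The weight is at most `1` for `s ≤ 0`, so the pointwise
`O(ε⁴)` remainder is `O(ε⁴)` in `H^{s,0}`. The bound on third-order coefficients then applies. The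
constant `K` of `f` only restricts the range of `ε` and does not enter `C`. -/
theorem IsSolutionMap.exists_cubic_bound {β γ s T t : ℝ} (hs : s ≤ 0) (hT : 0 < T)
    {Φ : ℝ → Sobolev s 0 → Sobolev s 0} (hΦ : IsSolutionMap β γ s T Φ) (ht : t ∈ Icc 0 T)
    (hd : ContDiffAt ℝ 3 (Φ t) 0) :
    ∃ C : ℝ, ∀ f : Plane → ℂ, Measurable f → (∃ K, ∀ k, ‖f k‖ ≤ K * decay T 0 k) →
      ‖sobolevOf s 0 (cubicTerm β γ (freeEvol β γ f) t)‖ ≤ C * ‖sobolevOf s 0 f‖ ^ 3 := by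
  obtain ⟨C, hC⟩ := exists_bound_cubic_coeff hd
  refine ⟨C, fun f hf ⟨K, hK⟩ => ?_⟩
  set L := freeEvol β γ f with hLdef
  have h0 : (0 : ℝ) ∈ Icc 0 T := ⟨le_rfl, hT.le⟩
  have hL : Adm T K L := adm_freeEvol β γ hT hf hK
  have hA2 := hL.duhamelOp β γ hT hL
  have hA3 := (hL.duhamelOp β γ hT hA2).const_mul 2
  obtain ⟨R, hR0, hR⟩ := solution_expansion β γ hT hL
  have hL0 : L 0 = f := by ext k; simp [hLdef, freeEvol]
  have hfm : MemLp f 2 volume := hL0 ▸ hL.memLp hT h0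
  have hfw : MemLp (fun k => (weight s 0 k : ℂ) * f k) 2 volume :=
    hL0 ▸ hL.memLp_weight_mul_of_nonpos hT hs h0
  refine hC _ (sobolevOf s 0 (L t)) (sobolevOf s 0 (duhamelOp β γ L L t)) _ ?_
  have hnear : ∀ᶠ ε : ℝ in 𝓝[>] 0, ∀ u : ℝ → Lp ℂ 2 (volume : Measure Plane),
      IsSmoothSolution β γ T u →
        (ε • sobolevOf s 0 f).toDistribution = (u 0 : 𝓢'(Plane, ℂ)) →
      ∀ t ∈ Icc 0 T, (Φ t (ε • sobolevOf s 0 f)).toDistribution = (u t : 𝓢'(Plane, ℂ)) := by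
    have h1 : Tendsto (fun ε : ℝ => ε • sobolevOf s 0 f) (𝓝[>] 0) (𝓝 0) := by
      have h2 : Tendsto (fun ε : ℝ => ε • sobolevOf s 0 f) (𝓝 0) (𝓝 ((0 : ℝ) • sobolevOf s 0 f)) :=
        (continuous_id.smul continuous_const).tendsto 0
      rw [zero_smul] at h2
      exact h2.mono_left nhdsWithin_le_nhds
    exact h1.eventually hΦ
  have hsmall : ∀ᶠ ε : ℝ in 𝓝[>] 0, 8 * duhamelConst T * K * ε ≤ 1 := by
    have h1 : Tendsto (fun ε : ℝ => 8 * duhamelConst T * K * ε) (𝓝[>] 0) (𝓝 0) := by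
      have h2 : Tendsto (fun ε : ℝ => 8 * duhamelConst T * K * ε) (𝓝 0)
          (𝓝 (8 * duhamelConst T * K * 0)) := (continuous_const.mul continuous_id).tendsto 0
      rw [mul_zero] at h2
      exact h2.mono_left nhdsWithin_le_nhds
    exact h1.eventually_le_const one_pos
  have hbig : (fun ε : ℝ => Φ t (ε • sobolevOf s 0 f) - (ε • sobolevOf s 0 (L t) +
      ε ^ 2 • sobolevOf s 0 (duhamelOp β γ L L t) +
      ε ^ 3 • sobolevOf s 0 (cubicTerm β γ L t))) =O[𝓝[>] 0] fun ε : ℝ => ε ^ 4 := by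
    refine Asymptotics.IsBigO.of_bound (R * √(∫ k, polyDecay k ^ 2)) ?_
    filter_upwards [hnear, hsmall, self_mem_nhdsWithin] with ε hε hεs hpos
    have hε0 : 0 ≤ ε := le_of_lt hpos
    obtain ⟨U, hU, hsol⟩ := exists_solution β γ hT hL hε0 hεs
    have hfree : ∀ t k, (ε : ℂ) * L t k = freeEvol β γ (fun k => (ε : ℂ) * f k) t k := by
      intro t k
      simp only [hLdef, freeEvol]
      ring
    have hsm : IsSmoothSolution β γ T fun t => ofFourier (U t) :=
      isSmoothSolution_ofFourier β γ hT hU (f := fun k => (ε : ℂ) * f k) fun t ht k => by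
        rw [hsol t ht k, hfree]
    have hU0 : U 0 = fun k => (ε : ℂ) * f k := by
      ext k
      rw [hsol 0 h0 k]
      simp [hLdef, freeEvol, duhamelOp]
    have hinit : ε • sobolevOf s 0 f = sobolevOf s 0 (U 0) := by
      rw [hU0, sobolevOf_const_mul _ hfm hfw, Complex.coe_smul]
    have hΦU : Φ t (ε • sobolevOf s 0 f) = sobolevOf s 0 (U t) := by
      refine Subtype.ext (Eq.trans (hε _ hsm ?_ t ht) ?_)
      · rw [hinit]
        exact toDistribution_sobolevOf (hU.memLp hT h0) (hU.memLp_weight_mul_of_nonpos hT hs h0)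
      · exact (toDistribution_sobolevOf (hU.memLp hT ht)
          (hU.memLp_weight_mul_of_nonpos hT hs ht)).symm
    have m1 := hL.const_mul (ε : ℂ)
    have m2 := hA2.const_mul ((ε : ℂ) ^ 2)
    have m3 := hA3.const_mul ((ε : ℂ) ^ 3)
    have m4 := ((m1.add m2).add m3).const_mul (-1)
    have e : Φ t (ε • sobolevOf s 0 f) - (ε • sobolevOf s 0 (L t) +
        ε ^ 2 • sobolevOf s 0 (duhamelOp β γ L L t) + ε ^ 3 • sobolevOf s 0 (cubicTerm β γ L t)) =
        sobolevOf s 0 fun k => U t k + -1 * (ε * L t k + ε ^ 2 * duhamelOp β γ L L t k +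
          ε ^ 3 * cubicTerm β γ L t k) := by
      have hw := fun {M : ℝ} {a : ℝ → Plane → ℂ} (ha : Adm T M a) =>
        ha.memLp_weight_mul_of_nonpos hT hs ht
      have hm := fun {M : ℝ} {a : ℝ → Plane → ℂ} (ha : Adm T M a) => ha.memLp hT ht
      have e1 := sobolevOf_add (hm hU) (hw hU) (hm m4) (hw m4)
      have e2 := sobolevOf_const_mul (-1) (hm ((m1.add m2).add m3)) (hw ((m1.add m2).add m3))
      have e3 := sobolevOf_add (hm (m1.add m2)) (hw (m1.add m2)) (hm m3) (hw m3)
      have e4 := sobolevOf_add (hm m1) (hw m1) (hm m2) (hw m2)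
      have e5 := sobolevOf_const_mul ε (hm hL) (hw hL)
      have e6 := sobolevOf_const_mul ((ε : ℂ) ^ 2) (hm hA2) (hw hA2)
      have e7 := sobolevOf_const_mul ((ε : ℂ) ^ 3) (hm hA3) (hw hA3)
      rw [e2, e3, e4, e5, e6, e7] at e1
      refine Eq.trans ?_ e1.symm
      rw [hΦU, neg_one_smul, ← sub_eq_add_neg, ← Complex.ofReal_pow, ← Complex.ofReal_pow,
        Complex.coe_smul, Complex.coe_smul, Complex.coe_smul]
      rfl
    have m5 := hU.add m4
    rw [e, Real.norm_of_nonneg (by positivity : 0 ≤ ε ^ 4), mul_right_comm]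
    refine norm_sobolevOf_le hs (by positivity) (m5.memLp hT ht)
      (m5.memLp_weight_mul_of_nonpos hT hs ht) fun k => ?_
    rw [neg_one_mul, ← sub_eq_add_neg]
    exact (hR ε hε0 U hU hsol t ht k).trans
      (mul_le_mul_of_nonneg_left (decay_le_polyDecay hT ht.2 k) (by positivity))
  refine hbig.trans_isLittleO ?_
  exact (Asymptotics.isLittleO_pow_pow (by norm_num : 3 < 4)).mono nhdsWithin_le_nhds

/-! ### The resonance function and an integral formula for the cubic term -/

/-- The resonance function `φ(p + q) - φ(p) - φ(q)`. -/
def resonance (β γ : ℝ) (p q : Plane) : ℝ := phase β γ (p + q) - phase β γ p - phase β γ q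

/-- The multiplier `ξ / (φ(p + q) - φ(p) - φ(q))`, `ξ` the first frequency of `p + q`. -/
def interaction (β γ : ℝ) (p q : Plane) : ℝ := freqX (p + q) / resonance β γ p q

theorem freqX_add (p q : Plane) : freqX (p + q) = freqX p + freqX q := by
  simp [freqX, mul_add]

theorem freqY_add (p q : Plane) : freqY (p + q) = freqY p + freqY q := by
  simp [freqY, mul_add]

theorem freqX_sub (p q : Plane) : freqX (p - q) = freqX p - freqX q := by
  simp [freqX, mul_sub]

theorem freqY_sub (p q : Plane) : freqY (p - q) = freqY p - freqY q := by
  simp [freqY, mul_sub]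

/-- The dispersive part is `(a + b)³ - a³ - b³ = 3ab(a + b)`. The fractions combine to a square plus
`γ` times a positive definite quadratic form, so for `β < 0` and `γ ≥ 0` both parts of the bracket
have the same sign and the bracket is at least `-3β`. -/
theorem resonance_eq (β γ : ℝ) {p q : Plane} (hp : freqX p ≠ 0) (hq : freqX q ≠ 0)
    (hpq : freqX (p + q) ≠ 0) :
    resonance β γ p q = freqX (p + q) * (freqX p * freqX q) * (-(3 * β) +
      ((freqY p * freqX q - freqY q * freqX p) ^ 2 +
        γ * (freqX p ^ 2 + freqX p * freqX q + freqX q ^ 2)) /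
          (freqX p * freqX q * freqX (p + q)) ^ 2) := by
  unfold resonance phase
  rw [freqX_add] at hpq ⊢
  rw [freqY_add]
  set a := freqX p
  set b := freqX q
  set c := freqY p
  set d := freqY q
  field_simp
  ring

theorem resonance_factor_ge {β γ : ℝ} (hγ : 0 ≤ γ) (p q : Plane) :
    -(3 * β) ≤ -(3 * β) + ((freqY p * freqX q - freqY q * freqX p) ^ 2 +
        γ * (freqX p ^ 2 + freqX p * freqX q + freqX q ^ 2)) /
          (freqX p * freqX q * freqX (p + q)) ^ 2 := by
  have h : 0 ≤ freqX p ^ 2 + freqX p * freqX q + freqX q ^ 2 := by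
    nlinarith [sq_nonneg (freqX p + freqX q), sq_nonneg (freqX p), sq_nonneg (freqX q)]
  have : 0 ≤ ((freqY p * freqX q - freqY q * freqX p) ^ 2 +
        γ * (freqX p ^ 2 + freqX p * freqX q + freqX q ^ 2)) /
          (freqX p * freqX q * freqX (p + q)) ^ 2 := by positivity
  linarith

theorem abs_resonance_ge {β γ : ℝ} (hγ : 0 ≤ γ) {p q : Plane} (hp : freqX p ≠ 0)
    (hq : freqX q ≠ 0) (hpq : freqX (p + q) ≠ 0) :
    -(3 * β) * |freqX (p + q) * (freqX p * freqX q)| ≤ |resonance β γ p q| := by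
  rw [resonance_eq β γ hp hq hpq, mul_comm, abs_mul (freqX (p + q) * (freqX p * freqX q))]
  have h := resonance_factor_ge (β := β) hγ p q
  refine mul_le_mul_of_nonneg_left (h.trans (le_abs_self _)) (abs_nonneg _)

theorem resonance_ne_zero {β γ : ℝ} (hβ : β < 0) (hγ : 0 ≤ γ) {p q : Plane} (hp : freqX p ≠ 0)
    (hq : freqX q ≠ 0) (hpq : freqX (p + q) ≠ 0) : resonance β γ p q ≠ 0 := by
  have h := abs_resonance_ge (β := β) hγ hp hq hpq
  have h2 : 0 < -(3 * β) * |freqX (p + q) * (freqX p * freqX q)| :=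
    mul_pos (by linarith) (abs_pos.2 (mul_ne_zero hpq (mul_ne_zero hp hq)))
  exact abs_pos.1 (h2.trans_le h)

theorem interaction_eq {β γ : ℝ} {p q : Plane} (hp : freqX p ≠ 0)
    (hq : freqX q ≠ 0) (hpq : freqX (p + q) ≠ 0) :
    interaction β γ p q = ((freqX p * freqX q) * (-(3 * β) +
      ((freqY p * freqX q - freqY q * freqX p) ^ 2 +
        γ * (freqX p ^ 2 + freqX p * freqX q + freqX q ^ 2)) /
          (freqX p * freqX q * freqX (p + q)) ^ 2))⁻¹ := by
  rw [interaction, resonance_eq β γ hp hq hpq, mul_assoc, div_mul_eq_div_div, div_self hpq,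
    one_div]

theorem abs_interaction_le {β γ N : ℝ} (hβ : β < 0) (hγ : 0 ≤ γ) (hN : 0 < N) {p q : Plane}
    (hp : N ≤ |freqX p|) (hq : N ≤ |freqX q|) :
    |interaction β γ p q| ≤ (-(3 * β) * N ^ 2)⁻¹ := by
  have hp0 : freqX p ≠ 0 := abs_pos.1 (hN.trans_le hp)
  have hq0 : freqX q ≠ 0 := abs_pos.1 (hN.trans_le hq)
  have hb : 0 < -(3 * β) := by linarith
  -- On this line the factorization is unavailable, but the numerator of the multiplier vanishes.
  -- Elsewhere the numerator cancels against the factor `ξ(p + q)` of the resonance.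
  by_cases hpq : freqX (p + q) = 0
  · rw [interaction, hpq, zero_div, abs_zero]
    positivity
  · rw [interaction_eq hp0 hq0 hpq, abs_inv, abs_mul, abs_mul]
    refine inv_anti₀ (by positivity) ?_
    have h := (resonance_factor_ge (β := β) hγ p q).trans (le_abs_self _)
    calc _ = (N * N) * -(3 * β) := by ring
      _ ≤ _ := by gcongr

theorem measurable_interaction (β γ : ℝ) :
    Measurable fun z : Plane × Plane => interaction β γ z.1 z.2 := by
  have hφ := measurable_phase β γ
  have ha : Measurable fun z : Plane × Plane => z.1 + z.2 := measurable_fst.add measurable_snd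
  unfold interaction resonance
  exact (continuous_freqX.measurable.comp ha).div
    (((hφ.comp ha).sub (hφ.comp measurable_fst)).sub (hφ.comp measurable_snd))

/-- The oscillating integral `∫₀ᵗ exp (-i τ R) dτ`. -/
def osc (t R : ℝ) : ℂ := ∫ τ in (0 : ℝ)..t, Complex.exp (-(Complex.I * R) * τ)

theorem norm_cexp_neg_I_mul (R τ : ℝ) : ‖Complex.exp (-(Complex.I * R) * τ)‖ = 1 := by
  have : -(Complex.I * R) * τ = ((-(R * τ) : ℝ) : ℂ) * Complex.I := by push_cast; ring
  rw [this, Complex.norm_exp_ofReal_mul_I]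

theorem norm_osc_le {t : ℝ} (ht : 0 ≤ t) (R : ℝ) : ‖osc t R‖ ≤ t := by
  have h := intervalIntegral.norm_integral_le_of_norm_le_const (a := 0) (b := t) (C := 1)
    (f := fun τ : ℝ => Complex.exp (-(Complex.I * R) * τ))
    fun τ _ => (norm_cexp_neg_I_mul R τ).le
  rwa [one_mul, sub_zero, abs_of_nonneg ht] at h

theorem norm_osc_le_div (t : ℝ) {R : ℝ} (hR : R ≠ 0) : ‖osc t R‖ ≤ 2 / |R| := by
  have hc : -(Complex.I * R) ≠ 0 :=
    neg_ne_zero.2 (mul_ne_zero Complex.I_ne_zero (by exact_mod_cast hR))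
  rw [osc, integral_exp_mul_complex hc, norm_div, norm_neg, norm_mul, Complex.norm_I, one_mul,
    Complex.norm_real, Real.norm_eq_abs]
  gcongr
  refine (norm_sub_le _ _).trans ?_
  rw [norm_cexp_neg_I_mul, norm_cexp_neg_I_mul]
  norm_num

theorem norm_osc_sub_le {t : ℝ} (ht : 0 ≤ t) (R : ℝ) : ‖osc t R - t‖ ≤ t * |R| * t := by
  have hi : IntervalIntegrable (fun τ : ℝ => Complex.exp (-(Complex.I * R) * τ)) volume 0 t :=
    Continuous.intervalIntegrable (by fun_prop) _ _
  have e : osc t R - t = ∫ τ in (0 : ℝ)..t, (Complex.exp (-(Complex.I * R) * τ) - 1) := by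
    rw [intervalIntegral.integral_sub hi (by simp), osc]
    simp
  rw [e]
  refine (intervalIntegral.norm_integral_le_of_norm_le_const (C := t * |R|) fun τ hτ => ?_).trans
    (by rw [sub_zero, abs_of_nonneg ht])
  rw [uIoc_of_le ht] at hτ
  have e2 : -(Complex.I * R) * τ = Complex.I * ((-(τ * R) : ℝ) : ℂ) := by push_cast; ring
  rw [e2]
  refine Real.norm_exp_I_mul_ofReal_sub_one_le.trans ?_
  rw [Real.norm_eq_abs, abs_neg, abs_mul, abs_of_pos hτ.1]
  exact mul_le_mul_of_nonneg_right hτ.2 (abs_nonneg _)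

/-! ### Time integration and the trilinear kernel -/

section formula

variable {β γ N : ℝ} {f : Plane → ℂ}

theorem integral_duhamel_phase (τ ξ a : ℝ) {r : ℝ} (hr : r ≠ 0) :
    ∫ σ in (0 : ℝ)..τ, Complex.exp (Complex.I * (τ - σ) * a) *
        (Complex.I * ξ * Complex.exp (Complex.I * σ * (a - r))) =
      -((ξ / r : ℝ) * (Complex.exp (Complex.I * τ * (a - r)) -
        Complex.exp (Complex.I * τ * a))) := by
  have hr' : (r : ℂ) ≠ 0 := by exact_mod_cast hr
  have hc : -(Complex.I * r) ≠ 0 := neg_ne_zero.2 (mul_ne_zero Complex.I_ne_zero hr')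
  have e : ∀ σ : ℝ, Complex.exp (Complex.I * (τ - σ) * a) *
        (Complex.I * ξ * Complex.exp (Complex.I * σ * (a - r))) =
      (Complex.I * ξ * Complex.exp (Complex.I * τ * a)) *
        Complex.exp (-(Complex.I * r) * σ) := by
    intro σ
    have : Complex.exp (Complex.I * (τ - σ) * a) * Complex.exp (Complex.I * σ * (a - r)) =
        Complex.exp (Complex.I * τ * a) * Complex.exp (-(Complex.I * r) * σ) := by
      rw [← Complex.exp_add, ← Complex.exp_add]
      congr 1
      ring
    linear_combination (Complex.I * ξ) * this
  simp only [e]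
  rw [intervalIntegral.integral_const_mul, integral_exp_mul_complex hc]
  have h2 : Complex.exp (Complex.I * τ * (a - r)) =
      Complex.exp (Complex.I * τ * a) * Complex.exp (-(Complex.I * r) * τ) := by
    rw [← Complex.exp_add]
    congr 1
    ring
  rw [h2]
  have hI := Complex.I_ne_zero
  push_cast
  simp only [mul_zero, Complex.exp_zero]
  field_simp

/-- By Fubini the time integral is done first. It divides by the resonance, which is nonzero because
the support of `f` stays away from `ξ = 0`; together with the factor `ξ(m)` this is the multiplier
`interaction`. -/
theorem duhamelOp_freeEvol (hβ : β < 0) (hγ : 0 ≤ γ) (hN : 0 < N) (hf : Measurable f)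
    (hi : Integrable f) (h1 : ∀ k, ‖f k‖ ≤ 1) (hfN : ∀ k, f k ≠ 0 → N ≤ |freqX k|)
    (τ : ℝ) (m : Plane) :
    duhamelOp β γ (freeEvol β γ f) (freeEvol β γ f) τ m =
      ∫ l, f l * f (m - l) * ((interaction β γ l (m - l) : ℝ) *
        (Complex.exp (Complex.I * τ * (phase β γ l + phase β γ (m - l))) -
          Complex.exp (Complex.I * τ * phase β γ m))) := by
  set F : ℝ → Plane → ℂ := fun σ l => Complex.exp (Complex.I * (τ - σ) * phase β γ m) *
    (Complex.I * freqX m * (freeEvol β γ f σ l * freeEvol β γ f σ (m - l))) with hF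
  have hL := measurable_freeEvol β γ hf
  have hFm : Measurable (Function.uncurry F) := by
    have h2 : Measurable fun z : ℝ × Plane => Complex.exp (Complex.I * (τ - z.1) * phase β γ m) := by
      have : Continuous fun z : ℝ × Plane =>
          Complex.exp (Complex.I * (τ - z.1) * phase β γ m) := by fun_prop
      exact this.measurable
    have h3 : Measurable fun z : ℝ × Plane => freeEvol β γ f z.1 (m - z.2) :=
      hL.comp (measurable_fst.prodMk (measurable_const.sub measurable_snd))
    exact h2.mul ((hL.mul h3).const_mul _)
  have hFi : Integrable (Function.uncurry F) ((volume.restrict (uIoc 0 τ)).prod volume) := by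
    have hdom : Integrable (fun z : ℝ × Plane => |freqX m| * ‖f z.2‖)
        ((volume.restrict (uIoc 0 τ)).prod volume) :=
      Integrable.mul_prod (f := fun _ : ℝ => |freqX m|) (integrableOn_const (by simp [uIoc])) hi.norm
    refine hdom.mono' hFm.aestronglyMeasurable (ae_of_all _ fun z => ?_)
    have he := norm_cexp_I_mul_mul (τ - z.1) (phase β γ m)
    push_cast at he
    simp only [Function.uncurry, hF]
    rw [norm_mul, he, one_mul, norm_mul, norm_mul, norm_mul, Complex.norm_I, one_mul,
      Complex.norm_real, Real.norm_eq_abs, norm_freeEvol, norm_freeEvol]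
    gcongr
    exact mul_le_of_le_one_right (norm_nonneg _) (h1 _)
  have e1 : duhamelOp β γ (freeEvol β γ f) (freeEvol β γ f) τ m =
      -∫ σ in (0 : ℝ)..τ, ∫ l, F σ l := by
    unfold duhamelOp convAt
    congr 2
    ext σ
    rw [← integral_const_mul, ← integral_const_mul]
  rw [e1, intervalIntegral_integral_swap hFi, ← integral_neg]
  refine integral_congr_ae (ae_of_all _ fun l => ?_)
  simp only
  have e2 : ∀ σ, F σ l = f l * f (m - l) * (Complex.exp (Complex.I * (τ - σ) * phase β γ m) *
      (Complex.I * freqX m * Complex.exp (Complex.I * σ *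
        (phase β γ l + phase β γ (m - l))))) := by
    intro σ
    have : Complex.exp (Complex.I * σ * (phase β γ l + phase β γ (m - l))) =
        Complex.exp (Complex.I * σ * phase β γ l) *
          Complex.exp (Complex.I * σ * phase β γ (m - l)) := by
      rw [← Complex.exp_add, mul_add]
    simp only [hF, freeEvol]
    rw [this]
    ring
  simp only [e2]
  rw [intervalIntegral.integral_const_mul, ← mul_neg]
  by_cases hz : f l * f (m - l) = 0
  · rw [hz, zero_mul, zero_mul]
  congr 1
  have hlm : l + (m - l) = m := by abel
  -- Here the resonance need not be invertible, but both sides vanish because of the factor `ξ(m)`.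
  by_cases hm0 : freqX m = 0
  · simp [interaction, hlm, hm0]
  have hp : freqX l ≠ 0 := abs_pos.1 (hN.trans_le (hfN _ (left_ne_zero_of_mul hz)))
  have hq : freqX (m - l) ≠ 0 := abs_pos.1 (hN.trans_le (hfN _ (right_ne_zero_of_mul hz)))
  have hr := resonance_ne_zero hβ hγ hp hq (by rwa [hlm])
  have e3 : (phase β γ l : ℂ) + phase β γ (m - l) =
      phase β γ m - resonance β γ l (m - l) := by
    rw [resonance, hlm]
    push_cast
    ring
  rw [e3, integral_duhamel_phase τ _ _ hr, neg_neg, interaction, hlm]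

/-- The kernel of the cubic term at the frequencies `l`, `m - l`, `k - m` with sum `k`. -/
def cubicKernel (β γ t : ℝ) (k : Plane) (z : Plane × Plane) : ℂ :=
  (interaction β γ z.2 (z.1 - z.2) : ℝ) *
    (osc t (phase β γ k - phase β γ z.2 - phase β γ (z.1 - z.2) - phase β γ (k - z.1)) -
      osc t (phase β γ k - phase β γ z.1 - phase β γ (k - z.1)))

theorem integral_cubic_phase (t a b c : ℝ) (d ξ : ℝ) :
    ∫ τ in (0 : ℝ)..t, Complex.exp (Complex.I * (t - τ) * a) * (Complex.I * ξ *
        ((Complex.exp (Complex.I * τ * b) - Complex.exp (Complex.I * τ * c)) *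
          Complex.exp (Complex.I * τ * d))) =
      Complex.I * ξ * Complex.exp (Complex.I * t * a) * (osc t (a - b - d) - osc t (a - c - d)) := by
  unfold osc
  rw [← intervalIntegral.integral_sub (Continuous.intervalIntegrable (by fun_prop) _ _)
    (Continuous.intervalIntegrable (by fun_prop) _ _), ← intervalIntegral.integral_const_mul]
  congr 1
  ext τ
  have e : ∀ b : ℝ, Complex.exp (Complex.I * (t - τ) * a) * (Complex.exp (Complex.I * τ * b) *
      Complex.exp (Complex.I * τ * d)) = Complex.exp (Complex.I * t * a) *
        Complex.exp (-(Complex.I * (a - b - d : ℝ)) * τ) := by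
    intro b
    rw [← Complex.exp_add, ← Complex.exp_add, ← Complex.exp_add]
    congr 1
    push_cast
    ring
  linear_combination (Complex.I * ξ) * (e b - e c)

/-- Inserting the formula for `B(L,L)` into the outer operator leaves two exponentials in `τ`. The
upper endpoint of the inner integral carries the full cubic resonance, and the lower endpoint
carries the quadratic resonance of `m` and `k - m`. Boundedness of `interaction` on the support
justifies the exchange of integrals. -/
theorem cubicTerm_freeEvol (hβ : β < 0) (hγ : 0 ≤ γ) (hN : 0 < N) (hf : Measurable f)
    (hi : Integrable f) (h1 : ∀ k, ‖f k‖ ≤ 1) (hfN : ∀ k, f k ≠ 0 → N ≤ |freqX k|)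
    (t : ℝ) (k : Plane) :
    cubicTerm β γ (freeEvol β γ f) t k =
      -(2 * (Complex.I * freqX k * Complex.exp (Complex.I * t * phase β γ k)) *
        ∫ z : Plane × Plane, f z.2 * f (z.1 - z.2) * f (k - z.1) * cubicKernel β γ t k z) := by
  set H : ℝ → Plane × Plane → ℂ := fun τ z => f z.2 * f (z.1 - z.2) * f (k - z.1) *
    ((interaction β γ z.2 (z.1 - z.2) : ℝ) *
      ((Complex.exp (Complex.I * τ * (phase β γ z.2 + phase β γ (z.1 - z.2))) -
        Complex.exp (Complex.I * τ * phase β γ z.1)) *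
          Complex.exp (Complex.I * τ * phase β γ (k - z.1)))) with hH
  have hm1 : Measurable fun z : ℝ × (Plane × Plane) => z.2.1 := measurable_snd.fst
  have hm2 : Measurable fun z : ℝ × (Plane × Plane) => z.2.2 := measurable_snd.snd
  have hm3 := hm1.sub hm2
  have hm4 : Measurable fun z : ℝ × (Plane × Plane) => k - z.2.1 := measurable_const.sub hm1
  have hφ : Measurable fun x : Plane => ((phase β γ x : ℝ) : ℂ) :=
    Complex.measurable_ofReal.comp (measurable_phase β γ)
  have hτ : Measurable fun z : ℝ × (Plane × Plane) => Complex.I * (z.1 : ℂ) :=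
    (Complex.measurable_ofReal.comp measurable_fst).const_mul _
  have hHm : Measurable (Function.uncurry H) :=
    (((hf.comp hm2).mul (hf.comp hm3)).mul (hf.comp hm4)).mul
      ((Complex.measurable_ofReal.comp
        ((measurable_interaction β γ).comp (hm2.prodMk hm3))).mul
        (((Complex.measurable_exp.comp (hτ.mul ((hφ.comp hm2).add (hφ.comp hm3)))).sub
          (Complex.measurable_exp.comp (hτ.mul (hφ.comp hm1)))).mul
            (Complex.measurable_exp.comp (hτ.mul (hφ.comp hm4)))))
  set c := (-(3 * β) * N ^ 2)⁻¹ with hc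
  have hc0 : 0 ≤ c := by
    have : 0 < -(3 * β) := by linarith
    positivity
  have hHb : ∀ τ z, ‖H τ z‖ ≤ 2 * c * (‖f (k - z.1)‖ * ‖f z.2‖) := by
    intro τ z
    by_cases hz : f z.2 * f (z.1 - z.2) = 0
    · simp only [hH, hz, zero_mul, norm_zero]
      positivity
    have hb := abs_interaction_le hβ hγ hN (hfN _ (left_ne_zero_of_mul hz))
      (hfN _ (right_ne_zero_of_mul hz))
    have n1 := norm_cexp_I_mul_mul τ (phase β γ z.2 + phase β γ (z.1 - z.2))
    push_cast at n1
    have n2 : ‖Complex.exp (Complex.I * τ * (phase β γ z.2 + phase β γ (z.1 - z.2))) -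
        Complex.exp (Complex.I * τ * phase β γ z.1)‖ ≤ 2 := by
      refine (norm_sub_le _ _).trans ?_
      rw [n1, norm_cexp_I_mul_mul]
      norm_num
    simp only [hH]
    rw [norm_mul, norm_mul, norm_mul, norm_mul, norm_mul, norm_cexp_I_mul_mul, mul_one,
      Complex.norm_real, Real.norm_eq_abs]
    calc _ ≤ ‖f z.2‖ * 1 * ‖f (k - z.1)‖ * (c * 2) := by
          gcongr
          exact h1 _
      _ = _ := by ring
  have hdom : Integrable (fun z : Plane × Plane => 2 * c * (‖f (k - z.1)‖ * ‖f z.2‖)) :=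
    (Integrable.mul_prod (f := fun x : Plane => ‖f (k - x)‖) (g := fun x : Plane => ‖f x‖)
      (hi.comp_sub_left k).norm hi.norm).const_mul _
  have hHi : ∀ τ, Integrable (H τ) := fun τ => hdom.mono'
    (hHm.comp measurable_prodMk_left).aestronglyMeasurable (ae_of_all _ (hHb τ))
  have e1 : ∀ τ, convAt (duhamelOp β γ (freeEvol β γ f) (freeEvol β γ f)) (freeEvol β γ f) τ k =
      ∫ z, H τ z := by
    intro τ
    have : ∫ z, H τ z = ∫ m, ∫ l, H τ (m, l) := integral_prod _ (hHi τ)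
    rw [this]
    unfold convAt
    refine integral_congr_ae (ae_of_all _ fun m => ?_)
    simp only
    rw [duhamelOp_freeEvol hβ hγ hN hf hi h1 hfN, ← integral_mul_const]
    refine integral_congr_ae (ae_of_all _ fun l => ?_)
    simp only [hH, freeEvol]
    ring
  set G : ℝ → Plane × Plane → ℂ := fun τ z => Complex.exp (Complex.I * (t - τ) * phase β γ k) *
    (Complex.I * freqX k * H τ z) with hG
  have hGi : Integrable (Function.uncurry G) ((volume.restrict (uIoc 0 t)).prod volume) := by
    have hd : Integrable (fun z : ℝ × (Plane × Plane) =>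
        |freqX k| * (2 * c * (‖f (k - z.2.1)‖ * ‖f z.2.2‖)))
        ((volume.restrict (uIoc 0 t)).prod volume) :=
      Integrable.mul_prod (f := fun _ : ℝ => |freqX k|) (integrableOn_const (by simp [uIoc])) hdom
    have h2 : Measurable fun z : ℝ × (Plane × Plane) =>
        Complex.exp (Complex.I * (t - z.1) * phase β γ k) := by
      have : Continuous fun z : ℝ × (Plane × Plane) =>
          Complex.exp (Complex.I * (t - z.1) * phase β γ k) := by fun_prop
      exact this.measurable
    refine hd.mono' (h2.mul (hHm.const_mul _)).aestronglyMeasurable (ae_of_all _ fun z => ?_)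
    have he := norm_cexp_I_mul_mul (t - z.1) (phase β γ k)
    push_cast at he
    simp only [Function.uncurry, hG]
    rw [norm_mul, he, one_mul, norm_mul, norm_mul, Complex.norm_I, one_mul,
      Complex.norm_real, Real.norm_eq_abs]
    exact mul_le_mul_of_nonneg_left (hHb _ _) (abs_nonneg _)
  have e2 : cubicTerm β γ (freeEvol β γ f) t k = -(2 * ∫ τ in (0 : ℝ)..t, ∫ z, G τ z) := by
    rw [cubicTerm, duhamelOp_comm, duhamelOp, mul_neg]
    congr 3
    ext τ
    rw [e1, ← integral_const_mul, ← integral_const_mul]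
  rw [e2, intervalIntegral_integral_swap hGi, mul_assoc,
    ← integral_const_mul (Complex.I * freqX k * Complex.exp (Complex.I * t * phase β γ k))]
  congr 2
  refine integral_congr_ae (ae_of_all _ fun z => ?_)
  simp only
  have h3 := integral_cubic_phase t (phase β γ k) (phase β γ z.2 + phase β γ (z.1 - z.2))
    (phase β γ z.1) (phase β γ (k - z.1)) (freqX k)
  rw [← sub_sub] at h3
  have e4 : ∀ τ, G τ z = f z.2 * f (z.1 - z.2) * f (k - z.1) *
      (interaction β γ z.2 (z.1 - z.2) : ℝ) * (Complex.exp (Complex.I * (t - τ) * phase β γ k) *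
        (Complex.I * freqX k * ((Complex.exp (Complex.I * τ *
          ((phase β γ z.2 + phase β γ (z.1 - z.2) : ℝ) : ℂ)) -
            Complex.exp (Complex.I * τ * phase β γ z.1)) *
              Complex.exp (Complex.I * τ * phase β γ (k - z.1))))) := by
    intro τ
    simp only [hG, hH]
    push_cast
    ring
  simp only [e4]
  rw [intervalIntegral.integral_const_mul, h3, cubicKernel]
  ring

end formula

/-! ### Frequency boxes -/

/-- The frequencies with `a ≤ ξ ≤ b` and `|η| ≤ h`. -/
def box (a b h : ℝ) : Set Plane := {k | freqX k ∈ Icc a b ∧ freqY k ∈ Icc (-h) h}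

theorem measurableSet_box (a b h : ℝ) : MeasurableSet (box a b h) :=
  (continuous_freqX.measurable measurableSet_Icc).inter
    (continuous_freqY.measurable measurableSet_Icc)

theorem volume_box (a b h : ℝ) : volume (box a b h) =
    ENNReal.ofReal ((b - a) / (2 * Real.pi)) * ENNReal.ofReal (2 * h / (2 * Real.pi)) := by
  have hpi : 0 < 2 * Real.pi := by positivity
  have e : box a b h = (WithLp.ofLp : Plane → Fin 2 → ℝ) ⁻¹'
      Icc ![a / (2 * Real.pi), -h / (2 * Real.pi)] ![b / (2 * Real.pi), h / (2 * Real.pi)] := by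
    ext k
    simp only [box, freqX, freqY, mem_ofPred_eq, mem_Icc, mem_preimage, Pi.le_def,
      Fin.forall_fin_two, Matrix.cons_val_zero, Matrix.cons_val_one, div_le_iff₀' hpi,
      le_div_iff₀' hpi]
    tauto
  rw [e, (PiLp.volume_preserving_ofLp (Fin 2)).measure_preimage
    measurableSet_Icc.nullMeasurableSet, Real.volume_Icc_pi]
  simp only [Fin.prod_univ_two, Matrix.cons_val_zero, Matrix.cons_val_one]
  congr 2 <;> ring

theorem volume_box_lt_top (a b h : ℝ) : volume (box a b h) < ∞ := by
  rw [volume_box]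
  exact ENNReal.mul_lt_top ENNReal.ofReal_lt_top ENNReal.ofReal_lt_top

theorem volume_real_box {a b h : ℝ} (hab : a ≤ b) (hh : 0 ≤ h) :
    volume.real (box a b h) = (b - a) * (2 * h) / (2 * Real.pi) ^ 2 := by
  have hpi : 0 < 2 * Real.pi := by positivity
  rw [Measure.real, volume_box, ENNReal.toReal_mul,
    ENNReal.toReal_ofReal (div_nonneg (by linarith) hpi.le),
    ENNReal.toReal_ofReal (by positivity)]
  ring

/-- The indicator function of `box a b h`. -/
def boxInd (a b h : ℝ) : Plane → ℝ := (box a b h).indicator 1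

section boxInd

variable (a b h : ℝ)

theorem measurable_boxInd : Measurable (boxInd a b h) :=
  measurable_one.indicator (measurableSet_box a b h)

theorem boxInd_nonneg (k : Plane) : 0 ≤ boxInd a b h k :=
  indicator_nonneg (fun _ _ => zero_le_one) k

theorem boxInd_le_one (k : Plane) : boxInd a b h k ≤ 1 :=
  indicator_le_self' (fun _ _ => zero_le_one) k

theorem integrable_boxInd : Integrable (boxInd a b h) :=
  (integrable_indicator_iff (measurableSet_box a b h)).2
    (integrableOn_const (volume_box_lt_top a b h).ne)

theorem integral_boxInd : ∫ k, boxInd a b h k = volume.real (box a b h) :=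
  integral_indicator_one (measurableSet_box a b h)

variable {a b h}

theorem boxInd_of_mem {k : Plane} (hk : k ∈ box a b h) : boxInd a b h k = 1 := by
  simp [boxInd, hk]

theorem boxInd_of_notMem {k : Plane} (hk : k ∉ box a b h) : boxInd a b h k = 0 := by
  simp [boxInd, hk]

end boxInd

/-! ### Triple convolutions -/

/-- The value at `k` of the convolution of `u`, `v` and `w`. -/
def tripleConv (u v w : Plane → ℝ) (k : Plane) : ℝ :=
  ∫ z : Plane × Plane, u z.2 * v (z.1 - z.2) * w (k - z.1)

/-- Measurable and integrable functions with values in `[0, 1]`. -/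
structure UnitIntegrable (u : Plane → ℝ) : Prop where
  measurable : Measurable u
  integrable : Integrable u
  nonneg : ∀ k, 0 ≤ u k
  le_one : ∀ k, u k ≤ 1

theorem unitIntegrable_boxInd (a b h : ℝ) : UnitIntegrable (boxInd a b h) :=
  ⟨measurable_boxInd a b h, integrable_boxInd a b h, boxInd_nonneg a b h, boxInd_le_one a b h⟩

section tripleConv

variable {u v w : Plane → ℝ}

theorem integrable_tripleConv (hu : UnitIntegrable u) (hv : UnitIntegrable v)
    (hw : UnitIntegrable w) (k : Plane) :
    Integrable fun z : Plane × Plane => u z.2 * v (z.1 - z.2) * w (k - z.1) := by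
  have hdom : Integrable (fun z : Plane × Plane => w (k - z.1) * u z.2) :=
    Integrable.mul_prod (f := fun x : Plane => w (k - x)) (hw.integrable.comp_sub_left k)
      hu.integrable
  refine hdom.mono' ?_ (ae_of_all _ fun z => ?_)
  · exact (((hu.measurable.comp measurable_snd).mul
      (hv.measurable.comp (measurable_fst.sub measurable_snd))).mul
        (hw.measurable.comp (measurable_const.sub measurable_fst))).aestronglyMeasurable
  · have h1 := hu.nonneg z.2
    have h2 := hv.nonneg (z.1 - z.2)
    have h3 := hw.nonneg (k - z.1)
    have h4 := hv.le_one (z.1 - z.2)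
    rw [Real.norm_of_nonneg (by positivity)]
    nlinarith [mul_nonneg (mul_nonneg h1 h3) (sub_nonneg.2 h4)]

theorem tripleConv_eq_integral (hu : UnitIntegrable u) (hv : UnitIntegrable v)
    (hw : UnitIntegrable w) (k : Plane) :
    tripleConv u v w k = ∫ m, ∫ l, u l * v (m - l) * w (k - m) :=
  integral_prod _ (integrable_tripleConv hu hv hw k)

theorem tripleConv_swap_left (hu : UnitIntegrable u) (hv : UnitIntegrable v)
    (hw : UnitIntegrable w) (k : Plane) : tripleConv u v w k = tripleConv v u w k := by
  rw [tripleConv_eq_integral hu hv hw, tripleConv_eq_integral hv hu hw]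
  congr 1
  ext m
  rw [← integral_sub_left_eq_self _ _ m]
  simp only [sub_sub_cancel, mul_comm (v _)]

/-- The substitutions `m ↦ k - m` and `l ↦ k - l` exchange the outer factors. With
`tripleConv_swap_left` this shows that the three orderings of the cubic interaction have equal
weight, which is what makes their signs comparable. -/
theorem tripleConv_reverse (hu : UnitIntegrable u) (hv : UnitIntegrable v)
    (hw : UnitIntegrable w) (k : Plane) : tripleConv u v w k = tripleConv w v u k := by
  have h1 : tripleConv w v u k = ∫ l, ∫ m, w l * v (m - l) * u (k - m) :=
    integral_prod_symm _ (integrable_tripleConv hw hv hu k)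
  rw [h1, tripleConv_eq_integral hu hv hw, ← integral_sub_left_eq_self _ _ k]
  congr 1
  ext l
  rw [← integral_sub_left_eq_self _ _ k]
  congr 1
  ext m
  rw [sub_sub_sub_cancel_left, sub_sub_cancel]
  ring

/-- If `p` and `q` range over sets so small that the third factor is automatically present, the
integral over `(p, q)` factorizes after the shift `m ↦ m - l`. -/
theorem mul_self_integral_le_tripleConv {u' : Plane → ℝ} (hu' : UnitIntegrable u')
    (hu : UnitIntegrable u) (hw : UnitIntegrable w) (k : Plane)
    (h : ∀ p q, u' p * u' q ≤ u p * u q * w (k - (p + q))) :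
    (∫ p, u' p) * ∫ p, u' p ≤ tripleConv u u w k := by
  have hi := integrable_tripleConv hu hu hw k
  have hdom : Integrable (fun z : Plane × Plane => u' z.2 * u' (z.1 - z.2)) := by
    refine hi.mono' ?_ (ae_of_all _ fun z => ?_)
    · exact ((hu'.measurable.comp measurable_snd).mul
        (hu'.measurable.comp (measurable_fst.sub measurable_snd))).aestronglyMeasurable
    · rw [Real.norm_of_nonneg (mul_nonneg (hu'.nonneg _) (hu'.nonneg _))]
      simpa using h z.2 (z.1 - z.2)
  have e : ∫ z : Plane × Plane, u' z.2 * u' (z.1 - z.2) = (∫ p, u' p) * ∫ p, u' p := by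
    have h1 : ∫ z : Plane × Plane, u' z.2 * u' (z.1 - z.2) = ∫ l, ∫ m, u' l * u' (m - l) :=
      integral_prod_symm _ hdom
    rw [h1, ← integral_mul_const]
    congr 1
    ext l
    rw [integral_const_mul, integral_sub_right_eq_self u' l]
  rw [← e]
  refine integral_mono hdom hi fun z => ?_
  simpa using h z.2 (z.1 - z.2)

end tripleConv

/-! ### The size of the kernel of the cubic term -/

/-- The box of positive frequencies in the support of the initial value. -/
abbrev plusBox (N δ h : ℝ) : Set Plane := box N (N + δ) h

/-- The box of negative frequencies in the support of the initial value. -/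
abbrev minusBox (N δ h : ℝ) : Set Plane := box (-(N + 3 * δ)) (-(N + 2 * δ)) h

/-- The parameters for which the cubic interaction of the two boxes is almost resonant while the
quadratic interactions are not. -/
structure Regime (β γ t N δ h : ℝ) : Prop where
  one_le : 1 ≤ N
  width_pos : 0 < δ
  height_pos : 0 < h
  width_small : (N + 3 * δ) ^ 2 ≤ 41 / 40 * N ^ 2
  ratio_small : 4 * (4 * h ^ 2 + 3 * γ) ≤ 1 / 40 * (-(3 * β) * N ^ 2 * δ ^ 2)
  nonresonant : 80 ≤ t * (-(3 * β) * N ^ 2 * δ)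
  resonant : t * (-(3 * β) * (27 * N * δ ^ 2) + (21 * h ^ 2 + 5 * γ) / N) ≤ 1 / 20

namespace Regime

variable {β γ t N δ h : ℝ}

theorem width_le (R : Regime β γ t N δ h) : 240 * δ ≤ N := by
  have h1 := R.one_le
  have h2 := R.width_small
  have h3 := R.width_pos
  have : N * (240 * δ) ≤ N * N := by nlinarith
  exact le_of_mul_le_mul_left this (by linarith)

theorem abs_freqX_plus (R : Regime β γ t N δ h) {p : Plane} (hp : p ∈ plusBox N δ h) :
    N ≤ |freqX p| ∧ |freqX p| ≤ N + 3 * δ := by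
  have h1 := R.one_le
  have h3 := R.width_pos
  obtain ⟨⟨h4, h5⟩, -⟩ := hp
  rw [abs_of_pos (by linarith)]
  constructor <;> linarith

theorem abs_freqX_minus (R : Regime β γ t N δ h) {p : Plane} (hp : p ∈ minusBox N δ h) :
    N ≤ |freqX p| ∧ |freqX p| ≤ N + 3 * δ := by
  have h1 := R.one_le
  have h3 := R.width_pos
  obtain ⟨⟨h4, h5⟩, -⟩ := hp
  rw [abs_of_neg (by linarith)]
  constructor <;> linarith

/-- The dispersive part is `3(x + y)(y + z)(x + z)`, in which two factors are sums of nearly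
opposite frequencies and are at most `3δ`, while the remaining one is at most `3N`. The fractions
are estimated separately: the output has `|ξ| ≥ N/2` and `|η| ≤ 3h`, giving `(18h² + 2γ)/N`, and the
three inputs give `(h² + γ)/N` each. -/
theorem abs_phase_sub_le (R : Regime β γ t N δ h) (hβ : β < 0) (hγ : 0 < γ) {a b c : Plane}
    (ha : a ∈ plusBox N δ h) (hb : b ∈ plusBox N δ h) (hc : c ∈ minusBox N δ h) :
    |phase β γ (a + b + c) - phase β γ a - phase β γ b - phase β γ c| ≤
      -(3 * β) * (27 * N * δ ^ 2) + (21 * h ^ 2 + 5 * γ) / N := by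
  have hN := R.one_le
  have hδ := R.width_pos
  have hh := R.height_pos
  have hw := R.width_le
  obtain ⟨⟨a1, a2⟩, ⟨a3, a4⟩⟩ := ha
  obtain ⟨⟨b1, b2⟩, ⟨b3, b4⟩⟩ := hb
  obtain ⟨⟨c1, c2⟩, ⟨c3, c4⟩⟩ := hc
  unfold phase
  rw [freqX_add, freqX_add, freqY_add, freqY_add]
  set x := freqX a
  set y := freqX b
  set z := freqX c
  have hq : ∀ η B x X : ℝ, -B ≤ η → η ≤ B → 0 < X → X ≤ |x| →
      |(η ^ 2 + γ) / x| ≤ (B ^ 2 + γ) / X := by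
    intro η B x X h1 h2 h3 h4
    rw [abs_div, abs_of_nonneg (by positivity : 0 ≤ η ^ 2 + γ)]
    have : η ^ 2 ≤ B ^ 2 := sq_le_sq' h1 h2
    gcongr
  have k1 := hq (freqY a + freqY b + freqY c) (3 * h) (x + y + z) (N / 2) (by linarith)
    (by linarith) (by linarith) (le_trans (by linarith) (le_abs_self _))
  have k2 := hq (freqY a) h x N a3 a4 (by linarith) (le_trans (by linarith) (le_abs_self _))
  have k3 := hq (freqY b) h y N b3 b4 (by linarith) (le_trans (by linarith) (le_abs_self _))
  have k4 := hq (freqY c) h z N c3 c4 (by linarith) (le_trans (by linarith) (neg_le_abs _))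
  have k5 : |(x + y) * ((y + z) * (x + z))| ≤ 3 * N * (3 * δ * (3 * δ)) := by
    rw [abs_mul, abs_mul]
    have e1 : |x + y| ≤ 3 * N := abs_le.2 ⟨by linarith, by linarith⟩
    have e2 : |y + z| ≤ 3 * δ := abs_le.2 ⟨by linarith, by linarith⟩
    have e3 : |x + z| ≤ 3 * δ := abs_le.2 ⟨by linarith, by linarith⟩
    gcongr
  have e : -β * (x + y + z) ^ 3 - ((freqY a + freqY b + freqY c) ^ 2 + γ) / (x + y + z) -
      (-β * x ^ 3 - (freqY a ^ 2 + γ) / x) - (-β * y ^ 3 - (freqY b ^ 2 + γ) / y) -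
      (-β * z ^ 3 - (freqY c ^ 2 + γ) / z) = -(3 * β) * ((x + y) * ((y + z) * (x + z))) -
      ((freqY a + freqY b + freqY c) ^ 2 + γ) / (x + y + z) + (freqY a ^ 2 + γ) / x +
      (freqY b ^ 2 + γ) / y + (freqY c ^ 2 + γ) / z := by ring
  rw [e]
  have e2 : ((3 * h) ^ 2 + γ) / (N / 2) + (h ^ 2 + γ) / N + (h ^ 2 + γ) / N + (h ^ 2 + γ) / N =
      (21 * h ^ 2 + 5 * γ) / N := by
    field_simp
    ring
  have e3 : |-(3 * β) * ((x + y) * ((y + z) * (x + z)))| ≤ -(3 * β) * (27 * N * δ ^ 2) := by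
    rw [abs_mul, abs_of_pos (by linarith : 0 < -(3 * β))]
    refine mul_le_mul_of_nonneg_left (k5.trans (le_of_eq (by ring))) (by linarith)
  rw [abs_le] at *
  constructor <;> linarith [k1.1, k1.2, k2.1, k2.2, k3.1, k3.2, k4.1, k4.2, e3.1, e3.2]

theorem re_osc_resonant (R : Regime β γ t N δ h) (hβ : β < 0) (hγ : 0 < γ) (ht : 0 < t)
    {a b c : Plane} (ha : a ∈ plusBox N δ h) (hb : b ∈ plusBox N δ h) (hc : c ∈ minusBox N δ h) :
    19 / 20 * t ≤
      (osc t (phase β γ (a + b + c) - phase β γ a - phase β γ b - phase β γ c)).re := by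
  have h1 := norm_osc_sub_le ht.le
    (phase β γ (a + b + c) - phase β γ a - phase β γ b - phase β γ c)
  have h2 := R.abs_phase_sub_le hβ hγ ha hb hc
  have h3 := R.resonant
  have h4 := (Complex.abs_re_le_norm _).trans h1
  rw [Complex.sub_re, Complex.ofReal_re, abs_le] at h4
  have h5 : t * |phase β γ (a + b + c) - phase β γ a - phase β γ b - phase β γ c| * t ≤
      1 / 20 * t := by
    refine mul_le_mul_of_nonneg_right (le_trans ?_ h3) ht.le
    exact mul_le_mul_of_nonneg_left h2 ht.le
  linarith [h4.1]

/-- The resonance is at least `-3β N² δ / 2`, so `nonresonant` makes `t |R| ≥ 40` and the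
oscillatory integral is at most `2/|R| ≤ t/20`. The lower bound `δ` on the intermediate frequency
comes from the gap between the boxes. -/
theorem norm_osc_nonresonant (R : Regime β γ t N δ h) (hβ : β < 0) (hγ : 0 < γ)
    {m r : Plane} (hm : δ ≤ |freqX m|) (hr : N ≤ |freqX r|) (hmr : N / 2 ≤ |freqX (m + r)|) :
    ‖osc t (phase β γ (m + r) - phase β γ m - phase β γ r)‖ ≤ 1 / 20 * t := by
  have hN := R.one_le
  have hδ := R.width_pos
  have hb : 0 < -(3 * β) := by linarith
  have h1 := abs_resonance_ge (β := β) hγ.le (abs_pos.1 (hδ.trans_le hm))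
    (abs_pos.1 (by linarith : 0 < |freqX r|)) (abs_pos.1 (by linarith : 0 < |freqX (m + r)|))
  have h2 : -(3 * β) * (N / 2 * (δ * N)) ≤ |resonance β γ m r| := by
    refine le_trans (mul_le_mul_of_nonneg_left ?_ hb.le) h1
    rw [abs_mul, abs_mul]
    gcongr
  have h3 : 0 < -(3 * β) * (N / 2 * (δ * N)) := by positivity
  have h4 := norm_osc_le_div t (abs_pos.1 (h3.trans_le h2))
  refine h4.trans ?_
  rw [div_le_iff₀ (h3.trans_le h2)]
  have h5 := R.nonresonant
  have ht : 0 ≤ t := by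
    by_contra hcon
    have : t * (-(3 * β) * N ^ 2 * δ) ≤ 0 :=
      mul_nonpos_of_nonpos_of_nonneg (by linarith) (by positivity)
    linarith
  have h6 : t * (-(3 * β) * (N / 2 * (δ * N))) ≤ t * |resonance β γ m r| :=
    mul_le_mul_of_nonneg_left h2 ht
  linarith

/-- For opposite signs the multiplier is negative, and a lower bound on its modulus is an upper
bound on the resonance factor. The dispersive part contributes at most `41/40` by `width_small`. The
transverse and rotational part, dangerous because `ξ(p + q)` is only of size `δ`, contributes at
most `1/40` by `ratio_small`. Their sum is `21/20`, and `20/21 ≥ 19/20`. -/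
theorem interaction_low (R : Regime β γ t N δ h) (hβ : β < 0) (hγ : 0 < γ) {p q : Plane}
    (hpq : freqX p * freqX q < 0) (hp : |freqX p| ≤ N + 3 * δ) (hq : |freqX q| ≤ N + 3 * δ)
    (hp' : N ≤ |freqX p|) (hq' : N ≤ |freqX q|) (hs : δ ≤ |freqX (p + q)|)
    (hpY : |freqY p| ≤ h) (hqY : |freqY q| ≤ h) :
    interaction β γ p q ≤ -(19 / 20 * (-(3 * β) * N ^ 2)⁻¹) := by
  have hN := R.one_le
  have hδ := R.width_pos
  have hh := R.height_pos
  have hb : 0 < -(3 * β) := by linarith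
  have hw := R.width_small
  have hp0 : freqX p ≠ 0 := abs_pos.1 (by linarith)
  have hq0 : freqX q ≠ 0 := abs_pos.1 (by linarith)
  have hs0 : freqX (p + q) ≠ 0 := abs_pos.1 (by linarith)
  rw [interaction_eq hp0 hq0 hs0]
  set X := (freqY p * freqX q - freqY q * freqX p) ^ 2 +
        γ * (freqX p ^ 2 + freqX p * freqX q + freqX q ^ 2) with hX
  set D := freqX p * freqX q with hD
  set S := freqX (p + q) with hS
  have hXle : X ≤ (4 * h ^ 2 + 3 * γ) * (N + 3 * δ) ^ 2 := by
    have i1 : |freqY p * freqX q - freqY q * freqX p| ≤ 2 * h * (N + 3 * δ) := by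
      refine (abs_sub _ _).trans ?_
      rw [abs_mul, abs_mul]
      have j1 : |freqY p| * |freqX q| ≤ h * (N + 3 * δ) := by gcongr
      have j2 : |freqY q| * |freqX p| ≤ h * (N + 3 * δ) := by gcongr
      linarith
    have i2 : (freqY p * freqX q - freqY q * freqX p) ^ 2 ≤ (2 * h * (N + 3 * δ)) ^ 2 :=
      sq_le_sq' (abs_le.1 i1).1 (abs_le.1 i1).2
    have i3 : freqX p ^ 2 ≤ (N + 3 * δ) ^ 2 := sq_le_sq' (abs_le.1 hp).1 (abs_le.1 hp).2
    have i4 : freqX q ^ 2 ≤ (N + 3 * δ) ^ 2 := sq_le_sq' (abs_le.1 hq).1 (abs_le.1 hq).2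
    have i5 : freqX p ^ 2 + D + freqX q ^ 2 ≤ 3 * (N + 3 * δ) ^ 2 := by
      linarith [sq_nonneg (N + 3 * δ)]
    have i6 := mul_le_mul_of_nonneg_left i5 hγ.le
    linarith
  have hDabs : |D| = -D := abs_of_neg hpq
  have hDlow : N ^ 2 ≤ -D := by
    rw [← hDabs, hD, abs_mul, sq]
    gcongr
  have hDup : -D ≤ (N + 3 * δ) ^ 2 := by
    rw [← hDabs, hD, abs_mul, sq]
    gcongr
  have hS2 : δ ^ 2 ≤ S ^ 2 := by
    rw [← sq_abs S]
    gcongr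
  have hfrac : X / (D * S) ^ 2 * (-D) ≤ 1 / 40 * (-(3 * β) * N ^ 2) := by
    have hDn : D ≠ 0 := by linarith [hpq.ne]
    have hD0 : 0 < -D := by linarith
    have e : X / (D * S) ^ 2 * (-D) = X / (-D * S ^ 2) := by
      field_simp
    rw [e, div_le_iff₀ (by positivity)]
    have g1 : N ^ 2 * δ ^ 2 ≤ -D * S ^ 2 := by gcongr
    have g2 : 0 ≤ 1 / 40 * (-(3 * β) * N ^ 2) := by positivity
    have g3 := mul_le_mul_of_nonneg_left g1 g2
    refine le_trans ?_ g3
    have g4 := R.ratio_small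
    have g5 : (N + 3 * δ) ^ 2 ≤ 4 * N ^ 2 := by linarith [sq_nonneg N]
    have g6 : (4 * h ^ 2 + 3 * γ) * (N + 3 * δ) ^ 2 ≤ (4 * h ^ 2 + 3 * γ) * (4 * N ^ 2) := by
      gcongr
    have g7 := mul_le_mul_of_nonneg_right g4 (sq_nonneg N)
    linarith
  have hden : -(D * (-(3 * β) + X / (D * S) ^ 2)) ≤ 21 / 20 * (-(3 * β) * N ^ 2) := by
    have : -(3 * β) * (-D) ≤ -(3 * β) * (41 / 40 * N ^ 2) :=
      mul_le_mul_of_nonneg_left (hDup.trans hw) hb.le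
    linarith
  have hpos : 0 < -(D * (-(3 * β) + X / (D * S) ^ 2)) := by
    have hf := resonance_factor_ge (β := β) hγ.le p q
    have : 0 < -D * (-(3 * β) + X / (D * S) ^ 2) :=
      mul_pos (by linarith) (hb.trans_le hf)
    linarith
  have hinv := inv_anti₀ hpos hden
  rw [inv_neg] at hinv
  have e : (21 / 20 * (-(3 * β) * N ^ 2))⁻¹ = 20 / 21 * (-(3 * β) * N ^ 2)⁻¹ := by
    rw [mul_inv]; norm_num
  rw [e] at hinv
  have : 0 < (-(3 * β) * N ^ 2)⁻¹ := by positivity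
  linarith

end Regime

theorem continuous_osc (t : ℝ) : Continuous (osc t) := by
  unfold osc
  refine intervalIntegral.continuous_parametric_intervalIntegral_of_continuous' ?_ 0 t
  fun_prop

theorem measurable_cubicKernel (β γ t : ℝ) (k : Plane) : Measurable (cubicKernel β γ t k) := by
  have h1 : Measurable fun z : Plane × Plane => z.1 - z.2 := measurable_fst.sub measurable_snd
  have h2 : Measurable fun z : Plane × Plane => k - z.1 := measurable_const.sub measurable_fst
  have hφ := measurable_phase β γ
  have ho := (continuous_osc t).measurable
  exact (Complex.measurable_ofReal.comp
    ((measurable_interaction β γ).comp (measurable_snd.prodMk h1))).mul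
    ((ho.comp (((measurable_const.sub (hφ.comp measurable_snd)).sub (hφ.comp h1)).sub
      (hφ.comp h2))).sub
      (ho.comp ((measurable_const.sub (hφ.comp measurable_fst)).sub (hφ.comp h2))))

theorem re_ofReal_mul_sub (c : ℝ) (E₁ E₂ : ℂ) :
    ((c : ℂ) * (E₁ - E₂)).re = c * (E₁.re - E₂.re) := by
  rw [Complex.re_ofReal_mul, Complex.sub_re]

namespace Regime

variable {β γ t N δ h : ℝ}

theorem abs_freqY_le {a b : ℝ} {p : Plane} (hp : p ∈ box a b h) : |freqY p| ≤ h :=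
  abs_le.2 ⟨hp.2.1, hp.2.2⟩

/-- The high-frequency interaction: the two frequencies in the positive box interact first. -/
theorem re_cubicKernel_high (R : Regime β γ t N δ h) (hβ : β < 0) (hγ : 0 < γ) (ht : 0 < t)
    {k : Plane} {z : Plane × Plane} (hp : z.2 ∈ plusBox N δ h) (hq : z.1 - z.2 ∈ plusBox N δ h)
    (hr : k - z.1 ∈ minusBox N δ h) :
    (cubicKernel β γ t k z).re ≤ 21 / 20 * ((-(3 * β) * N ^ 2)⁻¹ * t) := by
  have hN := R.one_le
  have hδ := R.width_pos
  have hw := R.width_le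
  have hm : freqX z.1 = freqX z.2 + freqX (z.1 - z.2) := by rw [freqX_sub]; ring
  have hkX : freqX k = freqX z.1 + freqX (k - z.1) := by rw [freqX_sub]; ring
  have hi := abs_interaction_le (γ := γ) hβ hγ.le (by linarith : 0 < N) (R.abs_freqX_plus hp).1
    (R.abs_freqX_plus hq).1
  have hk : z.1 + (k - z.1) = k := by abel
  have h2 := R.norm_osc_nonresonant hβ hγ (m := z.1) (r := k - z.1)
    (le_trans (by linarith [hp.1.1, hq.1.1]) (le_abs_self _)) (R.abs_freqX_minus hr).1
    (by
      rw [hk, hkX, hm]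
      exact le_trans (by linarith [hp.1.1, hq.1.1, hr.1.1]) (le_abs_self _))
  rw [hk] at h2
  have h1 := norm_osc_le ht.le
    (phase β γ k - phase β γ z.2 - phase β γ (z.1 - z.2) - phase β γ (k - z.1))
  rw [cubicKernel]
  -- This ordering has the unfavourable sign, so only an upper bound is needed: at most `t` from the
  -- resonant integral and `t/20` from the nonresonant one.
  refine (Complex.re_le_norm _).trans ?_
  rw [norm_mul, Complex.norm_real, Real.norm_eq_abs]
  have h3 := (norm_sub_le _ _).trans (add_le_add h1 h2)
  have hc0 : 0 ≤ (-(3 * β) * N ^ 2)⁻¹ := (abs_nonneg _).trans hi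
  calc _ ≤ (-(3 * β) * N ^ 2)⁻¹ * (t + 1 / 20 * t) :=
        mul_le_mul hi h3 (norm_nonneg _) hc0
    _ = _ := by ring

/-- The multiplier is negative of relative size at least `19/20`, and the difference of the two
oscillatory integrals has real part at least `(19/20 - 1/20) t`. The product of `19/20` and `18/20`
exceeds `17/20`. -/
theorem re_cubicKernel_low_aux (R : Regime β γ t N δ h) (hβ : β < 0) (hγ : 0 < γ) (ht : 0 < t)
    {k : Plane} {z : Plane × Plane} (hpq : freqX z.2 * freqX (z.1 - z.2) < 0)
    (hp : N ≤ |freqX z.2| ∧ |freqX z.2| ≤ N + 3 * δ)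
    (hq : N ≤ |freqX (z.1 - z.2)| ∧ |freqX (z.1 - z.2)| ≤ N + 3 * δ)
    (hpY : |freqY z.2| ≤ h) (hqY : |freqY (z.1 - z.2)| ≤ h)
    (hm : δ ≤ |freqX z.1|) (hr : N ≤ |freqX (k - z.1)|) (hk' : N / 2 ≤ |freqX k|)
    (hres : 19 / 20 * t ≤
      (osc t (phase β γ k - phase β γ z.2 - phase β γ (z.1 - z.2) - phase β γ (k - z.1))).re) :
    (cubicKernel β γ t k z).re ≤ -(17 / 20 * ((-(3 * β) * N ^ 2)⁻¹ * t)) := by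
  have hN := R.one_le
  have hlm : z.2 + (z.1 - z.2) = z.1 := by abel
  have hk : z.1 + (k - z.1) = k := by abel
  have hi := R.interaction_low hβ hγ hpq hp.2 hq.2 hp.1 hq.1 (by rwa [hlm]) hpY hqY
  have h2 := R.norm_osc_nonresonant hβ hγ hm hr (by rwa [hk])
  rw [hk] at h2
  have h3 := abs_le.1 ((Complex.abs_re_le_norm _).trans h2)
  rw [cubicKernel, re_ofReal_mul_sub]
  set E := (osc t (phase β γ k - phase β γ z.2 - phase β γ (z.1 - z.2) - phase β γ (k - z.1))).re -
    (osc t (phase β γ k - phase β γ z.1 - phase β γ (k - z.1))).re with hE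
  have hE1 : 18 / 20 * t ≤ E := by rw [hE]; linarith [h3.2]
  have hb : 0 < -(3 * β) := by linarith
  have hc0 : 0 < (-(3 * β) * N ^ 2)⁻¹ := by positivity
  set c := (-(3 * β) * N ^ 2)⁻¹
  have hE0 : 0 ≤ E := le_trans (by positivity) hE1
  calc _ ≤ -(19 / 20 * c) * E := mul_le_mul_of_nonneg_right hi hE0
    _ ≤ -(19 / 20 * c) * (18 / 20 * t) :=
        mul_le_mul_of_nonpos_left hE1 (by linarith)
    _ ≤ _ := by nlinarith [mul_pos hc0 ht]

/-- The low-frequency interaction: two frequencies of opposite signs interact first. -/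
theorem re_cubicKernel_low (R : Regime β γ t N δ h) (hβ : β < 0) (hγ : 0 < γ) (ht : 0 < t)
    {k : Plane} {z : Plane × Plane} (hp : z.2 ∈ plusBox N δ h) (hq : z.1 - z.2 ∈ minusBox N δ h)
    (hr : k - z.1 ∈ plusBox N δ h) :
    (cubicKernel β γ t k z).re ≤ -(17 / 20 * ((-(3 * β) * N ^ 2)⁻¹ * t)) := by
  have hN := R.one_le
  have hδ := R.width_pos
  have hw := R.width_le
  have hm : freqX z.1 = freqX z.2 + freqX (z.1 - z.2) := by rw [freqX_sub]; ring
  have hkX : freqX k = freqX z.1 + freqX (k - z.1) := by rw [freqX_sub]; ring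
  have hres := R.re_osc_resonant hβ hγ ht hp hr hq
  rw [show z.2 + (k - z.1) + (z.1 - z.2) = k by abel, sub_right_comm (phase β γ k - _)] at hres
  refine R.re_cubicKernel_low_aux hβ hγ ht ?_ (R.abs_freqX_plus hp) (R.abs_freqX_minus hq)
    (abs_freqY_le hp) (abs_freqY_le hq) ?_ (R.abs_freqX_plus hr).1 ?_ hres
  · exact mul_neg_of_pos_of_neg (by linarith [hp.1.1]) (by linarith [hq.1.2])
  · exact le_trans (by linarith [hp.1.2, hq.1.2]) (neg_le_abs _)
  · exact le_trans (by linarith [hp.1.1, hq.1.1, hr.1.1]) (le_abs_self _)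

theorem re_cubicKernel_low' (R : Regime β γ t N δ h) (hβ : β < 0) (hγ : 0 < γ) (ht : 0 < t)
    {k : Plane} {z : Plane × Plane} (hp : z.2 ∈ minusBox N δ h) (hq : z.1 - z.2 ∈ plusBox N δ h)
    (hr : k - z.1 ∈ plusBox N δ h) :
    (cubicKernel β γ t k z).re ≤ -(17 / 20 * ((-(3 * β) * N ^ 2)⁻¹ * t)) := by
  have hN := R.one_le
  have hδ := R.width_pos
  have hw := R.width_le
  have hm : freqX z.1 = freqX z.2 + freqX (z.1 - z.2) := by rw [freqX_sub]; ring
  have hkX : freqX k = freqX z.1 + freqX (k - z.1) := by rw [freqX_sub]; ring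
  have hres := R.re_osc_resonant hβ hγ ht hq hr hp
  rw [show z.1 - z.2 + (k - z.1) + z.2 = k by abel, sub_right_comm,
    sub_right_comm (phase β γ k)] at hres
  refine R.re_cubicKernel_low_aux hβ hγ ht ?_ (R.abs_freqX_minus hp) (R.abs_freqX_plus hq)
    (abs_freqY_le hp) (abs_freqY_le hq) ?_ (R.abs_freqX_plus hr).1 ?_ hres
  · exact mul_neg_of_neg_of_pos (by linarith [hp.1.2]) (by linarith [hq.1.1])
  · exact le_trans (by linarith [hp.1.2, hq.1.2]) (neg_le_abs _)
  · exact le_trans (by linarith [hp.1.1, hq.1.1, hr.1.1]) (le_abs_self _)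

end Regime

/-! ### The initial values -/

/-- The sum of the indicator functions of the two boxes. -/
def twoBoxes (N δ h : ℝ) (k : Plane) : ℝ :=
  boxInd N (N + δ) h k + boxInd (-(N + 3 * δ)) (-(N + 2 * δ)) h k

/-- The Fourier transform of the initial value. -/
def twoBoxesC (N δ h : ℝ) (k : Plane) : ℂ := twoBoxes N δ h k

theorem measurable_twoBoxesC (N δ h : ℝ) : Measurable (twoBoxesC N δ h) :=
  Complex.measurable_ofReal.comp ((measurable_boxInd _ _ _).add (measurable_boxInd _ _ _))

theorem integrable_twoBoxesC (N δ h : ℝ) : Integrable (twoBoxesC N δ h) :=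
  ((integrable_boxInd _ _ _).add (integrable_boxInd _ _ _)).ofReal

theorem norm_twoBoxesC (N δ h : ℝ) (k : Plane) : ‖twoBoxesC N δ h k‖ = twoBoxes N δ h k := by
  rw [twoBoxesC, Complex.norm_real, Real.norm_of_nonneg]
  exact add_nonneg (boxInd_nonneg _ _ _ _) (boxInd_nonneg _ _ _ _)

theorem exists_le_decay (T N δ h : ℝ) (hN : 0 ≤ N) (hδ : 0 ≤ δ) (hh : 0 ≤ h) :
    ∃ K, ∀ k, ‖twoBoxesC N δ h k‖ ≤ K * decay T 0 k := by
  set B := N + 3 * δ + h with hB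
  have hB0 : 0 ≤ B := by positivity
  set d := Real.exp (-2 * B) * ((1 + B ^ 2) ^ 2)⁻¹ with hd
  have hd0 : 0 < d := by positivity
  have hk : ∀ k : Plane, |freqX k| ≤ N + 3 * δ → |freqY k| ≤ h → d ≤ decay T 0 k := by
    intro k h1 h2
    have hn : ‖k‖ ≤ B := by
      have hpi : 1 ≤ 2 * Real.pi := by linarith [Real.pi_gt_three]
      have e1 : |k 0| ≤ |freqX k| := by
        rw [freqX, abs_mul, abs_of_pos (by positivity : 0 < 2 * Real.pi)]
        exact le_mul_of_one_le_left (abs_nonneg _) hpi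
      have e2 : |k 1| ≤ |freqY k| := by
        rw [freqY, abs_mul, abs_of_pos (by positivity : 0 < 2 * Real.pi)]
        exact le_mul_of_one_le_left (abs_nonneg _) hpi
      rw [EuclideanSpace.norm_eq, Fin.sum_univ_two]
      refine Real.sqrt_le_iff.2 ⟨hB0, ?_⟩
      simp only [Real.norm_eq_abs]
      have e3 : |k 0| + |k 1| ≤ B := by linarith
      nlinarith [abs_nonneg (k 0), abs_nonneg (k 1)]
    unfold decay polyDecay
    rw [hd]
    simp only [zero_div, sub_zero]
    refine mul_le_mul (Real.exp_le_exp.2 (by linarith)) ?_ (by positivity) (Real.exp_pos _).le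
    gcongr
  refine ⟨2 * d⁻¹, fun k => ?_⟩
  rw [norm_twoBoxesC]
  by_cases hm : |freqX k| ≤ N + 3 * δ ∧ |freqY k| ≤ h
  · have h1 := hk k hm.1 hm.2
    have h2 : twoBoxes N δ h k ≤ 2 := by
      have := add_le_add (boxInd_le_one N (N + δ) h k)
        (boxInd_le_one (-(N + 3 * δ)) (-(N + 2 * δ)) h k)
      unfold twoBoxes
      linarith
    refine h2.trans ?_
    rw [mul_assoc]
    have : 1 ≤ d⁻¹ * decay T 0 k := by
      rw [inv_mul_eq_div, one_le_div hd0]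
      exact h1
    linarith
  · have h1 : k ∉ box N (N + δ) h := by
      rintro ⟨⟨a1, a2⟩, a3⟩
      exact hm ⟨abs_le.2 ⟨by linarith, by linarith⟩, abs_le.2 a3⟩
    have h2 : k ∉ box (-(N + 3 * δ)) (-(N + 2 * δ)) h := by
      rintro ⟨⟨a1, a2⟩, a3⟩
      exact hm ⟨abs_le.2 ⟨by linarith, by linarith⟩, abs_le.2 a3⟩
    rw [twoBoxes, boxInd_of_notMem h1, boxInd_of_notMem h2, add_zero]
    have := decay_pos T 0 k
    positivity

theorem twoBoxes_cases {N δ h : ℝ} (hN : 0 < N) (hδ : 0 < δ) (k : Plane) :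
    (k ∈ plusBox N δ h ∧ boxInd N (N + δ) h k = 1 ∧
      boxInd (-(N + 3 * δ)) (-(N + 2 * δ)) h k = 0) ∨
    (k ∈ minusBox N δ h ∧ boxInd N (N + δ) h k = 0 ∧
      boxInd (-(N + 3 * δ)) (-(N + 2 * δ)) h k = 1) ∨
    (boxInd N (N + δ) h k = 0 ∧ boxInd (-(N + 3 * δ)) (-(N + 2 * δ)) h k = 0) := by
  by_cases h1 : k ∈ plusBox N δ h
  · have h2 : k ∉ minusBox N δ h := fun h2 => by linarith [h1.1.1, h2.1.2]
    exact Or.inl ⟨h1, boxInd_of_mem h1, boxInd_of_notMem h2⟩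
  · by_cases h2 : k ∈ minusBox N δ h
    · exact Or.inr (Or.inl ⟨h2, boxInd_of_notMem h1, boxInd_of_mem h2⟩)
    · exact Or.inr (Or.inr ⟨boxInd_of_notMem h1, boxInd_of_notMem h2⟩)

namespace Regime

variable {β γ t N δ h : ℝ}

theorem norm_twoBoxesC_le_one (R : Regime β γ t N δ h) (k : Plane) :
    ‖twoBoxesC N δ h k‖ ≤ 1 := by
  rw [norm_twoBoxesC, twoBoxes]
  rcases twoBoxes_cases (h := h) (by linarith [R.one_le] : 0 < N) R.width_pos k with
    ⟨-, h1, h2⟩ | ⟨-, h1, h2⟩ | ⟨h1, h2⟩ <;> rw [h1, h2] <;> norm_num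

theorem le_abs_freqX (R : Regime β γ t N δ h) (k : Plane) (hk : twoBoxesC N δ h k ≠ 0) :
    N ≤ |freqX k| := by
  rcases twoBoxes_cases (h := h) (by linarith [R.one_le] : 0 < N) R.width_pos k with
    ⟨h0, h1, h2⟩ | ⟨h0, h1, h2⟩ | ⟨h1, h2⟩
  · exact (R.abs_freqX_plus h0).1
  · exact (R.abs_freqX_minus h0).1
  · exact absurd (by rw [twoBoxesC, twoBoxes, h1, h2]; simp) hk

/-- For output frequencies just below `N`, only two positive inputs and one negative input can
contribute: the other sign patterns have sums near `3N`, `-N` or `-3N`. The three remaining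
orderings are estimated by the kernel bounds. -/
theorem re_integrand_le (R : Regime β γ t N δ h) (hβ : β < 0) (hγ : 0 < γ) (ht : 0 < t)
    {k : Plane} (hk : freqX k ∈ Icc (N - 2 * δ) (N - δ)) (z : Plane × Plane) :
    (twoBoxesC N δ h z.2 * twoBoxesC N δ h (z.1 - z.2) * twoBoxesC N δ h (k - z.1) *
      cubicKernel β γ t k z).re ≤ (-(3 * β) * N ^ 2)⁻¹ * t *
      (21 / 20 * (boxInd N (N + δ) h z.2 * boxInd N (N + δ) h (z.1 - z.2) *
          boxInd (-(N + 3 * δ)) (-(N + 2 * δ)) h (k - z.1)) -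
        17 / 20 * (boxInd N (N + δ) h z.2 *
          boxInd (-(N + 3 * δ)) (-(N + 2 * δ)) h (z.1 - z.2) * boxInd N (N + δ) h (k - z.1)) -
        17 / 20 * (boxInd (-(N + 3 * δ)) (-(N + 2 * δ)) h z.2 *
          boxInd N (N + δ) h (z.1 - z.2) * boxInd N (N + δ) h (k - z.1))) := by
  have hN := R.one_le
  have hδ := R.width_pos
  have hw := R.width_le
  have hsum : freqX k = freqX z.2 + freqX (z.1 - z.2) + freqX (k - z.1) := by
    rw [freqX_sub, freqX_sub]; ring
  have hk1 := hk.1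
  have hk2 := hk.2
  have kh := R.re_cubicKernel_high (k := k) (z := z) hβ hγ ht
  have kl := R.re_cubicKernel_low (k := k) (z := z) hβ hγ ht
  have kl' := R.re_cubicKernel_low' (k := k) (z := z) hβ hγ ht
  set C := (-(3 * β) * N ^ 2)⁻¹ * t
  unfold twoBoxesC twoBoxes
  rcases twoBoxes_cases (h := h) (by linarith : 0 < N) hδ z.2 with
    ⟨p0, p1, p2⟩ | ⟨p0, p1, p2⟩ | ⟨p1, p2⟩ <;>
  rcases twoBoxes_cases (h := h) (by linarith : 0 < N) hδ (z.1 - z.2) with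
    ⟨q0, q1, q2⟩ | ⟨q0, q1, q2⟩ | ⟨q1, q2⟩ <;>
  rcases twoBoxes_cases (h := h) (by linarith : 0 < N) hδ (k - z.1) with
    ⟨r0, r1, r2⟩ | ⟨r0, r1, r2⟩ | ⟨r1, r2⟩ <;>
  rw [p1, p2, q1, q2, r1, r2] <;>
  norm_num
  -- What remains are the eight patterns with all three frequencies in boxes, from `+++` to `---`.
  -- Three are the admissible orderings and five contradict the range of `ξ(k)`.
  · linarith [p0.1.1, q0.1.1, r0.1.1]
  · linarith [kh p0 q0 r0]
  · linarith [kl p0 q0 r0]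
  · linarith [p0.1.2, q0.1.2, r0.1.2]
  · linarith [kl' p0 q0 r0]
  · linarith [p0.1.2, q0.1.2, r0.1.2]
  · linarith [p0.1.2, q0.1.2, r0.1.2]
  · linarith [p0.1.2, q0.1.2, r0.1.2]

end Regime

/-! ### Lower bound for the cubic term and conclusion -/

/-- The volume of the boxes that enter the lower bound for the triple convolution. -/
def coreVolume (δ h : ℝ) : ℝ := δ * h / (8 * (2 * Real.pi) ^ 2)

namespace Regime

variable {β γ t N δ h : ℝ}

theorem integrable_integrand (R : Regime β γ t N δ h) (hβ : β < 0) (hγ : 0 < γ) (ht : 0 < t)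
    (k : Plane) : Integrable fun z : Plane × Plane =>
      twoBoxesC N δ h z.2 * twoBoxesC N δ h (z.1 - z.2) * twoBoxesC N δ h (k - z.1) *
        cubicKernel β γ t k z := by
  have hN : 0 < N := by linarith [R.one_le]
  have hi := integrable_twoBoxesC N δ h
  have hm := measurable_twoBoxesC N δ h
  set c := (-(3 * β) * N ^ 2)⁻¹ with hc
  have hb : 0 < -(3 * β) := by linarith
  have hc0 : 0 < c := by positivity
  have hdom : Integrable (fun z : Plane × Plane =>
      c * (t + t) * (‖twoBoxesC N δ h (k - z.1)‖ * ‖twoBoxesC N δ h z.2‖)) :=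
    (Integrable.mul_prod (f := fun x : Plane => ‖twoBoxesC N δ h (k - x)‖)
      (g := fun x : Plane => ‖twoBoxesC N δ h x‖) (hi.comp_sub_left k).norm hi.norm).const_mul _
  refine hdom.mono' ?_ (ae_of_all _ fun z => ?_)
  · exact ((((hm.comp measurable_snd).mul (hm.comp (measurable_fst.sub measurable_snd))).mul
      (hm.comp (measurable_const.sub measurable_fst))).mul
        (measurable_cubicKernel β γ t k)).aestronglyMeasurable
  · by_cases hz : twoBoxesC N δ h z.2 * twoBoxesC N δ h (z.1 - z.2) = 0
    · rw [hz, zero_mul, zero_mul, norm_zero]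
      positivity
    have h1 := abs_interaction_le (γ := γ) hβ hγ.le hN
      (R.le_abs_freqX _ (left_ne_zero_of_mul hz)) (R.le_abs_freqX _ (right_ne_zero_of_mul hz))
    have h2 := R.norm_twoBoxesC_le_one (z.1 - z.2)
    have h3 : ‖cubicKernel β γ t k z‖ ≤ c * (t + t) := by
      rw [cubicKernel, norm_mul, Complex.norm_real, Real.norm_eq_abs]
      exact mul_le_mul h1 ((norm_sub_le _ _).trans
        (add_le_add (norm_osc_le ht.le _) (norm_osc_le ht.le _))) (norm_nonneg _) hc0.le
    rw [norm_mul, norm_mul, norm_mul]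
    calc _ ≤ ‖twoBoxesC N δ h z.2‖ * 1 * ‖twoBoxesC N δ h (k - z.1)‖ * (c * (t + t)) := by
          gcongr
      _ = _ := by ring

/-- Two inputs are restricted to a concentric box of a quarter of the width and height. Their sum
has `ξ` in `2N + [3/4, 5/4] δ`, so the third frequency falls in `-N + [-3, -2] δ`, exactly the
negative box; in `η` the total is at most `h/2 + h/2`. -/
theorem coreVolume_sq_le (R : Regime β γ t N δ h) {k : Plane}
    (hk : k ∈ box (N - 7 / 4 * δ) (N - 5 / 4 * δ) (h / 2)) :
    coreVolume δ h ^ 2 ≤ tripleConv (boxInd N (N + δ) h) (boxInd N (N + δ) h)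
      (boxInd (-(N + 3 * δ)) (-(N + 2 * δ)) h) k := by
  have hδ := R.width_pos
  have hh := R.height_pos
  have hv : ∫ p, boxInd (N + 3 / 8 * δ) (N + 5 / 8 * δ) (h / 4) p = coreVolume δ h := by
    rw [integral_boxInd, volume_real_box (by linarith) (by linarith), coreVolume]
    have := Real.pi_pos
    field_simp
    ring
  have h1 := mul_self_integral_le_tripleConv
    (unitIntegrable_boxInd (N + 3 / 8 * δ) (N + 5 / 8 * δ) (h / 4))
    (unitIntegrable_boxInd N (N + δ) h)
    (unitIntegrable_boxInd (-(N + 3 * δ)) (-(N + 2 * δ)) h) k ?_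
  · rwa [hv, ← sq] at h1
  intro p q
  by_cases hp : p ∈ box (N + 3 / 8 * δ) (N + 5 / 8 * δ) (h / 4)
  swap
  · rw [boxInd_of_notMem hp, zero_mul]
    exact mul_nonneg (mul_nonneg (boxInd_nonneg _ _ _ _) (boxInd_nonneg _ _ _ _))
      (boxInd_nonneg _ _ _ _)
  by_cases hq : q ∈ box (N + 3 / 8 * δ) (N + 5 / 8 * δ) (h / 4)
  swap
  · rw [boxInd_of_notMem hq, mul_zero]
    exact mul_nonneg (mul_nonneg (boxInd_nonneg _ _ _ _) (boxInd_nonneg _ _ _ _))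
      (boxInd_nonneg _ _ _ _)
  obtain ⟨⟨p1, p2⟩, p3, p4⟩ := hp
  obtain ⟨⟨q1, q2⟩, q3, q4⟩ := hq
  obtain ⟨⟨k1, k2⟩, k3, k4⟩ := hk
  have m1 : p ∈ box N (N + δ) h := ⟨⟨by linarith, by linarith⟩, by linarith, by linarith⟩
  have m2 : q ∈ box N (N + δ) h := ⟨⟨by linarith, by linarith⟩, by linarith, by linarith⟩
  have m3 : k - (p + q) ∈ box (-(N + 3 * δ)) (-(N + 2 * δ)) h := by
    refine ⟨?_, ?_⟩
    · rw [freqX_sub, freqX_add]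
      constructor <;> linarith
    · rw [freqY_sub, freqY_add]
      constructor <;> linarith
  rw [boxInd_of_mem m1, boxInd_of_mem m2, boxInd_of_mem m3, mul_one, mul_one]
  exact mul_le_one₀ (boxInd_le_one _ _ _ _) (boxInd_nonneg _ _ _ _) (boxInd_le_one _ _ _ _)

/-- The three orderings have the same triple convolution, so the signed sum is at most `21/20 -
17/20 - 17/20 = -13/20` times it, which is below `-1/2`. The outer derivative contributes `|ξ| ≥
N/2`. -/
theorem norm_cubicTerm_ge (R : Regime β γ t N δ h) (hβ : β < 0) (hγ : 0 < γ) (ht : 0 < t)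
    {k : Plane} (hk : k ∈ box (N - 7 / 4 * δ) (N - 5 / 4 * δ) (h / 2)) :
    t * coreVolume δ h ^ 2 / (2 * -(3 * β) * N) ≤
      ‖cubicTerm β γ (freeEvol β γ (twoBoxesC N δ h)) t k‖ := by
  have hN := R.one_le
  have hδ := R.width_pos
  have hw := R.width_le
  have hb : 0 < -(3 * β) := by linarith
  have hkX : freqX k ∈ Icc (N - 2 * δ) (N - δ) := ⟨by linarith [hk.1.1], by linarith [hk.1.2]⟩
  rw [cubicTerm_freeEvol hβ hγ.le (by linarith : 0 < N) (measurable_twoBoxesC N δ h)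
    (integrable_twoBoxesC N δ h) R.norm_twoBoxesC_le_one R.le_abs_freqX]
  set J := ∫ z : Plane × Plane, twoBoxesC N δ h z.2 * twoBoxesC N δ h (z.1 - z.2) *
    twoBoxesC N δ h (k - z.1) * cubicKernel β γ t k z with hJ
  set u := boxInd N (N + δ) h with hu
  set w := boxInd (-(N + 3 * δ)) (-(N + 2 * δ)) h with hw'
  have Hu : UnitIntegrable u := unitIntegrable_boxInd _ _ _
  have Hw : UnitIntegrable w := unitIntegrable_boxInd _ _ _
  set C := (-(3 * β) * N ^ 2)⁻¹ * t with hC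
  have hC0 : 0 < C := by positivity
  have hV := R.coreVolume_sq_le hk
  set V := tripleConv u u w k with hVdef
  have e1 : tripleConv w u u k = V := tripleConv_reverse Hw Hu Hu k
  have e2 : tripleConv u w u k = V := by rw [tripleConv_swap_left Hu Hw Hu, e1]
  have hi := R.integrable_integrand hβ hγ ht k
  have i1 := (integrable_tripleConv Hu Hu Hw k).const_mul (21 / 20)
  have i2 := (integrable_tripleConv Hu Hw Hu k).const_mul (17 / 20)
  have i3 := (integrable_tripleConv Hw Hu Hu k).const_mul (17 / 20)
  have hre : J.re ≤ C * (21 / 20 * V - 17 / 20 * V - 17 / 20 * V) := by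
    have h1 : J.re = ∫ z : Plane × Plane, (twoBoxesC N δ h z.2 * twoBoxesC N δ h (z.1 - z.2) *
        twoBoxesC N δ h (k - z.1) * cubicKernel β γ t k z).re := by
      rw [hJ]
      exact (integral_re hi).symm
    rw [h1]
    refine (integral_mono hi.re (((i1.sub i2).sub i3).const_mul C)
      (R.re_integrand_le hβ hγ ht hkX)).trans (le_of_eq ?_)
    rw [integral_const_mul]
    congr 1
    have s1 := integral_sub (i1.sub i2) i3
    have s2 := integral_sub i1 i2
    simp only [Pi.sub_apply] at s1 s2 ⊢
    rw [s1, s2, integral_const_mul, integral_const_mul, integral_const_mul]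
    change 21 / 20 * V - 17 / 20 * tripleConv u w u k - 17 / 20 * tripleConv w u u k = _
    rw [e1, e2]
  have hJn : 1 / 2 * C * coreVolume δ h ^ 2 ≤ ‖J‖ := by
    have h1 := (neg_le_abs _).trans (Complex.abs_re_le_norm J)
    have h2 := mul_le_mul_of_nonneg_left hV hC0.le
    have h3 : 0 ≤ C * coreVolume δ h ^ 2 := by positivity
    linarith
  rw [norm_neg, norm_mul, norm_mul, norm_mul, norm_mul, norm_cexp_I_mul_mul, mul_one,
    Complex.norm_I, one_mul, Complex.norm_real, Real.norm_eq_abs, Complex.norm_ofNat]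
  have hkX' : N / 2 ≤ |freqX k| := le_trans (by linarith [hkX.1]) (le_abs_self _)
  calc _ = 2 * (N / 2) * (1 / 2 * C * coreVolume δ h ^ 2) := by
        rw [hC]
        field_simp
    _ ≤ _ := by gcongr

theorem norm_sq_cubicTerm_ge {s T K : ℝ} (R : Regime β γ t N δ h) (hβ : β < 0) (hγ : 0 < γ)
    (ht : t ∈ Ioc 0 T) (hs : s ≤ 0)
    (hK : ∀ k, ‖twoBoxesC N δ h k‖ ≤ K * decay T 0 k) :
    4 * coreVolume δ h * ((2 * N) ^ s * (t * coreVolume δ h ^ 2 / (2 * -(3 * β) * N))) ^ 2 ≤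
      ‖sobolevOf s 0 (cubicTerm β γ (freeEvol β γ (twoBoxesC N δ h)) t)‖ ^ 2 := by
  have hT : 0 < T := ht.1.trans_le ht.2
  have ht' : t ∈ Icc 0 T := ⟨ht.1.le, ht.2⟩
  have hN := R.one_le
  have hδ := R.width_pos
  have hh := R.height_pos
  have hw := R.width_le
  have hb : 0 < -(3 * β) := by linarith
  have hL : Adm T K (freeEvol β γ (twoBoxesC N δ h)) :=
    adm_freeEvol β γ hT (measurable_twoBoxesC N δ h) hK
  have hA : Adm T _ (cubicTerm β γ (freeEvol β γ (twoBoxesC N δ h))) :=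
    (hL.duhamelOp β γ hT (hL.duhamelOp β γ hT hL)).const_mul 2
  have hmw := hA.memLp_weight_mul_of_nonpos hT hs ht'
  rw [norm_sq_sobolevOf (hA.memLp hT ht') hmw]
  set O := box (N - 7 / 4 * δ) (N - 5 / 4 * δ) (h / 2) with hO
  set x := (2 * N) ^ s * (t * coreVolume δ h ^ 2 / (2 * -(3 * β) * N)) with hx
  have hc0 : 0 ≤ coreVolume δ h := by unfold coreVolume; positivity
  have hx0 : 0 ≤ x := by
    have := ht.1
    positivity
  have hvol : volume.real O = 4 * coreVolume δ h := by
    rw [hO, volume_real_box (by linarith) (by linarith), coreVolume]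
    have := Real.pi_pos
    field_simp
    ring
  have hint : Integrable fun k => (weight s 0 k *
      ‖cubicTerm β γ (freeEvol β γ (twoBoxesC N δ h)) t k‖) ^ 2 := by
    have := (memLp_two_iff_integrable_sq_norm hmw.1).1 hmw
    refine this.congr (ae_of_all _ fun k => ?_)
    simp only [norm_mul, Complex.norm_real, Real.norm_of_nonneg (weight_pos s 0 _).le]
  have hind : ∫ k, O.indicator (fun _ => x ^ 2) k = 4 * coreVolume δ h * x ^ 2 := by
    rw [integral_indicator_const _ (measurableSet_box _ _ _), hvol, smul_eq_mul]
  rw [← hind]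
  refine integral_mono ((integrable_indicator_iff (measurableSet_box _ _ _)).2
    (integrableOn_const (volume_box_lt_top _ _ _).ne)) hint fun k => ?_
  by_cases hk : k ∈ O
  swap
  · rw [indicator_of_notMem hk]
    positivity
  rw [indicator_of_mem hk]
  refine pow_le_pow_left₀ hx0 ?_ 2
  have h1 := R.norm_cubicTerm_ge hβ hγ ht.1 hk
  have hwk : (2 * N) ^ s ≤ weight s 0 k := by
    unfold weight
    rw [Real.rpow_zero, mul_one]
    refine Real.rpow_le_rpow_of_nonpos (by positivity) ?_ hs
    rw [abs_of_pos (by linarith [hk.1.1])]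
    linarith [hk.1.2]
  have hpos : 0 ≤ t * coreVolume δ h ^ 2 / (2 * -(3 * β) * N) := by
    have := ht.1
    positivity
  exact mul_le_mul hwk h1 hpos (weight_pos s 0 k).le

theorem norm_sq_initial_le {s T K : ℝ} (R : Regime β γ t N δ h) (hT : 0 < T) (hs : s ≤ 0)
    (hK : ∀ k, ‖twoBoxesC N δ h k‖ ≤ K * decay T 0 k) :
    ‖sobolevOf s 0 (twoBoxesC N δ h)‖ ^ 2 ≤ (N ^ s) ^ 2 * (32 * coreVolume δ h) := by
  have h0 : (0 : ℝ) ∈ Icc 0 T := ⟨le_rfl, hT.le⟩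
  have hN := R.one_le
  have hδ := R.width_pos
  have hh := R.height_pos
  have hL : Adm T K (freeEvol β γ (twoBoxesC N δ h)) :=
    adm_freeEvol β γ hT (measurable_twoBoxesC N δ h) hK
  have hL0 : freeEvol β γ (twoBoxesC N δ h) 0 = twoBoxesC N δ h := by
    ext k; simp [freeEvol]
  have hfm : MemLp (twoBoxesC N δ h) 2 volume := hL0 ▸ hL.memLp hT h0
  have hfw : MemLp (fun k => (weight s 0 k : ℂ) * twoBoxesC N δ h k) 2 volume :=
    hL0 ▸ hL.memLp_weight_mul_of_nonpos hT hs h0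
  rw [norm_sq_sobolevOf hfm hfw]
  have hi := (integrable_boxInd N (N + δ) h).add
    (integrable_boxInd (-(N + 3 * δ)) (-(N + 2 * δ)) h)
  have hv : ∫ k, (boxInd N (N + δ) h + boxInd (-(N + 3 * δ)) (-(N + 2 * δ)) h) k =
      32 * coreVolume δ h := by
    simp only [Pi.add_apply]
    rw [integral_add (integrable_boxInd _ _ _) (integrable_boxInd _ _ _), integral_boxInd,
      integral_boxInd, volume_real_box (by linarith) hh.le, volume_real_box (by linarith) hh.le,
      coreVolume]
    have := Real.pi_pos
    field_simp
    ring
  rw [← hv, ← integral_const_mul]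
  refine integral_mono_of_nonneg (ae_of_all _ fun k => sq_nonneg _) (hi.const_mul _)
    (ae_of_all _ fun k => ?_)
  have e : (boxInd N (N + δ) h + boxInd (-(N + 3 * δ)) (-(N + 2 * δ)) h) k = ‖twoBoxesC N δ h k‖ :=
    (norm_twoBoxesC N δ h k).symm
  simp only [e]
  by_cases hz : twoBoxesC N δ h k = 0
  · simp [hz]
  have h1 := R.norm_twoBoxesC_le_one k
  have h2 := R.le_abs_freqX k hz
  have hwk : weight s 0 k ≤ N ^ s := by
    unfold weight
    rw [Real.rpow_zero, mul_one]
    exact Real.rpow_le_rpow_of_nonpos (by linarith) (by linarith) hs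
  have hw0 := (weight_pos s 0 k).le
  rw [mul_pow]
  have h3 : ‖twoBoxesC N δ h k‖ ^ 2 ≤ ‖twoBoxesC N δ h k‖ := by
    rw [sq]
    exact mul_le_of_le_one_left (norm_nonneg _) h1
  gcongr

end Regime

/-- If the solution map is `C³`, then the frequency boxes of all almost resonant parameters have
bounded volume relative to the frequency. -/
theorem exists_bound_of_cubic_bound {β γ s T t C : ℝ} (hβ : β < 0) (hγ : 0 < γ) (hs : s ≤ 0)
    (ht : t ∈ Ioc 0 T)
    (hC : ∀ f : Plane → ℂ, Measurable f → (∃ K, ∀ k, ‖f k‖ ≤ K * decay T 0 k) →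
      ‖sobolevOf s 0 (cubicTerm β γ (freeEvol β γ f) t)‖ ≤ C * ‖sobolevOf s 0 f‖ ^ 3) :
    ∃ B : ℝ, ∀ N δ h, Regime β γ t N δ h → (δ * h) ^ 2 * N ^ (-4 * s - 2) ≤ B := by
  have hb : 0 < -(3 * β) := by linarith
  have hT : 0 < T := ht.1.trans_le ht.2
  have ht0 := ht.1
  have hpi := Real.pi_pos
  set v := (8 * (2 * Real.pi) ^ 2)⁻¹ with hv
  have hv0 : 0 < v := by positivity
  set q := 4 * (2 ^ s) ^ 2 * (t / (2 * -(3 * β))) ^ 2 * v ^ 2 with hq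
  have hq0 : 0 < q := by positivity
  refine ⟨C ^ 2 * 32 ^ 3 / q, fun N δ h R => ?_⟩
  have hN := R.one_le
  have hδ := R.width_pos
  have hh := R.height_pos
  have hN0 : 0 < N := by linarith
  obtain ⟨K, hK⟩ := exists_le_decay T N δ h hN0.le hδ.le hh.le
  have h1 := R.norm_sq_cubicTerm_ge hβ hγ ht hs hK
  have h2 := R.norm_sq_initial_le hT hs hK
  have h3 := hC _ (measurable_twoBoxesC N δ h) ⟨K, hK⟩
  set A := coreVolume δ h with hA
  have hA0 : 0 < A := by rw [hA, coreVolume]; positivity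
  have hAv : A = δ * h * v := by rw [hA, coreVolume, hv, div_eq_mul_inv]
  have h4 : 4 * A * ((2 * N) ^ s * (t * A ^ 2 / (2 * -(3 * β) * N))) ^ 2 ≤
      C ^ 2 * ((N ^ s) ^ 2 * (32 * A)) ^ 3 := by
    refine h1.trans ?_
    calc _ ≤ (C * ‖sobolevOf s 0 (twoBoxesC N δ h)‖ ^ 3) ^ 2 :=
          pow_le_pow_left₀ (norm_nonneg _) h3 2
      _ = C ^ 2 * (‖sobolevOf s 0 (twoBoxesC N δ h)‖ ^ 2) ^ 3 := by ring
      _ ≤ _ := by gcongr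
  have hNs : 0 < N ^ s := Real.rpow_pos_of_pos hN0 s
  have e1 : (2 * N) ^ s = 2 ^ s * N ^ s := Real.mul_rpow (by norm_num) hN0.le
  have e2 : N ^ (-4 * s - 2) = ((N ^ s) ^ 4)⁻¹ * (N ^ 2)⁻¹ := by
    rw [sub_eq_add_neg, Real.rpow_add hN0, Real.rpow_neg hN0.le, Real.rpow_two,
      show -4 * s = -(s * (4 : ℕ)) by push_cast; ring, Real.rpow_neg hN0.le, Real.rpow_mul hN0.le,
      Real.rpow_natCast]
  rw [le_div_iff₀ hq0, e2, hq]
  rw [e1] at h4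
  set X := N ^ s with hX
  -- Up to constants, `A⁵ X² / N² ≤ A³ X⁶` with `X = N ^ s`. Dividing by `A³ X⁶` leaves `A²
  -- N^(-4s-2)`.
  have h5 : A ^ 3 * X ^ 6 * (4 * (2 ^ s) ^ 2 * (t / (2 * -(3 * β))) ^ 2 * A ^ 2 *
      ((X ^ 4)⁻¹ * (N ^ 2)⁻¹)) ≤ A ^ 3 * X ^ 6 * (C ^ 2 * 32 ^ 3) := by
    calc _ = 4 * A * (2 ^ s * X * (t * A ^ 2 / (2 * -(3 * β) * N))) ^ 2 := by
          field_simp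
      _ ≤ _ := h4
      _ = _ := by ring
  have h6 := le_of_mul_le_mul_left h5 (by positivity)
  rw [hAv] at h6
  refine le_trans (le_of_eq ?_) h6
  ring

/-- Near resonance needs `N δ² → 0` and `h²/N → 0`, which puts both exponents just below the
critical `∓1/2`. The additional requirement `h² ≪ N² δ²` is why `h` loses `2σ` while `δ` loses `σ`:
then `N δ² = N^(-2σ)`, `h²/N = N^(-4σ)` and `h²/(N² δ²) = N^(-2σ)`. The nonresonance quantity `N² δ
= N^(3/2 - σ)` is large with room to spare. -/
theorem eventually_regime {β γ t σ : ℝ} (hβ : β < 0) (ht : 0 < t) (hσ : 0 < σ)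
    (hσ' : σ ≤ 1 / 8) :
    ∀ᶠ N : ℝ in atTop, Regime β γ t N (N ^ (-(1 / 2) - σ)) (N ^ (1 / 2 - 2 * σ)) := by
  have hb : 0 < -(3 * β) := by linarith
  have zero : ∀ a : ℝ, 0 < a → Tendsto (fun N : ℝ => N ^ (-a)) atTop (𝓝 0) := fun a ha =>
    tendsto_rpow_neg_atTop ha
  have hratio : ∀ᶠ N : ℝ in atTop,
      4 * (4 * N ^ (-(2 * σ)) + 3 * γ * N ^ (-(1 - 2 * σ))) ≤ 1 / 40 * -(3 * β) := by
    have h1 := (((zero (2 * σ) (by linarith)).const_mul 4).add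
      ((zero (1 - 2 * σ) (by linarith)).const_mul (3 * γ))).const_mul 4
    refine h1.eventually_le_const ?_
    simp only [mul_zero, add_zero]
    positivity
  have hnon : ∀ᶠ N : ℝ in atTop, 80 ≤ t * -(3 * β) * N ^ (3 / 2 - σ) :=
    ((tendsto_rpow_atTop (by linarith : 0 < 3 / 2 - σ)).const_mul_atTop
      (mul_pos ht hb)).eventually_ge_atTop 80
  have hres : ∀ᶠ N : ℝ in atTop, t * (-(3 * β) * (27 * N ^ (-(2 * σ))) +
      (21 * N ^ (-(4 * σ)) + 5 * γ * N ^ (-1 : ℝ))) ≤ 1 / 20 := by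
    have h1 := ((((zero (2 * σ) (by linarith)).const_mul 27).const_mul (-(3 * β))).add
      (((zero (4 * σ) (by linarith)).const_mul 21).add
        ((zero 1 one_pos).const_mul (5 * γ)))).const_mul t
    refine h1.eventually_le_const ?_
    simp only [mul_zero, add_zero]
    norm_num
  filter_upwards [hratio, hnon, hres, eventually_ge_atTop 300] with N h1 h2 h3 hN
  have hN0 : 0 < N := by linarith
  have eδ : (N ^ (-(1 / 2) - σ)) ^ 2 = N ^ (-1 - 2 * σ) := by
    rw [← Real.rpow_natCast, ← Real.rpow_mul hN0.le]
    congr 1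
    push_cast
    ring
  have eh : (N ^ (1 / 2 - 2 * σ)) ^ 2 = N ^ (1 - 4 * σ) := by
    rw [← Real.rpow_natCast, ← Real.rpow_mul hN0.le]
    congr 1
    push_cast
    ring
  have e2 : N ^ 2 = N ^ (2 : ℝ) := (Real.rpow_two N).symm
  have hδ1 : N ^ (-(1 / 2) - σ) ≤ 1 :=
    Real.rpow_le_one_of_one_le_of_nonpos (by linarith) (by linarith)
  have hδ0 : 0 < N ^ (-(1 / 2) - σ) := Real.rpow_pos_of_pos hN0 _
  refine ⟨by linarith, hδ0, Real.rpow_pos_of_pos hN0 _, ?_, ?_, ?_, ?_⟩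
  -- Since `δ ≤ 1` and `N ≥ 300`, one has `3δ ≤ N/100`, and `1.01² ≤ 41/40`.
  · have h5 : (N + 3 * N ^ (-(1 / 2) - σ)) ^ 2 ≤ (101 / 100 * N) ^ 2 :=
      pow_le_pow_left₀ (by positivity) (by linarith) 2
    nlinarith [sq_nonneg N]
  · have h5 := mul_le_mul_of_nonneg_right h1 (Real.rpow_pos_of_pos hN0 (1 - 2 * σ)).le
    have e5 : N ^ (-(2 * σ)) * N ^ (1 - 2 * σ) = N ^ (1 - 4 * σ) := by
      rw [← Real.rpow_add hN0]; congr 1; ring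
    have e6 : N ^ (-(1 - 2 * σ)) * N ^ (1 - 2 * σ) = 1 := by
      rw [← Real.rpow_add hN0, neg_add_cancel, Real.rpow_zero]
    have e7 : N ^ 2 * N ^ (-1 - 2 * σ) = N ^ (1 - 2 * σ) := by
      rw [e2, ← Real.rpow_add hN0]; congr 1; ring
    rw [eδ, eh, mul_assoc (-(3 * β)), e7]
    linear_combination h5 - 16 * e5 - 12 * γ * e6
  · have e5 : N ^ 2 * N ^ (-(1 / 2) - σ) = N ^ (3 / 2 - σ) := by
      rw [e2, ← Real.rpow_add hN0]; congr 1; ring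
    rw [mul_assoc (-(3 * β)), e5, ← mul_assoc]
    exact h2
  · have e5 : N * N ^ (-1 - 2 * σ) = N ^ (-(2 * σ)) := by
      rw [← Real.rpow_one_add' hN0.le (by linarith)]; congr 1; ring
    have e6 : N ^ (1 - 4 * σ) / N = N ^ (-(4 * σ)) := by
      rw [← Real.rpow_sub_one hN0.ne']; congr 1; ring
    rw [eδ, eh, mul_assoc 27, e5, add_div, mul_div_assoc, e6, div_eq_mul_inv (5 * γ),
      ← Real.rpow_neg_one]
    exact h3

end RMKP

end

theorem theorem1p3 (β γ s₁ T : ℝ) (hβ : β < 0) (hγ : 0 < γ) (hs : s₁ < -(1 / 2)) (hT : 0 < T)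
    (Φ : ℝ → RMKP.Sobolev s₁ 0 → RMKP.Sobolev s₁ 0) (hΦ : RMKP.IsSolutionMap β γ s₁ T Φ) :
    ∀ t ∈ Set.Ioc 0 T, ¬ ContDiffAt ℝ 3 (Φ t) 0 := by
  intro t ht hd
  obtain ⟨C, hC⟩ := hΦ.exists_cubic_bound (by linarith) hT ⟨ht.1.le, ht.2⟩ hd
  obtain ⟨B, hB⟩ := RMKP.exists_bound_of_cubic_bound hβ hγ (by linarith) ht hC
  -- With `δh = N^(-3σ)` the bounded quantity is `N^(-4s₁ - 2 - 6σ)`. This `σ` spends at most half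
  -- of the available exponent `-4s₁ - 2 > 0`, so the quantity is unbounded.
  set σ : ℝ := min ((-1 - 2 * s₁) / 6) (1 / 8) with hσ
  have hσ0 : 0 < σ := lt_min (by linarith) (by norm_num)
  have hσ1 : σ ≤ (-1 - 2 * s₁) / 6 := min_le_left _ _
  have hbig : Tendsto (fun N : ℝ => N ^ (-4 * s₁ - 2 - 6 * σ)) atTop atTop :=
    tendsto_rpow_atTop (by linarith)
  obtain ⟨N, hR, hN, hN1⟩ := ((RMKP.eventually_regime (γ := γ) hβ ht.1 hσ0 (min_le_right _ _)).and
    ((hbig.eventually_gt_atTop B).and (eventually_ge_atTop 1))).exists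
  have hN0 : 0 < N := by linarith
  refine absurd (hB _ _ _ hR) (not_le.2 (hN.trans_le (le_of_eq ?_)))
  rw [← Real.rpow_add hN0, ← Real.rpow_natCast, ← Real.rpow_mul hN0.le, ← Real.rpow_add hN0]
  congr 1
  push_cast
  ring
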